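/- **Conventions.** Graphs are finite, undirected, without loops or multiple edges; a weighted graph has an integer attached to each vertex. $\mathbb{Z}^*$ is the set of finite sequences of integers, $X^-$ is the reversal of $X\in\mathbb{Z}^*$, and $\varnothing$ is the empty sequence. *Sequences.* The blowings-up of $(x_1,\dots,x_n)$, $n\ge1$, are $(-1,x_1-1,x_2,\dots,x_n)$, $(x_1,\dots,x_i-1,-1,x_{i+1}-1,\dots,x_n)$ for $1\le i<n$, and $(x_1,\dots,x_{n-1},x_n-1,-1)$; the blowing-up of $\varnothing$ is $(-1)$. Let $\sim$ be the equivalence relation on $\mathbb{Z}^*$ generated by blowing-up. For $X=(x_1,\dots,x_n)$ let $\det X=\det(-M)$, where $M$ is the $n\times n$ matrix with diagonal $x_1,\dots,x_n$, entries $1$ immediately above and below the diagonal and $0$ elsewhere ($\det\varnothing=1$); $\det$ is constant on equivalence classes. A sequence is *canonical* if it is of the form $(0,\dots,0,a_1,\dots,a_k)$ with $r\ge0$ zeros, all $a_i<-1$, and $r$ even if $k>0$. *Paths.* For a forest $G$, let $P(G)$ be the set of sequences $\gamma=(v_0,\dots,v_n)$ of vertices such that either $n=0$ and $\deg v_0=0$,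 or $n>0$, the $v_i$ are distinct, consecutive ones are adjacent, and $\{i:\deg v_i\ne2\}=\{0,n\}$; $\gamma^-$ denotes the reversal. $\gamma$ has type $(+,+)$ if $\deg v_0>2$ and $\deg v_n>2$, and type $(+,-)$ if $\deg v_0>2$ and $\deg v_n<2$. If $G$ is a weighted forest, $W_G(\gamma)\in\mathbb{Z}^*$ is the sequence of weights of those $v_i$ (in order) with $\deg v_i<3$. $G$ is *pseudo-minimal* if every $\gamma\in P(G)$ with $W_G(\gamma)\sim\varnothing$ is of type $(+,+)$; $G$ is *canonical* if for each $\gamma\in P(G)$ at least one of $W_G(\gamma),W_G(\gamma^-)$ is canonical. *Skeletal maps.* Write $\mathrm{Vtx}_{\neq2}(G)$, $\mathrm{Vtx}_{>2}(G)$ for the sets of vertices of degree $\ne2$, $>2$. A *skeletal map* $f:G\dashrightarrow G'$ of forests is a map $f:\mathrm{Vtx}_{\ne2}(G)\to\mathrm{Vtx}_{\ne2}(G')$ such that (i) for each $\gamma=(v_0,\dots,v_m)\in P(G)$ there is $\gamma'\in P(G')$ (necessarily unique, denoted $\vec f(\gamma)$) that starts at $f(v_0)$ and ends at $f(v_m)$;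 (ii) $\vec f:P(G)\to P(G')$ is surjective; (iii) if $u\ne v$ and $f(u)=f(v)$, some element of $P(G)$ starts at $u$ and ends at $v$. For weighted forests, these notions refer to the underlying forests. A *skeleton* is a forest with no vertex of degree $0$ or $2$. *Strict blowing-down.* A weighted forest $G'$ is a strict blowing-down of $G$ if, up to isomorphism of weighted graphs, $G$ is obtained from $G'$ either (a) by choosing a vertex $v$ with $\deg(v,G')\le1$, adding a vertex $e$ of weight $-1$ and an edge $\{e,v\}$, and decreasing the weight of $v$ by $1$, or (b) by choosing an edge $\{v_1,v_2\}$, deleting it, adding a vertex $e$ of weight $-1$ and edges $\{v_1,e\},\{e,v_2\}$, and decreasing the weights of $v_1$ and $v_2$ by $1$. The blowing-down map $\pi:\mathrm{Vtx}_{\ne2}(G)\to\mathrm{Vtx}_{\ne2}(G')$ fixes every vertex other than $e$ and, in case (a), sends $e$ to $v$. **Setting.** Fix a skeleton $S$. Let $\mathrm{FO}^+(S)$ be the set of pairs $(\sigma,G)$ where $G$ is a pseudo-minimal weighted forest and $\sigma:S\dashrightarrow G$ is skeletal. $(\sigma',G')$ is a *blowing-down* of $(\sigma,G)$ if $G'$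 is a strict blowing-down of $G$ and $\pi\circ\sigma=\sigma'$ for a blowing-down map $\pi$. Let $\sim$ be the equivalence relation on $\mathrm{FO}^+(S)$ generated by blowings-down, where pairs are taken up to isomorphism ($(\sigma,G)$ and $(f\circ\sigma,G')$ are isomorphic if $f:G\to G'$ is an isomorphism of weighted graphs). An *edge map* is a map $W:P(S)\to\mathbb{Z}^*$ with $W(\gamma^-)=W(\gamma)^-$ for all $\gamma$ and such that $W(\gamma)\sim\varnothing$ implies that $\gamma$ is of type $(+,+)$. Let $\Omega(S)$ be the set of equivalence classes of edge maps, where $W,W'$ are equivalent if $W(\gamma)\sim W'(\gamma)$ for all $\gamma\in P(S)$. For $\omega\in\Omega(S)$ let $\omega(\gamma)=\{W(\gamma):W\in\omega\}$, an equivalence class of sequences, which has a well-defined determinant. Let $(S,\omega)^\sharp$ be the forest with vertex set $\mathrm{Vtx}_{>2}(S)$ whose edges are the pairs $\{u,v\}$ with $\gamma=(u,v)\in P(S)$ and $\det\omega(\gamma)=0$. A vertex $u$ of it is *special* if there is $\gamma=(u,v)\in P(S)$ of type $(+,-)$ with $\det\omega(\gamma)=0$. Let $Z(S,\omega)$ be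 the module of all $z:\mathrm{Vtx}_{>2}(S)\to\mathbb{Z}$ such that $\sum_{v\in C}z(v)=0$ for every connected component $C$ of $(S,\omega)^\sharp$ without special vertices, put $N(S,\omega)=\mathbb{Z}^{\mathrm{Vtx}_{>2}(S)}/Z(S,\omega)$, and let $\mathfrak{X}(S)=\{(\omega,\eta):\omega\in\Omega(S),\ \eta\in N(S,\omega)\}$. For $(\sigma,G)\in\mathrm{FO}^+(S)$, $W_G\circ\vec\sigma$ is an edge map; let $\mathrm{FO}^+(S,\omega)$ be the set of pairs with $W_G\circ\vec\sigma\in\omega$, and define $\bar T:\mathrm{FO}^+(S,\omega)\to\omega\times N(S,\omega)$ by $\bar T(\sigma,G)=(W_G\circ\vec\sigma,\ \text{class of } w)$, where $w(v)$ is the weight of $\sigma(v)$ in $G$ for $v\in\mathrm{Vtx}_{>2}(S)$. **Theorem.** There is a unique surjective map $Q:\mathrm{FO}^+(S)\to\mathfrak{X}(S)$ satisfying: 1. for all $(\sigma,G),(\sigma',G')\in\mathrm{FO}^+(S)$: $(\sigma,G)\sim(\sigma',G')\iff Q(\sigma,G)=Q(\sigma',G')$; 2. for every $(\sigma,G)\in\mathrm{FO}^+(S)$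 such that $G$ is a canonical forest, if $\omega$ is the element of $\Omega(S)$ with $(\sigma,G)\in\mathrm{FO}^+(S,\omega)$ and $\bar T(\sigma,G)=(W,\eta)$, then $Q(\sigma,G)=(\omega,\eta)$. -/

import Mathlib

universe u v

noncomputable section

namespace Blowing

/-! ## Finite sequences of integers -/

/-- `SeqBlowUp X X'` : the sequence `X'` is a blowing-up of the sequence `X`. -/
inductive SeqBlowUp : List ℤ → List ℤ → Prop
  | empty : SeqBlowUp [] [-1]
  | left (x : ℤ) (l : List ℤ) : SeqBlowUp (x :: l) (-1 :: (x - 1) :: l)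
  | middle (l : List ℤ) (x y : ℤ) (r : List ℤ) :
      SeqBlowUp (l ++ x :: y :: r) (l ++ (x - 1) :: -1 :: (y - 1) :: r)
  | right (l : List ℤ) (x : ℤ) : SeqBlowUp (l ++ [x]) (l ++ [x - 1, -1])

/-- Equivalence of sequences: the equivalence relation generated by blowing-up. -/
def SeqEquiv : List ℤ → List ℤ → Prop := Relation.EqvGen SeqBlowUp

/-- A canonical sequence `(0^r, A)`: all terms of `A` are `< -1`, and `r` is even if `A ≠ ∅`. -/
def IsCanonicalSeq (C : List ℤ) : Prop :=
  ∃ (r : ℕ) (A : List ℤ), C = List.replicate r 0 ++ A ∧ (∀ a ∈ A, a < -1) ∧ (A ≠ [] → Even r)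

/-- The determinant of a sequence `X`, i.e. `det (-M)` where `M` is the matrix of the intersection
form of the linear chain `[X]` (weights on the diagonal, `1` for consecutive vertices, `0`
elsewhere). It is `1` for the empty sequence. -/
def seqDet (X : List ℤ) : ℤ := by
  classical
  exact (-(Matrix.diagonal X.get + (SimpleGraph.pathGraph X.length).adjMatrix ℤ)).det

/-! ## Graphs, the sequences `P(G)`, skeletal maps -/

section Graphs

variable {V : Type u} {V' : Type v}

/-- The degree of a vertex (all our graphs are finite). -/
def deg (G : SimpleGraph V) (x : V) : ℕ := (G.neighborSet x).ncard

/-- The vertices of degree different from `2`. -/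
abbrev VtxNe2 (G : SimpleGraph V) : Type u := {x : V // deg G x ≠ 2}

/-- The vertices of degree greater than `2`. -/
abbrev VtxGt2 (G : SimpleGraph V) : Type u := {x : V // 2 < deg G x}

/-- The inclusion of the vertices of degree `> 2` in those of degree `≠ 2`. -/
def VtxGt2.toNe2 {G : SimpleGraph V} (x : VtxGt2 G) : VtxNe2 G := ⟨x.1, x.2.ne'⟩

/-- The condition on `(v_0, …, v_n)` defining the set `P(G)`: either `n = 0` and `v_0` has degree
zero, or `n > 0`, the `v_i` are distinct, consecutive ones are adjacent, and `v_i` has degree `≠ 2`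
exactly for `i = 0` and `i = n`. -/
def IsPSeq (G : SimpleGraph V) (l : List V) : Prop :=
  (∃ x, l = [x] ∧ deg G x = 0) ∨
  (1 < l.length ∧ l.Nodup ∧ l.IsChain G.Adj ∧
    ∀ (i : ℕ) (h : i < l.length), deg G l[i] ≠ 2 ↔ (i = 0 ∨ i + 1 = l.length))

theorem IsPSeq.ne_nil {G : SimpleGraph V} {l : List V} (h : IsPSeq G l) : l ≠ [] := by
  rcases h with ⟨x, rfl, -⟩ | ⟨h, -⟩
  · simp
  · rintro rfl
    simp at h

theorem IsPSeq.reverse {G : SimpleGraph V} {l : List V} (h : IsPSeq G l) :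
    IsPSeq G l.reverse := by
  rcases h with ⟨x, rfl, hx⟩ | ⟨h1, h2, h3, h4⟩
  · exact Or.inl ⟨x, by simp, hx⟩
  · refine Or.inr ⟨by simpa using h1, by simpa using h2, ?_, ?_⟩
    · rw [List.isChain_reverse]
      exact h3.imp fun a b hab => hab.symm
    · intro i hi
      rw [List.getElem_reverse, h4]
      simp only [List.length_reverse] at hi ⊢
      omega

theorem IsPSeq.deg_head {G : SimpleGraph V} {l : List V} (h : IsPSeq G l) :
    deg G (l.head h.ne_nil) ≠ 2 := by
  rcases h with ⟨x, rfl, hx⟩ | ⟨h1, h2, h3, h4⟩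
  · simp [hx]
  · rw [List.head_eq_getElem, h4]
    simp

theorem IsPSeq.deg_getLast {G : SimpleGraph V} {l : List V} (h : IsPSeq G l) :
    deg G (l.getLast h.ne_nil) ≠ 2 := by
  rcases h with ⟨x, rfl, hx⟩ | ⟨h1, h2, h3, h4⟩
  · simp [hx]
  · rw [List.getLast_eq_getElem, h4]
    omega

/-- The set `P(G)`. -/
@[ext] structure PSeq (G : SimpleGraph V) where
  verts : List V
  isPSeq : IsPSeq G verts

namespace PSeq

variable {G : SimpleGraph V}

/-- The first vertex `v_0` of `γ`. -/
def first (γ : PSeq G) : VtxNe2 G := ⟨γ.verts.head γ.isPSeq.ne_nil, γ.isPSeq.deg_head⟩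

/-- The last vertex `v_n` of `γ`. -/
def last (γ : PSeq G) : VtxNe2 G := ⟨γ.verts.getLast γ.isPSeq.ne_nil, γ.isPSeq.deg_getLast⟩

/-- The reversal `γ⁻` of `γ`. -/
def rev (γ : PSeq G) : PSeq G := ⟨γ.verts.reverse, γ.isPSeq.reverse⟩

/-- `γ` is of type `(+,+)`. -/
def IsTypePlusPlus (γ : PSeq G) : Prop := 2 < deg G γ.first.1 ∧ 2 < deg G γ.last.1

/-- `γ` is of type `(+,-)`. -/
def IsTypePlusMinus (γ : PSeq G) : Prop := 2 < deg G γ.first.1 ∧ deg G γ.last.1 < 2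

theorem rev_first (γ : PSeq G) : γ.rev.first = γ.last := by
  simp [first, last, rev]

theorem rev_last (γ : PSeq G) : γ.rev.last = γ.first := by
  simp [first, last, rev]

end PSeq

/-- A pre-skeletal map from `G` to `G'`. -/
def IsPreSkeletal {G : SimpleGraph V} {G' : SimpleGraph V'} (f : VtxNe2 G → VtxNe2 G') : Prop :=
  ∀ γ : PSeq G, ∃ γ' : PSeq G', f γ.first = γ'.first ∧ f γ.last = γ'.last

/-- The map `P(G) → P(G')` induced by a pre-skeletal map. (When `G'` is a forest the
sequence `γ'` is unique, see `PSeq.eq_of_ends`.) -/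
def vec {G : SimpleGraph V} {G' : SimpleGraph V'} (f : VtxNe2 G → VtxNe2 G')
    (hf : IsPreSkeletal f) (γ : PSeq G) : PSeq G' := (hf γ).choose

/-- A skeletal map from `G` to `G'`. -/
structure IsSkeletal {G : SimpleGraph V} {G' : SimpleGraph V'} (f : VtxNe2 G → VtxNe2 G') :
    Prop where
  isPreSkeletal : IsPreSkeletal f
  surjective : Function.Surjective (vec f isPreSkeletal)
  joined : ∀ x y, x ≠ y → f x = f y → ∃ γ : PSeq G, γ.first = x ∧ γ.last = y

/-! ### Facts needed to know that `W_G ∘ σ⃗` is an edge map -/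

theorem vec_first {G : SimpleGraph V} {G' : SimpleGraph V'} (f : VtxNe2 G → VtxNe2 G')
    (hf : IsPreSkeletal f) (γ : PSeq G) : (vec f hf γ).first = f γ.first :=
  (hf γ).choose_spec.1.symm

theorem vec_last {G : SimpleGraph V} {G' : SimpleGraph V'} (f : VtxNe2 G → VtxNe2 G')
    (hf : IsPreSkeletal f) (γ : PSeq G) : (vec f hf γ).last = f γ.last :=
  (hf γ).choose_spec.2.symm

theorem IsPSeq.nodup {G : SimpleGraph V} {l : List V} (h : IsPSeq G l) : l.Nodup := by
  rcases h with ⟨x, rfl, -⟩ | ⟨-, h, -⟩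
  · simp
  · exact h

theorem IsPSeq.isChain {G : SimpleGraph V} {l : List V} (h : IsPSeq G l) : l.IsChain G.Adj := by
  rcases h with ⟨x, rfl, -⟩ | ⟨-, -, h, -⟩
  · simp
  · exact h

theorem PSeq.deg_eq_zero {G : SimpleGraph V} (γ : PSeq G) (h : γ.first = γ.last) :
    deg G γ.first.1 = 0 := by
  obtain ⟨l, hl⟩ := γ
  rcases id hl with ⟨x, rfl, hx⟩ | ⟨h1, h2, -, -⟩
  · simpa [PSeq.first] using hx
  · simp only [PSeq.first, PSeq.last, Subtype.mk.injEq] at h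
    rw [List.head_eq_getElem, List.getLast_eq_getElem, h2.getElem_inj_iff] at h
    omega

theorem PSeq.eq_of_ends {G : SimpleGraph V} (hG : G.IsAcyclic) (γ γ' : PSeq G)
    (h1 : γ.first = γ'.first) (h2 : γ.last = γ'.last) : γ = γ' := by
  obtain ⟨l, hl⟩ := γ
  obtain ⟨l', hl'⟩ := γ'
  simp only [PSeq.first, PSeq.last, Subtype.mk.injEq] at h1 h2
  have e1 := SimpleGraph.Walk.support_ofSupport hl.ne_nil hl.isChain
  have e2 := SimpleGraph.Walk.support_ofSupport hl'.ne_nil hl'.isChain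
  have p1 : (SimpleGraph.Walk.ofSupport l hl.ne_nil hl.isChain).IsPath := by
    rw [SimpleGraph.Walk.isPath_def, e1]; exact hl.nodup
  have p2 : ((SimpleGraph.Walk.ofSupport l' hl'.ne_nil hl'.isChain).copy h1.symm h2.symm).IsPath := by
    rw [SimpleGraph.Walk.isPath_def, SimpleGraph.Walk.support_copy, e2]; exact hl'.nodup
  have := congrArg (fun p => p.1.support)
    ((hG.subsingleton_path _ _).elim ⟨_, p1⟩ ⟨_, p2⟩)
  simp only [SimpleGraph.Walk.support_copy] at this
  rw [e1, e2] at this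
  ext1
  exact this

theorem exists_pSeq_aux [Finite V] {G : SimpleGraph V} (hG : G.IsAcyclic) {a z : V}
    (hz : deg G z ≠ 2) (n : ℕ) :
    ∀ (x y : V) (t : List V), Nat.card V ≤ (x :: y :: t).length + n → (x :: y :: t).Nodup →
      (x :: y :: t).IsChain G.Adj → (∃ m, x :: y :: t = m ++ [a, z]) →
      (∀ (i : ℕ) (h : i < (x :: y :: t).length), i ≠ 0 → i + 1 ≠ (x :: y :: t).length →
        deg G (x :: y :: t)[i] = 2) →
      ∃ (γ : PSeq G) (m : List V), γ.verts = m ++ [a, z] := by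
  induction n with
  | zero =>
    intro x y t hc hnd hch hm hd
    by_cases hx : deg G x = 2
    · exfalso
      have hall : ∀ w, w ∈ x :: y :: t := by
        classical
        have : Fintype V := Fintype.ofFinite V
        have h1 : (x :: y :: t).toFinset = Finset.univ := by
          apply Finset.eq_univ_of_card
          apply le_antisymm (Finset.card_le_univ _)
          rw [List.toFinset_card_of_nodup hnd, ← Nat.card_eq_fintype_card]
          simpa using hc
        intro w
        rw [← List.mem_toFinset, h1]
        simp
      obtain ⟨w, hw, hwy⟩ : ∃ w ∈ G.neighborSet x, w ≠ y := by
        apply Set.exists_ne_of_one_lt_ncard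
        change 1 < deg G x
        omega
      have hp : (SimpleGraph.Walk.ofSupport (x :: y :: t) (by simp) hch).IsPath := by
        rw [SimpleGraph.Walk.isPath_def, SimpleGraph.Walk.support_ofSupport]; exact hnd
      have := hG.eq_snd_of_adj_start hp hw
        (by rw [SimpleGraph.Walk.support_ofSupport]; exact hall w)
      exact hwy (this.trans (SimpleGraph.Walk.getVert_zero _))
    · refine ⟨⟨x :: y :: t, Or.inr ⟨by simp, hnd, hch, ?_⟩⟩, hm⟩
      intro i hi
      refine ⟨fun h => ?_, ?_⟩
      · by_contra hcon
        push Not at hcon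
        exact h (hd i hi hcon.1 hcon.2)
      · rintro (rfl | h)
        · simpa using hx
        · obtain ⟨m, hm⟩ := hm
          have : (x :: y :: t)[i] = z := by
            obtain rfl : i = (x :: y :: t).length - 1 := by omega
            rw [← List.getLast_eq_getElem (by simp)]
            simp [hm]
          rw [this]
          exact hz
  | succ n ih =>
    intro x y t hc hnd hch hm hd
    by_cases hx : deg G x = 2
    · obtain ⟨w, hw, hwy⟩ : ∃ w ∈ G.neighborSet x, w ≠ y := by
        apply Set.exists_ne_of_one_lt_ncard
        change 1 < deg G x
        omega
      have hp : (SimpleGraph.Walk.ofSupport (x :: y :: t) (by simp) hch).IsPath := by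
        rw [SimpleGraph.Walk.isPath_def, SimpleGraph.Walk.support_ofSupport]; exact hnd
      have hwn : w ∉ x :: y :: t := by
        intro hmem
        have := hG.eq_snd_of_adj_start hp hw
          (by rw [SimpleGraph.Walk.support_ofSupport]; exact hmem)
        exact hwy (this.trans (SimpleGraph.Walk.getVert_zero _))
      refine ih w x (y :: t) ?_ ?_ ?_ ?_ ?_
      · simp only [List.length_cons] at hc ⊢
        omega
      · exact List.nodup_cons.2 ⟨hwn, hnd⟩
      · exact List.isChain_cons_cons.2 ⟨SimpleGraph.Adj.symm hw, hch⟩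
      · obtain ⟨m, hm⟩ := hm
        exact ⟨w :: m, by simp [hm]⟩
      · intro i hi h0 h1
        obtain ⟨j, rfl⟩ := Nat.exists_eq_succ_of_ne_zero h0
        rcases Nat.eq_zero_or_pos j with rfl | hj
        · simpa using hx
        · have := hd j (by simpa using hi) hj.ne' (by simpa using h1)
          simpa using this
    · refine ⟨⟨x :: y :: t, Or.inr ⟨by simp, hnd, hch, ?_⟩⟩, hm⟩
      intro i hi
      refine ⟨fun h => ?_, ?_⟩
      · by_contra hcon
        push Not at hcon
        exact h (hd i hi hcon.1 hcon.2)
      · rintro (rfl | h)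
        · simpa using hx
        · obtain ⟨m, hm⟩ := hm
          have : (x :: y :: t)[i] = z := by
            obtain rfl : i = (x :: y :: t).length - 1 := by omega
            rw [← List.getLast_eq_getElem (by simp)]
            simp [hm]
          rw [this]
          exact hz

theorem exists_pSeq [Finite V] {G : SimpleGraph V} (hG : G.IsAcyclic) {a z : V}
    (hz : deg G z ≠ 2) (haz : G.Adj a z) :
    ∃ (γ : PSeq G) (m : List V), γ.verts = m ++ [a, z] := by
  refine exists_pSeq_aux hG hz (Nat.card V) a z [] (by omega) (by simpa using haz.ne)
    (by simpa using haz) ⟨[], by simp⟩ ?_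
  intro i hi h0 h1
  simp at hi h1
  omega

theorem IsSkeletal.two_lt_deg [Finite V'] {S : SimpleGraph V} {G : SimpleGraph V'}
    (hG : G.IsAcyclic) (hS : ∀ x, deg S x ≠ 0 ∧ deg S x ≠ 2)
    {σ : VtxNe2 S → VtxNe2 G} (hσ : IsSkeletal σ) (x : VtxNe2 S) (hx : 2 < deg G (σ x).1) :
    2 < deg S x.1 := by
  by_contra hcon
  have hx1 : deg S x.1 = 1 := by
    have := hS x.1
    omega
  obtain ⟨p, hp⟩ := Set.ncard_eq_one.1 hx1
  -- every element of `P(S)` ending at a vertex over `σ x` is `(p, x)`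
  have key : ∀ δ : PSeq S, (vec σ hσ.isPreSkeletal δ).last = σ x → δ.verts = [p, x.1] := by
    intro δ hδ
    rw [vec_last] at hδ
    have hlast : δ.last = x := by
      by_contra hne
      obtain ⟨γ, h1, h2⟩ := hσ.joined _ _ hne hδ
      have := (vec σ hσ.isPreSkeletal γ).deg_eq_zero (by rw [vec_first, vec_last, h1, h2, hδ])
      rw [vec_first, h1, hδ] at this
      omega
    obtain ⟨l, hl⟩ := δ
    have hl' := congrArg Subtype.val hlast
    simp only [PSeq.last] at hl'
    rcases id hl with ⟨y, rfl, hy⟩ | ⟨h1, h2, h3, h4⟩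
    · exact absurd hy (hS y).1
    · have hlen : l.length = 2 := by
        have := (h4 1 h1).1 (hS _).2
        omega
      obtain ⟨b, c, rfl⟩ := List.length_eq_two.1 hlen
      simp at hl' h3
      subst hl'
      have : b ∈ S.neighborSet x.1 := h3.symm
      rw [hp] at this
      simp only [Set.mem_singleton_iff] at this
      simp [this]
  obtain ⟨a, ha, b, hb, hab⟩ := (Set.one_lt_ncard (s := G.neighborSet (σ x).1)
    (Set.toFinite _)).1 (by change 1 < deg G _; omega)
  obtain ⟨γ, m, hγ⟩ := exists_pSeq hG (σ x).2 (SimpleGraph.Adj.symm ha)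
  obtain ⟨γ', m', hγ'⟩ := exists_pSeq hG (σ x).2 (SimpleGraph.Adj.symm hb)
  obtain ⟨δ, rfl⟩ := hσ.surjective γ
  obtain ⟨δ', rfl⟩ := hσ.surjective γ'
  have e1 := key δ (Subtype.ext (by simp [PSeq.last, hγ]))
  have e2 := key δ' (Subtype.ext (by simp [PSeq.last, hγ']))
  obtain rfl : δ = δ' := PSeq.ext (e1.trans e2.symm)
  rw [hγ'] at hγ
  have := (List.append_inj' hγ (by simp)).2
  simp at this
  exact hab this.symm

end Graphs

/-! ## Weighted graphs, weighted forests and skeletons -/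

/-- A (finite) weighted graph. -/
structure WeightedGraph where
  V : Type v
  finite : Finite V
  graph : SimpleGraph V
  weight : V → ℤ

/-- A (finite) weighted forest. -/
structure WeightedForest extends WeightedGraph.{v} where
  isAcyclic : graph.IsAcyclic

/-- A skeleton: a (finite) forest without vertices of degree zero or two. -/
structure Skeleton where
  V : Type u
  finite : Finite V
  graph : SimpleGraph V
  isAcyclic : graph.IsAcyclic
  deg_ne : ∀ x, deg graph x ≠ 0 ∧ deg graph x ≠ 2

attribute [instance] WeightedGraph.finite Skeleton.finite

namespace WeightedGraph

/-- Isomorphism of weighted graphs. -/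
structure Iso (G H : WeightedGraph.{v}) where
  toIso : G.graph ≃g H.graph
  weight_eq : ∀ x, H.weight (toIso x) = G.weight x

open Classical in
/-- The blowing-up of `G` at the vertex `v`; the created vertex is `none`. -/
def blowUpVertex (G : WeightedGraph.{v}) (v : G.V) : WeightedGraph.{v} where
  V := Option G.V
  finite := inferInstance
  graph :=
    { Adj := fun
        | some x, some y => G.graph.Adj x y
        | some x, none => x = v
        | none, some y => y = v
        | none, none => False
      symm := ⟨by rintro (_ | x) (_ | y) h <;> first | exact h | exact SimpleGraph.Adj.symm h⟩
      loopless := ⟨by rintro (_ | x) h <;> first | exact h | exact G.graph.loopless.irrefl _ h⟩ }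
  weight := fun
    | some x => if x = v then G.weight x - 1 else G.weight x
    | none => -1

open Classical in
/-- The blowing-up of `G` at the edge `{v₁, v₂}` (used only when `v₁` and `v₂` are adjacent);
the created vertex is `none`. -/
def blowUpEdge (G : WeightedGraph.{v}) (v₁ v₂ : G.V) : WeightedGraph.{v} where
  V := Option G.V
  finite := inferInstance
  graph :=
    { Adj := fun
        | some x, some y => G.graph.Adj x y ∧ s(x, y) ≠ s(v₁, v₂)
        | some x, none => x = v₁ ∨ x = v₂
        | none, some y => y = v₁ ∨ y = v₂
        | none, none => False
      symm := ⟨by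
        rintro (_ | x) (_ | y) h
        · exact h
        · exact h
        · exact h
        · exact ⟨SimpleGraph.Adj.symm h.1, by rw [Sym2.eq_swap]; exact h.2⟩⟩
      loopless := ⟨by
        rintro (_ | x) h
        · exact h
        · exact G.graph.loopless.irrefl _ h.1⟩ }
  weight := fun
    | some x => if x = v₁ ∨ x = v₂ then G.weight x - 1 else G.weight x
    | none => -1

end WeightedGraph

namespace WeightedForest

/-- The map `W_G : P(G) → ℤ*`: the sequence of the weights of the vertices of degree `< 3` in `γ`. -/
def pathWeights (G : WeightedForest.{v}) (γ : PSeq G.graph) : List ℤ :=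
  (γ.verts.filter fun x => deg G.graph x < 3).map G.weight

/-- Pseudo-minimal forests. -/
def IsPseudoMinimal (G : WeightedForest.{v}) : Prop :=
  ∀ γ : PSeq G.graph, SeqEquiv (G.pathWeights γ) [] → γ.IsTypePlusPlus

/-- Canonical forests. -/
def IsCanonical (G : WeightedForest.{v}) : Prop :=
  ∀ γ : PSeq G.graph, IsCanonicalSeq (G.pathWeights γ) ∨ IsCanonicalSeq (G.pathWeights γ.rev)

/-- `G'` is a strict blowing-down of `G` (that is, `G` is, up to isomorphism, either the blowing-up
of `G'` at an edge, or the blowing-up of `G'` at a vertex `v` of degree at most one), and `π` is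
the blowing-down map from `G` to `G'`. In the case of a vertex, `π` sends the created vertex `e`
to `v`; in the case of an edge, `e` has degree two. All other vertices are sent to themselves. -/
def IsStrictBlowDownMap (G G' : WeightedForest.{v}) (π : VtxNe2 G.graph → VtxNe2 G'.graph) :
    Prop :=
  (∃ v : G'.V, deg G'.graph v ≤ 1 ∧
    ∃ φ : G.toWeightedGraph.Iso (G'.toWeightedGraph.blowUpVertex v),
      ∀ x, (φ.toIso x.1 = none → (π x).1 = v) ∧ (∀ y, φ.toIso x.1 = some y → (π x).1 = y)) ∨
  (∃ v₁ v₂ : G'.V, G'.graph.Adj v₁ v₂ ∧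
    ∃ φ : G.toWeightedGraph.Iso (G'.toWeightedGraph.blowUpEdge v₁ v₂),
      ∀ x, φ.toIso x.1 = some (π x).1)

end WeightedForest

/-! ## The set `FO⁺(S)` and its equivalence relation -/

/-- The set `FO⁺(S)` of pairs `(σ, G)` where `G` is a pseudo-minimal forest and `σ` is a skeletal
map from `S` to `G`. -/
structure FOPlus (S : Skeleton.{u}) where
  forest : WeightedForest.{v}
  isPseudoMinimal : forest.IsPseudoMinimal
  σ : VtxNe2 S.graph → VtxNe2 forest.graph
  isSkeletal : IsSkeletal σ

namespace FOPlus

variable {S : Skeleton.{u}}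

/-- `(σ, G)` and `(σ', G')` are isomorphic: `f ∘ σ = σ'` for an isomorphism `f : G → G'` of
weighted graphs. -/
def IsIsomorphic (p p' : FOPlus.{u, v} S) : Prop :=
  ∃ f : p.forest.toWeightedGraph.Iso p'.forest.toWeightedGraph,
    ∀ s, f.toIso (p.σ s).1 = (p'.σ s).1

/-- `(σ', G')` is a blowing-down of `(σ, G)`. -/
def IsBlowDown (p p' : FOPlus.{u, v} S) : Prop :=
  ∃ π, p.forest.IsStrictBlowDownMap p'.forest π ∧ π ∘ p.σ = p'.σ

/-- Equivalence in `FO⁺(S)`: the equivalence relation generated by blowing-down, isomorphic pairs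
being identified. -/
def Equivalent : FOPlus.{u, v} S → FOPlus.{u, v} S → Prop :=
  Relation.EqvGen fun p p' => IsIsomorphic p p' ∨ IsBlowDown p p'

end FOPlus

/-! ## Edge maps, `Ω(S)` and `N(S, ω)` -/

/-- An edge map for `S`. -/
@[ext] structure EdgeMap (S : Skeleton.{u}) where
  toFun : PSeq S.graph → List ℤ
  rev : ∀ γ, toFun γ.rev = (toFun γ).reverse
  typePlusPlus : ∀ γ, SeqEquiv (toFun γ) [] → γ.IsTypePlusPlus

/-- Equivalence of edge maps. -/
instance EdgeMap.setoid (S : Skeleton.{u}) : Setoid (EdgeMap S) where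
  r W W' := ∀ γ, SeqEquiv (W.toFun γ) (W'.toFun γ)
  iseqv :=
    { refl := fun _ _ => Relation.EqvGen.refl _
      symm := fun h γ => (h γ).symm
      trans := fun h h' γ => (h γ).trans _ _ _ (h' γ) }

/-- The set `Ω(S)` of equivalence classes of edge maps. -/
def Omega (S : Skeleton.{u}) : Type u := Quotient (EdgeMap.setoid S)

section Omega

variable {S : Skeleton.{u}}

/-- The equivalence class `ω(γ)` of sequences. -/
def Omega.at (ω : Omega S) (γ : PSeq S.graph) : Set (List ℤ) :=
  {X | ∃ W : EdgeMap S, Quotient.mk _ W = ω ∧ W.toFun γ = X}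

/-- `ω(γ)` has determinant zero. (Equivalent sequences have equal determinants, so "some element"
could be replaced by "every element".) -/
def Omega.DetZeroAt (ω : Omega S) (γ : PSeq S.graph) : Prop := ∃ X ∈ ω.at γ, seqDet X = 0

/-- The forest `(S, ω)^♯`: its vertices are the vertices of degree `> 2` of `S`, and its edges are
the pairs `{x, y}` such that `γ = (x, y)` belongs to `P(S)` and `ω(γ)` has determinant zero. -/
def sharp (S : Skeleton.{u}) (ω : Omega S) : SimpleGraph (VtxGt2 S.graph) :=
  SimpleGraph.fromRel fun x y => ∃ γ : PSeq S.graph, γ.verts = [x.1, y.1] ∧ ω.DetZeroAt γ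

/-- Special vertices of `(S, ω)^♯`. -/
def IsSpecial (ω : Omega S) (x : VtxGt2 S.graph) : Prop :=
  ∃ (y : S.V) (γ : PSeq S.graph), γ.verts = [x.1, y] ∧ γ.IsTypePlusMinus ∧ ω.DetZeroAt γ

/-- The module `Z(S, ω)` of all maps `z` whose sum over each connected component of `(S, ω)^♯`
without special vertices is zero. -/
def ZSub (S : Skeleton.{u}) (ω : Omega S) : Submodule ℤ (VtxGt2 S.graph → ℤ) where
  carrier := {z | ∀ C : (sharp S ω).ConnectedComponent, (∀ x ∈ C.supp, ¬ IsSpecial ω x) →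
    ∑ᶠ x ∈ C.supp, z x = 0}
  add_mem' := by
    intro a b ha hb C hC
    have := finsum_mem_add_distrib (f := a) (g := b) (Set.toFinite C.supp)
    simp only [Pi.add_apply]
    rw [this, ha C hC, hb C hC, add_zero]
  zero_mem' := by
    intro C _
    simp
  smul_mem' := by
    intro c a ha C hC
    simp only [Pi.smul_apply]
    rw [← smul_finsum_mem (Set.toFinite C.supp), ha C hC, smul_zero]

/-- The module `N(S, ω)`. -/
abbrev NMod (S : Skeleton.{u}) (ω : Omega S) : Type u := (VtxGt2 S.graph → ℤ) ⧸ ZSub S ω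

end Omega

/-- The set `𝔛(S)` of pairs `(ω, η)` with `ω ∈ Ω(S)` and `η ∈ N(S, ω)`. -/
def XSet (S : Skeleton.{u}) : Type u := Σ ω : Omega S, NMod S ω

/-! ## The maps `T` and `T̄` -/

namespace FOPlus

variable {S : Skeleton.{u}}

/-- The first component of `T(σ, G)`: the edge map `W_G ∘ σ⃗ : P(S) → P(G) → ℤ*`. -/
def edgeMap (p : FOPlus.{u, v} S) : EdgeMap S where
  toFun γ := p.forest.pathWeights (vec p.σ p.isSkeletal.isPreSkeletal γ)
  rev := by
    intro γ
    have : vec p.σ p.isSkeletal.isPreSkeletal γ.rev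
        = (vec p.σ p.isSkeletal.isPreSkeletal γ).rev := by
      apply PSeq.eq_of_ends p.forest.isAcyclic
      · rw [vec_first, PSeq.rev_first, PSeq.rev_first, vec_last]
      · rw [vec_last, PSeq.rev_last, PSeq.rev_last, vec_first]
    rw [this]
    simp [WeightedForest.pathWeights, PSeq.rev, List.filter_reverse, List.map_reverse]
  typePlusPlus := by
    intro γ hγ
    obtain ⟨h1, h2⟩ := p.isPseudoMinimal _ hγ
    rw [vec_first] at h1
    rw [vec_last] at h2
    exact ⟨p.isSkeletal.two_lt_deg p.forest.isAcyclic S.deg_ne _ h1,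
      p.isSkeletal.two_lt_deg p.forest.isAcyclic S.deg_ne _ h2⟩

/-- The second component of `T(σ, G)`: the map `w(x) = w(σ(x), G)`, for `x` of degree `> 2`. -/
def vertexWeights (p : FOPlus.{u, v} S) (x : VtxGt2 S.graph) : ℤ :=
  p.forest.weight (p.σ x.toNe2).1

/-- The subset `FO⁺(S, ω)` of `FO⁺(S)`. -/
def FOPlusAt (S : Skeleton.{u}) (ω : Omega S) : Set (FOPlus.{u, v} S) :=
  {p | Quotient.mk _ p.edgeMap = ω}

/-- The map `T̄ : FO⁺(S, ω) → ω × N(S, ω)`. -/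
def Tbar (ω : Omega S) (p : FOPlusAt.{u, v} S ω) :
    {W : EdgeMap S // Quotient.mk _ W = ω} × NMod S ω :=
  (⟨p.1.edgeMap, p.2⟩, (ZSub S ω).mkQ p.1.vertexWeights)

end FOPlus

end Blowing

end

/-! Up to isomorphism, a pair (σ, G) is determined by its state: its edge map together with the
weights at the branch vertices of S, those of degree > 2 (`Marked.isIsomorphic_of_weights_eq`).
Every state occurs (`FOPlus.exists_state_eq`). Blowing up (σ, G) means blowing up one sequence W(γ)
and lowering the weights of those ends of γ that are branch vertices and adjacent to the new vertex
(`Marked.IsBlowDown.exists_isMoveAt`, `Marked.exists_blowUp`). The theorem thus becomes a statement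
about states and moves, in which an equivalence of sequences is carried together with the total
decreases (a, b) that it imposes on its two outer neighbours: a `FramedEquiv`.

Attach to a sequence X the product M(X) of the matrices (-x, -1; 1, 0). A framed equivalence
multiplies M(X) on the left by (1, 0; a, 1) and on the right by (1, -b; 0, 1). Hence M₀₀, which is
the determinant, is invariant. If it is nonzero, M₁₀/M₀₀ grows by exactly a, so adding this quotient
to the weight at that end compensates for the decrease. For canonical sequences the quotient lies in
[0, 1), so equivalent canonical sequences have equal quotients. Uniqueness of the canonical form
itself is never needed.

If the determinant is zero, X is equivalent to an odd run of zeros, and such a run is equivalent to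
itself with shift (1, -1) (`framedEquiv_self_of_seqDet_eq_zero`). Weight therefore moves freely
between the two ends of γ, and disappears if the far end is a leaf. Only a + b is controlled, by the
sum of X plus three times its length; half of this is used as the correction at each end.

Consequently the sum of the corrected weights over a component of (S, ω)^♯ without special vertices
is invariant under moves (`StateEquiv.sum_corrWeight`), while the transfers realize every element of
Z(S, ω) (`ZSub_subset_shifts`). On states with canonical edge maps the corrections agree, so being
equivalent is the same as defining the same element of 𝔛(S) (`stateEquiv_iff_of_isCanonical`). Since
every sequence has a canonical form (`exists_canonical`), every class of pairs has a canonical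
member. Q is read off from it, and the two required conditions leave no other choice. -/

namespace Blowing

/-! ## Framed blowing-up of sequences -/

/-- Blowing-up of sequences, recording by how much the weights of the vertices to the left and to
the right of the sequence decrease. -/
inductive FramedBlowUp : List ℤ → List ℤ → ℤ → ℤ → Prop
  | empty : FramedBlowUp [] [-1] 1 1
  | left (x : ℤ) (l : List ℤ) : FramedBlowUp (x :: l) (-1 :: (x - 1) :: l) 1 0
  | middle (l : List ℤ) (x y : ℤ) (r : List ℤ) :
      FramedBlowUp (l ++ x :: y :: r) (l ++ (x - 1) :: -1 :: (y - 1) :: r) 0 0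
  | right (l : List ℤ) (x : ℤ) : FramedBlowUp (l ++ [x]) (l ++ [x - 1, -1]) 0 1

/-- The equivalence generated by framed blowing-up. -/
inductive FramedEquiv : List ℤ → List ℤ → ℤ → ℤ → Prop
  | refl (X : List ℤ) : FramedEquiv X X 0 0
  | step {X Y : List ℤ} {a b : ℤ} (h : FramedBlowUp X Y a b) : FramedEquiv X Y a b
  | symm {X Y : List ℤ} {a b : ℤ} (h : FramedEquiv X Y a b) : FramedEquiv Y X (-a) (-b)
  | trans {X Y Z : List ℤ} {a b c d : ℤ} (h : FramedEquiv X Y a b) (h' : FramedEquiv Y Z c d) :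
      FramedEquiv X Z (a + c) (b + d)

theorem FramedBlowUp.reverse {X Y : List ℤ} {a b : ℤ} (h : FramedBlowUp X Y a b) :
    FramedBlowUp X.reverse Y.reverse b a := by
  cases h with
  | empty => exact .empty
  | left x l => simpa using FramedBlowUp.right l.reverse x
  | middle l x y r => simpa using FramedBlowUp.middle r.reverse y x l.reverse
  | right l x => simpa using FramedBlowUp.left x l.reverse

theorem FramedBlowUp.seqBlowUp {X Y : List ℤ} {a b : ℤ} (h : FramedBlowUp X Y a b) :
    SeqBlowUp X Y := by
  cases h <;> constructor

theorem SeqBlowUp.framed {X Y : List ℤ} (h : SeqBlowUp X Y) : ∃ a b, FramedBlowUp X Y a b := by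
  cases h <;> exact ⟨_, _, by constructor⟩

theorem SeqBlowUp.reverse {X Y : List ℤ} (h : SeqBlowUp X Y) :
    SeqBlowUp X.reverse Y.reverse := by
  obtain ⟨a, b, h⟩ := h.framed
  exact h.reverse.seqBlowUp

theorem SeqEquiv.reverse {X Y : List ℤ} (h : SeqEquiv X Y) :
    SeqEquiv X.reverse Y.reverse := by
  induction h with
  | rel X Y h => exact .rel _ _ h.reverse
  | refl X => exact .refl _
  | symm X Y _ ih => exact .symm _ _ ih
  | trans X Y Z _ _ ih ih' => exact .trans _ _ _ ih ih'

namespace FramedEquiv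

variable {X Y : List ℤ} {a b : ℤ}

theorem congr_shift {a' b' : ℤ} (h : FramedEquiv X Y a b) (ha : a = a') (hb : b = b') :
    FramedEquiv X Y a' b' := ha ▸ hb ▸ h

theorem seqEquiv (h : FramedEquiv X Y a b) : SeqEquiv X Y := by
  induction h with
  | refl X => exact .refl _
  | step h => exact .rel _ _ h.seqBlowUp
  | symm _ ih => exact .symm _ _ ih
  | trans _ _ ih ih' => exact .trans _ _ _ ih ih'

theorem reverse (h : FramedEquiv X Y a b) : FramedEquiv X.reverse Y.reverse b a := by
  induction h with
  | refl X => exact .refl _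
  | step h => exact .step h.reverse
  | symm _ ih => exact .symm ih
  | trans _ _ ih ih' => exact .trans ih ih'

/-- The new left neighbour x absorbs the left shift, leaving none for what stands further left. This
is what lets an equivalence of a tail act inside a longer sequence, and why the shifts are recorded.
-/
theorem cons (h : FramedEquiv X Y a b) (x : ℤ) : FramedEquiv (x :: X) ((x - a) :: Y) 0 b := by
  induction h generalizing x with
  | refl X => simpa using FramedEquiv.refl (x :: X)
  | step h =>
    refine .step ?_
    cases h with
    | empty => exact FramedBlowUp.right [] x
    | left y l => exact FramedBlowUp.middle [] x y l
    | middle l y z r => simpa using FramedBlowUp.middle (x :: l) y z r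
    | right l y => simpa using FramedBlowUp.right (x :: l) y
  | @symm X Y a b _ ih =>
    have := (ih (x + a)).symm
    simpa [sub_neg_eq_add] using this
  | @trans X Y Z a b c d _ _ ih ih' =>
    simpa [sub_sub] using (ih x).trans (ih' (x - a))

end FramedEquiv

theorem SeqEquiv.framed {X Y : List ℤ} (h : SeqEquiv X Y) : ∃ a b, FramedEquiv X Y a b := by
  induction h with
  | rel X Y h =>
    obtain ⟨a, b, h⟩ := h.framed
    exact ⟨a, b, .step h⟩
  | refl X => exact ⟨0, 0, .refl _⟩
  | symm X Y _ ih =>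
    obtain ⟨a, b, h⟩ := ih
    exact ⟨_, _, h.symm⟩
  | trans X Y Z _ _ ih ih' =>
    obtain ⟨a, b, h⟩ := ih
    obtain ⟨c, d, h'⟩ := ih'
    exact ⟨_, _, h.trans h'⟩

/-! ### Sequences containing zeros -/

/-- The elementary transformation at a zero. For n = 1: blowing up on the left gives (-1, -1, y, R),
which is also the blowing-up of (0, y + 1, R) between its first two terms. Other n follow by
iteration in both directions. -/
theorem framedEquiv_zero_cons (y : ℤ) (R : List ℤ) (n : ℤ) :
    FramedEquiv (0 :: y :: R) (0 :: (y + n) :: R) n 0 := by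
  have key : ∀ y : ℤ, FramedEquiv (0 :: y :: R) (0 :: (y + 1) :: R) 1 0 := by
    intro y
    have h1 := FramedEquiv.step (FramedBlowUp.left 0 (y :: R))
    have h2 := (FramedEquiv.step (FramedBlowUp.middle [] 0 (y + 1) R)).symm
    rw [add_sub_cancel_right] at h2
    exact (h1.trans h2).congr_shift (by simp) (by simp)
  induction n using Int.induction_on with
  | zero => simpa using FramedEquiv.refl (0 :: y :: R)
  | succ i ih => simpa [add_assoc] using ih.trans (key (y + i))
  | pred i ih =>
    have h := (key (y + (-i - 1))).symm
    rw [show y + (-i - 1 : ℤ) + 1 = y + -i by ring] at h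
    exact (ih.trans h).congr_shift (by ring) (by simp)

theorem framedEquiv_mid_zero (x y : ℤ) (R : List ℤ) (n : ℤ) :
    FramedEquiv (x :: 0 :: y :: R) ((x - n) :: 0 :: (y + n) :: R) 0 0 :=
  (framedEquiv_zero_cons y R n).cons x

theorem framedEquiv_pair_zero (x n : ℤ) : FramedEquiv [x, 0] [x + n, 0] 0 n := by
  simpa using (framedEquiv_zero_cons x [] n).reverse

/-- The second zero absorbs the left shift a and becomes -a; the elementary transformation at the
first zero restores it and passes a on to the left. -/
theorem FramedEquiv.zero_zero {X Y : List ℤ} {a b : ℤ} (h : FramedEquiv X Y a b) :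
    FramedEquiv (0 :: 0 :: X) (0 :: 0 :: Y) a b := by
  have h' := framedEquiv_zero_cons (0 - a) Y a
  rw [sub_add_cancel] at h'
  have h'' := (h.cons 0).cons 0
  rw [sub_zero] at h''
  exact (h''.trans h').congr_shift (by simp) (by simp)

/-- The change of x is compensated two places to the right, then again two places further, until it
leaves the odd run at its right end. -/
theorem framedEquiv_cons_zeros (k : ℕ) (x n : ℤ) :
    FramedEquiv (x :: List.replicate (2 * k + 1) 0) ((x + n) :: List.replicate (2 * k + 1) 0)
      0 n := by
  induction k generalizing x n with
  | zero => exact framedEquiv_pair_zero x n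
  | succ k ih =>
    have h1 := framedEquiv_mid_zero x 0 (List.replicate (2 * k + 1) 0) (-n)
    have h2 := ((ih (-n) n).cons 0).cons (x + n)
    rw [neg_add_cancel, sub_zero] at h2
    rw [sub_neg_eq_add, zero_add] at h1
    exact (h1.trans h2).congr_shift (by simp) (by simp)

/-- The elementary transformation at the first zero takes one unit from the left and turns the
second zero into 1; the remaining odd run then carries this unit out on the right. For a single
zero, its left and right blowings-up are both (-1, -1). -/
theorem framedEquiv_zeros (k : ℕ) :
    FramedEquiv (List.replicate (2 * k + 1) 0) (List.replicate (2 * k + 1) 0) 1 (-1) := by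
  rcases k with _ | k
  · have h1 := FramedEquiv.step (FramedBlowUp.left 0 [])
    have h2 := (FramedEquiv.step (FramedBlowUp.right [] 0)).symm
    exact (h1.trans h2).congr_shift (by simp) (by simp)
  · have h1 := framedEquiv_zero_cons 0 (List.replicate (2 * k + 1) 0) 1
    have h2 := (framedEquiv_cons_zeros k 1 (-1)).cons 0
    rw [add_neg_cancel, sub_zero] at h2
    exact (h1.trans h2).congr_shift (by simp) (by simp)

/-! ### Existence of canonical forms -/

theorem IsCanonicalSeq.zero_zero {C : List ℤ} (h : IsCanonicalSeq C) :
    IsCanonicalSeq (0 :: 0 :: C) := by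
  obtain ⟨r, A, rfl, hA, hr⟩ := h
  refine ⟨r + 2, A, by simp [List.replicate_succ], hA, fun h => ?_⟩
  have := hr h
  grind

theorem isCanonicalSeq_of_neg {A : List ℤ} (h : ∀ a ∈ A, a < -1) : IsCanonicalSeq A :=
  ⟨0, A, by simp, h, by simp⟩

/-- Blowing up between n + 1 and -1 gives (n, -1, -2, B): the leading term drops and the tail beyond
-1 remains < -1. At n = 0 the zero turns -1 into a second zero. -/
theorem exists_canonical_nat_cons (n : ℕ) (B : List ℤ) (hB : ∀ a ∈ B, a < -1) :
    ∃ D, SeqEquiv ((n : ℤ) :: -1 :: B) D ∧ IsCanonicalSeq D := by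
  induction n generalizing B with
  | zero =>
    refine ⟨0 :: 0 :: B, ?_, (isCanonicalSeq_of_neg hB).zero_zero⟩
    simpa using (framedEquiv_zero_cons (-1) B 1).seqEquiv
  | succ n ih =>
    obtain ⟨D, h, hD⟩ := ih (-2 :: B) (by simpa using hB)
    refine ⟨D, .trans _ _ _ (.rel _ _ ?_) h, hD⟩
    simpa using SeqBlowUp.middle [] ((n + 1 : ℕ) : ℤ) (-1) B

/-- By the sign of x + 1. A leading -1 is blown down; a leading 0 turns its neighbour into 0; a
positive x is blown up once on its right, which produces the shape treated by
`exists_canonical_nat_cons` with n = x - 1. -/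
theorem exists_canonical_cons_neg (A : List ℤ) (hA : ∀ a ∈ A, a < -1) (x : ℤ) :
    ∃ D, SeqEquiv (x :: A) D ∧ IsCanonicalSeq D := by
  induction A generalizing x with
  | nil =>
    rcases lt_or_ge x (-1) with h | h
    · exact ⟨_, .refl _, isCanonicalSeq_of_neg (by simpa using h)⟩
    · rcases h.eq_or_lt with rfl | h
      · exact ⟨[], .symm _ _ (.rel _ _ .empty), isCanonicalSeq_of_neg (by simp)⟩
      · rcases (show 0 ≤ x by omega).eq_or_lt with rfl | h
        · exact ⟨_, .refl _, 1, [], by simp⟩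
        · obtain ⟨n, rfl⟩ : ∃ n : ℕ, x = n + 1 := ⟨(x - 1).toNat, by omega⟩
          obtain ⟨D, h, hD⟩ := exists_canonical_nat_cons n [] (by simp)
          refine ⟨D, .trans _ _ _ (.rel _ _ ?_) h, hD⟩
          simpa using SeqBlowUp.right [] ((n : ℤ) + 1)
  | cons a A ih =>
    have ha := hA a (by simp)
    have hA' : ∀ a ∈ A, a < -1 := fun b hb => hA b (by simp [hb])
    rcases lt_or_ge x (-1) with h | h
    · refine ⟨_, .refl _, isCanonicalSeq_of_neg ?_⟩
      simpa [h] using hA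
    · rcases h.eq_or_lt with rfl | h
      · obtain ⟨D, h, hD⟩ := ih hA' (a + 1)
        refine ⟨D, .trans _ _ _ (.symm _ _ (.rel _ _ ?_)) h, hD⟩
        simpa using SeqBlowUp.left (a + 1) A
      · rcases (show 0 ≤ x by omega).eq_or_lt with rfl | h
        · refine ⟨0 :: 0 :: A, ?_, (isCanonicalSeq_of_neg hA').zero_zero⟩
          simpa using (framedEquiv_zero_cons a A (-a)).seqEquiv
        · obtain ⟨n, rfl⟩ : ∃ n : ℕ, x = n + 1 := ⟨(x - 1).toNat, by omega⟩
          obtain ⟨D, h, hD⟩ := exists_canonical_nat_cons n ((a - 1) :: A)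
            (by simpa using ⟨by omega, hA'⟩)
          refine ⟨D, .trans _ _ _ (.rel _ _ ?_) h, hD⟩
          simpa using SeqBlowUp.middle [] ((n : ℤ) + 1) a A

/-- A pair of zeros can be moved past x: (x, 0, 0, R) is equivalent to (0, 0, x, R). So zeros are
removed in pairs; when only one remains, parity forces A to be empty and x can be made 0. -/
theorem exists_canonical_cons (r : ℕ) (A : List ℤ) (hA : ∀ a ∈ A, a < -1) (hr : A ≠ [] → Even r)
    (x : ℤ) : ∃ D, SeqEquiv (x :: (List.replicate r 0 ++ A)) D ∧ IsCanonicalSeq D := by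
  induction r using Nat.twoStepInduction generalizing x with
  | zero => simpa using exists_canonical_cons_neg A hA x
  | one =>
    have : A = [] := by
      by_contra h
      exact Nat.not_even_one (hr h)
    subst this
    refine ⟨[0, 0], ?_, 2, [], by simp [List.replicate_succ]⟩
    simpa using (framedEquiv_pair_zero x (-x)).seqEquiv
  | more r ih _ =>
    obtain ⟨D, h, hD⟩ := ih (fun h => by have := hr h; grind) x
    obtain ⟨a, b, h⟩ := h.framed
    refine ⟨0 :: 0 :: D, ?_, hD.zero_zero⟩
    refine .trans _ _ _ ?_ h.zero_zero.seqEquiv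
    simpa [List.replicate_succ, SeqEquiv] using
      (framedEquiv_mid_zero x 0 (List.replicate r 0 ++ A) x).seqEquiv

/-- Every sequence is equivalent to a canonical one. -/
theorem exists_canonical (X : List ℤ) : ∃ C, SeqEquiv X C ∧ IsCanonicalSeq C := by
  induction X with
  | nil => exact ⟨[], .refl _, isCanonicalSeq_of_neg (by simp)⟩
  | cons x X ih =>
    obtain ⟨C, h, r, A, rfl, hA, hr⟩ := ih
    obtain ⟨a, b, h⟩ := h.framed
    obtain ⟨D, h', hD⟩ := exists_canonical_cons r A hA hr (x - a)
    exact ⟨D, .trans _ _ _ (h.cons x).seqEquiv h', hD⟩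

/-! ### The matrix of a sequence -/

/-- The product of the matrices `!![-x, -1; 1, 0]` over the terms `x` of the sequence. -/
def seqMat : List ℤ → Matrix (Fin 2) (Fin 2) ℤ
  | [] => 1
  | x :: l => !![-x, -1; 1, 0] * seqMat l

theorem seqMat_append (X Y : List ℤ) : seqMat (X ++ Y) = seqMat X * seqMat Y := by
  induction X with
  | nil => simp [seqMat]
  | cons x X ih => simp [seqMat, ih]

theorem seqMat_cons_zero_zero (x : ℤ) (l : List ℤ) :
    seqMat (x :: l) 0 0 = -x * seqMat l 0 0 - seqMat l 1 0 := by
  simp [seqMat, Matrix.mul_apply, Fin.sum_univ_two]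
  ring

theorem seqMat_cons_one_zero (x : ℤ) (l : List ℤ) : seqMat (x :: l) 1 0 = seqMat l 0 0 := by
  simp [seqMat, Matrix.mul_apply, Fin.sum_univ_two]

theorem seqMat_zero_zero_cons (l : List ℤ) : seqMat (0 :: 0 :: l) = -seqMat l := by
  rw [seqMat, seqMat, ← Matrix.mul_assoc]
  have : (!![-0, -1; 1, 0] * !![-0, -1; 1, 0] : Matrix (Fin 2) (Fin 2) ℤ) = -1 := by
    ext i j
    fin_cases i <;> fin_cases j <;> simp [Matrix.mul_apply, Fin.sum_univ_two]
  rw [this, neg_one_mul]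

/-- Each kind of blowing-up is a local identity between products of two or three of the matrices.
The middle one changes nothing; a shift at an end appears as a unipotent factor on that side. -/
theorem FramedBlowUp.seqMat_eq {X Y : List ℤ} {a b : ℤ} (h : FramedBlowUp X Y a b) :
    seqMat Y = !![1, 0; a, 1] * seqMat X * !![1, -b; 0, 1] := by
  have one : (!![1, 0; 0, 1] : Matrix (Fin 2) (Fin 2) ℤ) = 1 := by
    ext i j
    fin_cases i <;> fin_cases j <;> rfl
  have hl : ∀ x : ℤ, (!![-(-1), -1; 1, 0] * !![-(x - 1), -1; 1, 0] : Matrix (Fin 2) (Fin 2) ℤ)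
      = !![1, 0; 1, 1] * !![-x, -1; 1, 0] := by
    intro x
    ext i j
    fin_cases i <;> fin_cases j <;> simp [Matrix.mul_apply, Fin.sum_univ_two] <;> ring
  have hr : ∀ x : ℤ, (!![-(x - 1), -1; 1, 0] * !![-(-1), -1; 1, 0] : Matrix (Fin 2) (Fin 2) ℤ)
      = !![-x, -1; 1, 0] * !![1, -1; 0, 1] := by
    intro x
    ext i j
    fin_cases i <;> fin_cases j <;> simp [Matrix.mul_apply, Fin.sum_univ_two] <;> ring
  have hm : ∀ x y : ℤ, (!![-(x - 1), -1; 1, 0] * (!![-(-1), -1; 1, 0] * !![-(y - 1), -1; 1, 0]) :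
      Matrix (Fin 2) (Fin 2) ℤ) = !![-x, -1; 1, 0] * !![-y, -1; 1, 0] := by
    intro x y
    ext i j
    fin_cases i <;> fin_cases j <;> simp [Matrix.mul_apply, Fin.sum_univ_two] <;> ring
  cases h with
  | empty =>
    ext i j
    fin_cases i <;> fin_cases j <;> simp [seqMat, Matrix.mul_apply, Fin.sum_univ_two]
  | left x l =>
    simp only [seqMat, neg_zero, one, mul_one, ← Matrix.mul_assoc, hl]
  | middle l x y r =>
    simp only [seqMat_append, seqMat, neg_zero, one, mul_one, one_mul]
    rw [← Matrix.mul_assoc (!![-x, -1; 1, 0]), ← hm]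
    simp only [Matrix.mul_assoc]
  | right l x =>
    simp only [seqMat_append, seqMat, one, one_mul, mul_one, hr, Matrix.mul_assoc]

theorem FramedEquiv.seqMat_eq {X Y : List ℤ} {a b : ℤ} (h : FramedEquiv X Y a b) :
    seqMat Y = !![1, 0; a, 1] * seqMat X * !![1, -b; 0, 1] := by
  have one : (!![1, 0; 0, 1] : Matrix (Fin 2) (Fin 2) ℤ) = 1 := by
    ext i j
    fin_cases i <;> fin_cases j <;> rfl
  have hl : ∀ a b : ℤ, (!![1, 0; a, 1] * !![1, 0; b, 1] : Matrix (Fin 2) (Fin 2) ℤ)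
      = !![1, 0; b + a, 1] := by
    intro a b
    ext i j
    fin_cases i <;> fin_cases j <;> simp [Matrix.mul_apply, Fin.sum_univ_two]
    ring
  have hr : ∀ a b : ℤ, (!![1, a; 0, 1] * !![1, b; 0, 1] : Matrix (Fin 2) (Fin 2) ℤ)
      = !![1, a + b; 0, 1] := by
    intro a b
    ext i j
    fin_cases i <;> fin_cases j <;> simp [Matrix.mul_apply, Fin.sum_univ_two]
    ring
  induction h with
  | refl X => simp [one]
  | step h => exact h.seqMat_eq
  | @symm X Y a b _ ih =>
    rw [ih, Matrix.mul_assoc, Matrix.mul_assoc, Matrix.mul_assoc, hr, ← Matrix.mul_assoc,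
      ← Matrix.mul_assoc, hl]
    simp [one]
  | @trans X Y Z a b c d _ _ ih ih' =>
    rw [ih', ih, Matrix.mul_assoc, Matrix.mul_assoc, Matrix.mul_assoc, hr, ← Matrix.mul_assoc,
      ← Matrix.mul_assoc, hl, neg_add]

/-- Each factor equals its transpose conjugated by diag(1, -1), and transposition reverses products.
-/
theorem seqMat_reverse (X : List ℤ) : seqMat X.reverse =
    !![seqMat X 0 0, -seqMat X 1 0; -seqMat X 0 1, seqMat X 1 1] := by
  induction X with
  | nil =>
    ext i j
    fin_cases i <;> fin_cases j <;> simp [seqMat]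
  | cons x X ih =>
    rw [List.reverse_cons, seqMat_append, ih]
    ext i j
    fin_cases i <;> fin_cases j <;> simp [seqMat, Matrix.mul_apply, Fin.sum_univ_two] <;> ring

theorem seqMat_replicate_append (i : ℕ) (A : List ℤ) :
    seqMat (List.replicate (2 * i) 0 ++ A) = (-1) ^ i • seqMat A := by
  induction i with
  | zero => simp
  | succ i ih =>
    rw [Nat.mul_succ, List.replicate_succ, List.replicate_succ, List.cons_append,
      List.cons_append, seqMat_zero_zero_cons, ih, pow_succ]
    simp

/-- The continued fraction estimate: with -a ≥ 2, the new corner entry -a·M₀₀ - M₁₀ exceeds M₀₀,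
which is the new M₁₀. -/
theorem seqMat_neg {A : List ℤ} (hA : ∀ a ∈ A, a < -1) :
    0 ≤ seqMat A 1 0 ∧ seqMat A 1 0 < seqMat A 0 0 := by
  induction A with
  | nil => simp [seqMat]
  | cons a A ih =>
    have ha := hA a (by simp)
    obtain ⟨h1, h2⟩ := ih (fun b hb => hA b (by simp [hb]))
    rw [seqMat_cons_one_zero, seqMat_cons_zero_zero]
    refine ⟨by omega, ?_⟩
    nlinarith

/-! ### The determinant -/

/-- Expansion along the first row leaves two terms; the minor of the second has one possibly nonzero
entry in its first column. The tridiagonal shape is only needed in the first row and column. -/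
theorem det_tridiagonal (n : ℕ) (M : Matrix (Fin (n + 2)) (Fin (n + 2)) ℤ)
    (h0 : ∀ j : Fin (n + 2), 2 ≤ j.1 → M 0 j = 0) (h1 : ∀ i : Fin (n + 2), 2 ≤ i.1 → M i 0 = 0) :
    M.det = M 0 0 * (M.submatrix Fin.succ Fin.succ).det
      - M 0 1 * M 1 0 * (M.submatrix (Fin.succ ∘ Fin.succ) (Fin.succ ∘ Fin.succ)).det := by
  have hA : (M.submatrix Fin.succ (Fin.succAbove (Fin.succ (0 : Fin (n + 1))))).det =
      M 1 0 * (M.submatrix (Fin.succ ∘ Fin.succ) (Fin.succ ∘ Fin.succ)).det := by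
    rw [Matrix.det_succ_column_zero, Fin.sum_univ_succ, Finset.sum_eq_zero]
    · have e1 : (Fin.succAbove (0 : Fin (n + 1))) = Fin.succ := by ext; simp
      have e2 : (Fin.succAbove (Fin.succ (0 : Fin (n + 1)))) ∘ Fin.succ = Fin.succ ∘ Fin.succ := by
        funext i
        simp
      rw [Matrix.submatrix_submatrix, e1, e2, Matrix.submatrix_apply]
      simp
    · intro i _
      rw [Matrix.submatrix_apply, show Fin.succAbove (Fin.succ (0 : Fin (n + 1))) 0 = 0 by simp, h1]
      · ring
      · simp
  have e0 : (Fin.succAbove (0 : Fin (n + 2))) = Fin.succ := by ext; simp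
  rw [Matrix.det_succ_row_zero, Fin.sum_univ_succ, Fin.sum_univ_succ, Finset.sum_eq_zero, hA, e0]
  · simp
    ring
  · intro j _
    rw [h0 _ (by simp)]
    ring

theorem seqDet_cons_cons (x y : ℤ) (l : List ℤ) :
    seqDet (x :: y :: l) = -x * seqDet (y :: l) - seqDet l := by
  classical
  -- Entries are expressed through the natural numbers underlying the indices, so that the shifted
  -- submatrices can be compared with the matrices of the shorter lists.
  have hent : ∀ (X : List ℤ) (i j : Fin X.length), (-(Matrix.diagonal X.get +
      (SimpleGraph.pathGraph X.length).adjMatrix ℤ)) i j =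
      if i.1 = j.1 then -X.get i else if i.1 + 1 = j.1 ∨ j.1 + 1 = i.1 then -1 else 0 := by
    intro X i j
    rw [Matrix.neg_apply, Matrix.add_apply, Matrix.diagonal_apply, SimpleGraph.adjMatrix_apply]
    simp only [SimpleGraph.pathGraph_adj, Fin.ext_iff]
    split_ifs
    all_goals simp
    all_goals omega
  unfold seqDet
  have := det_tridiagonal l.length (-(Matrix.diagonal (x :: y :: l).get +
    (SimpleGraph.pathGraph (x :: y :: l).length).adjMatrix ℤ)) ?_ ?_
  · refine this.trans ?_
    -- The product of the two off-diagonal entries is (-1)(-1) = 1.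
    have e : ∀ i j : ℤ, i = 1 → i * j = j := by rintro _ _ rfl; simp
    refine congrArg₂ _ (congrArg₂ _ ?_ (congrArg _ ?_)) ((e _ _ ?_).trans (congrArg _ ?_))
    · exact hent (x :: y :: l) _ _
    · ext i j
      rw [hent (y :: l)]
      refine (hent (x :: y :: l) i.succ j.succ).trans ?_
      simp
    · refine (congrArg₂ _ (hent (x :: y :: l) (0 : Fin (l.length + 2)) (1 : Fin (l.length + 2)))
        (hent (x :: y :: l) (1 : Fin (l.length + 2)) (0 : Fin (l.length + 2)))).trans ?_
      simp
    · ext i j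
      rw [hent l]
      refine (hent (x :: y :: l) i.succ.succ j.succ.succ).trans ?_
      simp
  · intro j hj
    refine (hent (x :: y :: l) (0 : Fin (l.length + 2)) j).trans ?_
    rw [if_neg, if_neg]
    · change ¬ (0 + 1 = j.1 ∨ j.1 + 1 = 0)
      omega
    · change ¬ 0 = j.1
      omega
  · intro j hj
    refine (hent (x :: y :: l) j (0 : Fin (l.length + 2))).trans ?_
    rw [if_neg, if_neg]
    · change ¬ (j.1 + 1 = 0 ∨ 0 + 1 = j.1)
      omega
    · change ¬ j.1 = 0
      omega

theorem seqDet_eq (X : List ℤ) : seqDet X = seqMat X 0 0 := by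
  induction X using List.twoStepInduction with
  | nil => simp [seqDet, seqMat]
  | singleton x =>
    simp [seqDet, seqMat, Matrix.mul_apply, Fin.sum_univ_two]
  | cons_cons x y l ih ih' =>
    rw [seqDet_cons_cons, seqMat_cons_zero_zero, seqMat_cons_one_zero, ih, ih']

end Blowing

namespace Blowing

/-! ### The correction term of a sequence -/

/-- If a sequence is attached to a vertex of weight `w`, then `w + endCorr X` is invariant under
framed blowing-up when the determinant is nonzero; when it is zero, the sum of these quantities
over the two ends of the sequence is invariant. -/
def endCorr (X : List ℤ) : ℚ :=
  if seqMat X 0 0 = 0 then ((X.sum + 3 * X.length : ℤ) : ℚ) / 2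
  else (seqMat X 1 0 : ℚ) / seqMat X 0 0

namespace FramedEquiv

variable {X Y : List ℤ} {a b : ℤ}

theorem seqMat_zero_zero (h : FramedEquiv X Y a b) : seqMat Y 0 0 = seqMat X 0 0 := by
  rw [h.seqMat_eq]
  simp only [Matrix.mul_apply, Fin.sum_univ_two]
  simp

theorem seqMat_one_zero (h : FramedEquiv X Y a b) :
    seqMat Y 1 0 = a * seqMat X 0 0 + seqMat X 1 0 := by
  rw [h.seqMat_eq]
  simp only [Matrix.mul_apply, Fin.sum_univ_two]
  simp

theorem seqMat_one_one (h : FramedEquiv X Y a b) :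
    seqMat Y 1 1 = a * seqMat X 0 1 + seqMat X 1 1 - b * (a * seqMat X 0 0 + seqMat X 1 0) := by
  rw [h.seqMat_eq]
  simp only [Matrix.mul_apply, Fin.sum_univ_two]
  simp
  ring

/-- A blowing-up adds a term -1 and makes two decrements, of which a + b fall outside the sequence.
The sum thus changes by -3 + a + b, and the coefficient 3 of the length cancels the constant. -/
theorem sum_add_length (h : FramedEquiv X Y a b) :
    Y.sum + 3 * (Y.length : ℤ) = X.sum + 3 * (X.length : ℤ) + a + b := by
  induction h with
  | refl X => ring
  | step h => cases h <;> simp <;> ring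
  | symm _ ih => linarith
  | trans _ _ ih ih' => linarith

theorem endCorr_of_ne (h : FramedEquiv X Y a b) (h0 : seqMat X 0 0 ≠ 0) :
    endCorr Y = endCorr X + a := by
  have h0' : (seqMat X 0 0 : ℚ) ≠ 0 := by exact_mod_cast h0
  rw [endCorr, endCorr, if_neg h0, if_neg (by rwa [h.seqMat_zero_zero]), h.seqMat_zero_zero,
    h.seqMat_one_zero]
  push_cast
  field_simp
  ring

theorem endCorr_of_eq (h : FramedEquiv X Y a b) (h0 : seqMat X 0 0 = 0) :
    endCorr Y = endCorr X + (a + b) / 2 := by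
  rw [endCorr, endCorr, if_pos h0, if_pos (by rwa [h.seqMat_zero_zero]), h.sum_add_length]
  push_cast
  ring

end FramedEquiv

theorem SeqEquiv.seqDet_eq {X Y : List ℤ} (h : SeqEquiv X Y) : seqDet X = seqDet Y := by
  obtain ⟨a, b, h⟩ := h.framed
  rw [Blowing.seqDet_eq, Blowing.seqDet_eq, h.seqMat_zero_zero]

theorem seqMat_replicate_odd (k : ℕ) :
    seqMat (List.replicate (2 * k + 1) 0) = (-1) ^ k • !![0, -1; 1, 0] := by
  rw [List.replicate_add, seqMat_replicate_append]
  simp [seqMat]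

theorem seqMat_reverse_zero_zero (X : List ℤ) : seqMat X.reverse 0 0 = seqMat X 0 0 := by
  simp [seqMat_reverse]

/-- A canonical sequence of determinant zero has an odd number of zeros and no other term;
otherwise the correction terms at both ends are in `[0, 1)`. -/
theorem IsCanonicalSeq.dichotomy {C : List ℤ} (h : IsCanonicalSeq C) :
    (∃ k, C = List.replicate (2 * k + 1) 0) ∨
      (seqMat C 0 0 ≠ 0 ∧ (0 ≤ endCorr C ∧ endCorr C < 1) ∧
        (0 ≤ endCorr C.reverse ∧ endCorr C.reverse < 1)) := by
  obtain ⟨r, A, rfl, hA, hr⟩ := h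
  rcases Nat.even_or_odd' r with ⟨i, rfl | rfl⟩
  · right
    -- An even run of zeros contributes only the scalar ±1, which cancels in the quotient. Being
    -- scalar, it may stand on either side, so the same estimate serves A and its reversal.
    have key : ∀ (B X : List ℤ), (∀ b ∈ B, b < -1) →
        seqMat X = (-1) ^ i • seqMat B →
        seqMat X 0 0 ≠ 0 ∧ (0 ≤ endCorr X ∧ endCorr X < 1) := by
      intro B X hB hX
      obtain ⟨h1, h2⟩ := seqMat_neg hB
      have h0 : seqMat X 0 0 ≠ 0 := by
        rw [hX]
        rcases neg_one_pow_eq_or ℤ i with h | h <;> rw [h] <;> simp <;> omega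
      have h3 : (0 : ℚ) < seqMat B 0 0 := by exact_mod_cast (by omega : 0 < seqMat B 0 0)
      have e : endCorr X = (seqMat B 1 0 : ℚ) / seqMat B 0 0 := by
        rw [endCorr, if_neg h0, hX]
        rcases neg_one_pow_eq_or ℤ i with h | h <;> rw [h] <;> simp
      refine ⟨h0, ?_, ?_⟩
      · rw [e]
        exact div_nonneg (by exact_mod_cast h1) h3.le
      · rw [e, div_lt_one h3]
        exact_mod_cast h2
    have h1 := key A _ hA (seqMat_replicate_append i A)
    refine ⟨h1.1, h1.2, (key A.reverse _ (by simpa using hA) ?_).2⟩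
    rw [List.reverse_append, seqMat_append, List.reverse_replicate]
    have := seqMat_replicate_append i []
    rw [List.append_nil] at this
    rw [this, seqMat, Matrix.mul_smul, Matrix.mul_one]
  · left
    have : A = [] := by
      by_contra h
      have := hr h
      grind
    exact ⟨i, by simp [this]⟩

theorem dichotomy_of_isCanonicalSeq_or {X : List ℤ}
    (h : IsCanonicalSeq X ∨ IsCanonicalSeq X.reverse) :
    (∃ k, X = List.replicate (2 * k + 1) 0) ∨
      (seqMat X 0 0 ≠ 0 ∧ 0 ≤ endCorr X ∧ endCorr X < 1) := by
  rcases h with h | h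
  · rcases h.dichotomy with h | ⟨h0, h1, -⟩
    · exact Or.inl h
    · exact Or.inr ⟨h0, h1⟩
  · rcases h.dichotomy with ⟨k, h⟩ | ⟨h0, -, h1⟩
    · exact Or.inl ⟨k, by simpa using congrArg List.reverse h⟩
    · rw [seqMat_reverse_zero_zero] at h0
      rw [List.reverse_reverse] at h1
      exact Or.inr ⟨h0, h1⟩

/-- For nonzero determinant the two corrections differ by the integer a and both lie in [0, 1). For
determinant zero both sequences are odd runs of zeros, and their matrices force a + b = 0. -/
theorem endCorr_eq_of_isCanonicalSeq {X Y : List ℤ} (h : SeqEquiv X Y)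
    (hX : IsCanonicalSeq X ∨ IsCanonicalSeq X.reverse)
    (hY : IsCanonicalSeq Y ∨ IsCanonicalSeq Y.reverse) : endCorr X = endCorr Y := by
  obtain ⟨a, b, h⟩ := h.framed
  have h00 := h.seqMat_zero_zero
  rcases dichotomy_of_isCanonicalSeq_or hX with ⟨k, rfl⟩ | ⟨hX0, hX1, hX2⟩ <;>
    rcases dichotomy_of_isCanonicalSeq_or hY with ⟨l, rfl⟩ | ⟨hY0, hY1, hY2⟩
  · have h11 := h.seqMat_one_one
    rw [h.endCorr_of_eq (by simp [seqMat_replicate_odd])]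
    -- Up to sign both matrices are (0, -1; 1, 0), so the formula for the entry (1, 1) reads 0 = ±(a
    -- + b).
    have : a + b = 0 := by
      rw [seqMat_replicate_odd, seqMat_replicate_odd] at h11
      rcases neg_one_pow_eq_or ℤ k with h | h <;> rw [h] at h11 <;> simp at h11 <;> omega
    rw [← Int.cast_add, this]
    simp
  · simp [seqMat_replicate_odd] at h00
    exact absurd h00 hY0
  · simp [seqMat_replicate_odd] at h00
    exact absurd h00.symm hX0
  · have e := h.endCorr_of_ne hX0
    have : a = 0 := by
      have h1 : (a : ℚ) < 1 := by linarith
      have h2 : (-1 : ℚ) < a := by linarith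
      have h1' : a < 1 := by exact_mod_cast h1
      have h2' : -1 < a := by exact_mod_cast h2
      omega
    rw [e, this]
    simp

theorem exists_odd_zeros_of_seqDet_eq_zero {X : List ℤ} (h : seqDet X = 0) :
    ∃ k, SeqEquiv X (List.replicate (2 * k + 1) 0) := by
  obtain ⟨C, hXC, hC⟩ := exists_canonical X
  rcases hC.dichotomy with ⟨k, rfl⟩ | ⟨h0, -⟩
  · exact ⟨k, hXC⟩
  · rw [hXC.seqDet_eq, seqDet_eq] at h
    exact absurd h h0

/-- A sequence of determinant zero is equivalent to itself with a transfer of weight from one end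
to the other. -/
theorem framedEquiv_self_of_seqDet_eq_zero {X : List ℤ} (h : seqDet X = 0) :
    FramedEquiv X X 1 (-1) := by
  obtain ⟨k, hk⟩ := exists_odd_zeros_of_seqDet_eq_zero h
  obtain ⟨a, b, hk⟩ := hk.framed
  -- Conjugation by the equivalence with an odd run of zeros: the shifts of the outer two factors
  -- cancel.
  exact ((hk.trans (framedEquiv_zeros k)).trans hk.symm).congr_shift (by ring) (by ring)

end Blowing

namespace Blowing

/-! ## Sequences of a skeleton -/

namespace PSeq

theorem rev_rev {V : Type u} {G : SimpleGraph V} (γ : PSeq G) : γ.rev.rev = γ := by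
  ext1
  simp [rev]

theorem rev_injective {V : Type u} {G : SimpleGraph V} :
    Function.Injective (rev : PSeq G → PSeq G) := fun γ δ h => by
  rw [← γ.rev_rev, h, rev_rev]

theorem eq_rev_comm {V : Type u} {G : SimpleGraph V} {γ δ : PSeq G} :
    γ = δ.rev ↔ δ = γ.rev :=
  ⟨fun h => by rw [h, rev_rev], fun h => by rw [h, rev_rev]⟩

end PSeq

namespace Skeleton

variable {S : Skeleton.{u}}

/-- A skeleton has no vertices of degree 2 to serve as interior vertices of γ, and none of degree 0
for a one-term γ. -/
theorem exists_verts_eq (γ : PSeq S.graph) : ∃ x y, γ.verts = [x, y] ∧ S.graph.Adj x y := by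
  rcases γ.isPSeq with ⟨x, -, h⟩ | ⟨h1, -, h3, h4⟩
  · exact absurd h (S.deg_ne x).1
  · have hlen : γ.verts.length = 2 := by
      have := (h4 1 h1).1 (S.deg_ne _).2
      omega
    obtain ⟨x, y, h⟩ := List.length_eq_two.1 hlen
    refine ⟨x, y, h, ?_⟩
    rw [h] at h3
    simpa using h3

theorem first_ne_last (γ : PSeq S.graph) : γ.first ≠ γ.last := fun h =>
  (S.deg_ne _).1 (γ.deg_eq_zero h)

theorem rev_ne (γ : PSeq S.graph) : γ.rev ≠ γ := fun h =>
  first_ne_last γ (by conv_lhs => rw [← h, PSeq.rev_first])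

theorem adj_first_last (γ : PSeq S.graph) : S.graph.Adj γ.first.1 γ.last.1 := by
  obtain ⟨x, y, h, hxy⟩ := exists_verts_eq γ
  simpa [PSeq.first, PSeq.last, h] using hxy

theorem verts_eq (γ : PSeq S.graph) : γ.verts = [γ.first.1, γ.last.1] := by
  obtain ⟨x, y, h, hxy⟩ := exists_verts_eq γ
  simp [PSeq.first, PSeq.last, h]

theorem pSeq_ext {γ δ : PSeq S.graph} (h1 : γ.first = δ.first) (h2 : γ.last = δ.last) : γ = δ :=
  PSeq.eq_of_ends S.isAcyclic γ δ h1 h2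

/-- The element of `P(S)` given by two adjacent vertices of the skeleton. -/
def pair {x y : S.V} (h : S.graph.Adj x y) : PSeq S.graph where
  verts := [x, y]
  isPSeq := Or.inr ⟨by simp, by simpa using h.ne, by simpa using h, by
    intro i hi
    simp only [List.length_cons, List.length_nil] at hi ⊢
    exact iff_of_true (S.deg_ne _).2 (by omega)⟩

instance : Finite (PSeq S.graph) :=
  Finite.of_injective (fun γ : PSeq S.graph => (γ.first, γ.last)) fun γ δ h => by
    simp only [Prod.mk.injEq] at h
    exact pSeq_ext h.1 h.2

end Skeleton

/-! ## Moves on pairs consisting of an edge map and vertex weights -/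

variable {S : Skeleton.{u}}

theorem Omega.detZeroAt_mk {W : EdgeMap S} {γ : PSeq S.graph} :
    Omega.DetZeroAt (Quotient.mk _ W : Omega S) γ ↔ seqDet (W.toFun γ) = 0 := by
  constructor
  · rintro ⟨X, ⟨W', hW', rfl⟩, h⟩
    rwa [← (Quotient.exact hW' γ).seqDet_eq]
  · exact fun h => ⟨_, ⟨W, rfl, rfl⟩, h⟩

/-- Edge maps agreeing except possibly at `γ` and its reversal. -/
def EdgeMap.AgreeOff (γ : PSeq S.graph) (W W' : EdgeMap S) : Prop :=
  ∀ δ, δ ≠ γ → δ ≠ γ.rev → W'.toFun δ = W.toFun δ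

theorem EdgeMap.AgreeOff.eq {γ : PSeq S.graph} {W W' : EdgeMap S} (h : AgreeOff γ W W')
    (hγ : W'.toFun γ = W.toFun γ) : W' = W := by
  ext1
  funext δ
  by_cases h1 : δ = γ
  · rw [h1, hγ]
  by_cases h2 : δ = γ.rev
  · rw [h2, W.rev, W'.rev, hγ]
  exact h δ h1 h2

open Classical in
/-- Replacement of the value of an edge map at `γ` by an equivalent sequence. -/
noncomputable def EdgeMap.update (W : EdgeMap S) (γ : PSeq S.graph) (Y : List ℤ)
    (h : SeqEquiv (W.toFun γ) Y) : EdgeMap S where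
  toFun δ := if δ = γ then Y else if δ = γ.rev then Y.reverse else W.toFun δ
  rev δ := by
    by_cases h1 : δ = γ
    · subst h1
      simp [Skeleton.rev_ne]
    · by_cases h2 : δ = γ.rev
      · subst h2
        simp [PSeq.rev_rev, Skeleton.rev_ne]
      · rw [if_neg h1, if_neg h2, if_neg, if_neg, W.rev]
        · exact fun h => h1 (PSeq.rev_injective h)
        · exact fun h => h2 (PSeq.eq_rev_comm.1 h.symm)
  typePlusPlus δ hδ := by
    refine W.typePlusPlus δ ?_
    split_ifs at hδ with h1 h2
    · subst h1
      exact h.trans _ _ _ hδ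
    · subst h2
      rw [W.rev]
      exact h.reverse.trans _ _ _ hδ
    · exact hδ

theorem EdgeMap.update_self {W : EdgeMap S} {γ : PSeq S.graph} {Y : List ℤ}
    (h : SeqEquiv (W.toFun γ) Y) : (W.update γ Y h).toFun γ = Y := by
  simp [update]

theorem EdgeMap.update_agreeOff {W : EdgeMap S} {γ : PSeq S.graph} {Y : List ℤ}
    (h : SeqEquiv (W.toFun γ) Y) : AgreeOff γ W (W.update γ Y h) := by
  intro δ h1 h2
  simp [update, h1, h2]

theorem EdgeMap.update_equiv {W : EdgeMap S} {γ : PSeq S.graph} {Y : List ℤ}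
    (h : SeqEquiv (W.toFun γ) Y) (δ : PSeq S.graph) :
    SeqEquiv (W.toFun δ) ((W.update γ Y h).toFun δ) := by
  by_cases h1 : δ = γ
  · rw [h1, update_self]
    exact h
  by_cases h2 : δ = γ.rev
  · rw [h2, EdgeMap.rev, EdgeMap.rev, update_self]
    exact h.reverse
  rw [update_agreeOff h δ h1 h2]
  exact .refl _

open Classical in
/-- The change of the vertex weights caused by a framed equivalence along `γ`. -/
noncomputable def endShift (γ : PSeq S.graph) (a b : ℤ) (x : VtxGt2 S.graph) : ℤ :=
  (if γ.first = x.toNe2 then a else 0) + (if γ.last = x.toNe2 then b else 0)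

/-- An edge map together with weights for the vertices of degree greater than two. -/
abbrev WState (S : Skeleton.{u}) : Type u := EdgeMap S × (VtxGt2 S.graph → ℤ)

/-- Framed blowing-up along `γ`. -/
def IsMoveAt (γ : PSeq S.graph) (t t' : WState S) : Prop :=
  ∃ a b, FramedBlowUp (t.1.toFun γ) (t'.1.toFun γ) a b ∧ EdgeMap.AgreeOff γ t.1 t'.1 ∧
    t'.2 = t.2 - endShift γ a b

/-- The elementary moves. -/
def IsMove (t t' : WState S) : Prop := ∃ γ, IsMoveAt γ t t'

/-- The equivalence relation generated by the moves. -/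
def StateEquiv : WState S → WState S → Prop := Relation.EqvGen IsMove

theorem endShift_zero (γ : PSeq S.graph) : endShift γ 0 0 = 0 := by
  funext x
  simp [endShift]

theorem endShift_neg (γ : PSeq S.graph) (a b : ℤ) :
    endShift γ (-a) (-b) = -endShift γ a b := by
  funext x
  simp only [endShift, Pi.neg_apply]
  split_ifs <;> ring

theorem endShift_add (γ : PSeq S.graph) (a b c d : ℤ) :
    endShift γ (a + c) (b + d) = endShift γ a b + endShift γ c d := by
  funext x
  simp only [endShift, Pi.add_apply]
  split_ifs <;> ring

theorem endShift_rev (γ : PSeq S.graph) (a b : ℤ) : endShift γ.rev a b = endShift γ b a := by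
  funext x
  rw [endShift, endShift, PSeq.rev_first, PSeq.rev_last, add_comm]

theorem EdgeMap.AgreeOff.symm {γ : PSeq S.graph} {W W' : EdgeMap S} (h : AgreeOff γ W W') :
    AgreeOff γ W' W := fun δ h1 h2 => (h δ h1 h2).symm

theorem EdgeMap.AgreeOff.trans {γ : PSeq S.graph} {W W' W'' : EdgeMap S} (h : AgreeOff γ W W')
    (h' : AgreeOff γ W' W'') : AgreeOff γ W W'' :=
  fun δ h1 h2 => (h' δ h1 h2).trans (h δ h1 h2)

/-- Framed equivalences of sequences lift to equivalences of states. -/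
theorem FramedEquiv.stateEquiv {X Y : List ℤ} {a b : ℤ} (h : FramedEquiv X Y a b)
    (γ : PSeq S.graph) {t t' : WState S} (hX : t.1.toFun γ = X) (hY : t'.1.toFun γ = Y)
    (hoff : EdgeMap.AgreeOff γ t.1 t'.1) (hw : t'.2 = t.2 - endShift γ a b) :
    StateEquiv t t' := by
  induction h generalizing t t' with
  | refl X =>
    have : t' = t := Prod.ext (hoff.eq (hY.trans hX.symm)) (by rw [hw, endShift_zero, sub_zero])
    rw [this]
    exact .refl _
  | step h =>
    subst hX hY
    exact .rel _ _ ⟨γ, _, _, h, hoff, hw⟩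
  | symm _ ih =>
    refine .symm _ _ (ih hY hX hoff.symm ?_)
    rw [hw, endShift_neg]
    abel
  | @trans X Y Z a b c d h h' ih ih' =>
    subst hX
    -- The intermediate sequence is again the value of an edge map, since the condition on types
    -- depends only on equivalence classes.
    let t1 : WState S := (t.1.update γ Y h.seqEquiv, t.2 - endShift γ a b)
    have e : t1.1.toFun γ = Y := EdgeMap.update_self h.seqEquiv
    have o : EdgeMap.AgreeOff γ t.1 t1.1 := EdgeMap.update_agreeOff h.seqEquiv
    refine .trans _ t1 _ (ih rfl e o rfl) (ih' e hY (o.symm.trans hoff) ?_)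
    rw [hw, endShift_add]
    change _ = t.2 - endShift γ a b - _
    abel

theorem exists_stateEquiv_update (t : WState S) (γ : PSeq S.graph) {Y : List ℤ}
    (h : SeqEquiv (t.1.toFun γ) Y) : ∃ w, StateEquiv t (t.1.update γ Y h, w) := by
  obtain ⟨a, b, h'⟩ := h.framed
  exact ⟨_, h'.stateEquiv γ rfl (EdgeMap.update_self h) (EdgeMap.update_agreeOff h) rfl⟩

/-- Induction on the number of γ at which the two edge maps differ. Correcting γ also corrects its
reversal and touches nothing else; the vertex weights follow along uncontrolled. -/
theorem exists_stateEquiv_of_edgeMap_equiv (t : WState S) (W : EdgeMap S)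
    (h : ∀ γ, SeqEquiv (t.1.toFun γ) (W.toFun γ)) : ∃ w, StateEquiv t (W, w) := by
  induction hn : {γ | t.1.toFun γ ≠ W.toFun γ}.ncard using Nat.strong_induction_on generalizing t
    with
  | _ n ih =>
    by_cases hall : ∀ γ, t.1.toFun γ = W.toFun γ
    · refine ⟨t.2, ?_⟩
      have : t.1 = W := by
        ext1
        exact funext hall
      rw [← this]
      exact .refl _
    · push Not at hall
      obtain ⟨γ, hγ⟩ := hall
      obtain ⟨w, hw⟩ := exists_stateEquiv_update t γ (h γ)
      obtain ⟨w', hw'⟩ := ih _ (by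
        rw [← hn]
        refine Set.ncard_lt_ncard ((Set.ssubset_iff_of_subset ?_).2 ⟨γ, hγ, ?_⟩) (Set.toFinite _)
        · intro δ hδ
          by_cases h1 : δ = γ
          · subst h1
            exact hγ
          by_cases h2 : δ = γ.rev
          · subst h2
            simp only [Set.mem_ofPred_eq, EdgeMap.rev]
            exact fun h => hγ (List.reverse_injective h)
          simpa [EdgeMap.update_agreeOff (h γ) δ h1 h2] using hδ
        · simp [EdgeMap.update_self (h γ)]) (t.1.update γ _ (h γ), w)
        (fun δ => (EdgeMap.update_equiv (h γ) δ).symm.trans _ _ _ (h δ)) rfl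
      exact ⟨w', hw.trans _ _ _ hw'⟩

/-- Edge maps all of whose values are canonical, up to reversal. -/
def EdgeMap.IsCanonical (W : EdgeMap S) : Prop :=
  ∀ γ, IsCanonicalSeq (W.toFun γ) ∨ IsCanonicalSeq (W.toFun γ).reverse

theorem EdgeMap.exists_isCanonical (W : EdgeMap S) :
    ∃ W' : EdgeMap S, (∀ γ, SeqEquiv (W.toFun γ) (W'.toFun γ)) ∧ W'.IsCanonical := by
  induction hn : {γ | ¬ (IsCanonicalSeq (W.toFun γ) ∨ IsCanonicalSeq (W.toFun γ).reverse)}.ncard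
    using Nat.strong_induction_on generalizing W with
  | _ n ih =>
    by_cases hall : W.IsCanonical
    · exact ⟨W, fun γ => .refl _, hall⟩
    · unfold IsCanonical at hall
      push Not at hall
      obtain ⟨γ, hγ⟩ := hall
      obtain ⟨C, h, hC⟩ := exists_canonical (W.toFun γ)
      obtain ⟨W', hW', hcan⟩ := ih _ (by
        rw [← hn]
        refine Set.ncard_lt_ncard ((Set.ssubset_iff_of_subset ?_).2 ⟨γ, ?_, ?_⟩) (Set.toFinite _)
        · intro δ hδ
          by_cases h1 : δ = γ
          · subst h1
            simp [hγ]
          by_cases h2 : δ = γ.rev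
          · subst h2
            simp [hγ, W.rev]
          simpa [EdgeMap.update_agreeOff h δ h1 h2] using hδ
        · simpa using hγ
        · simp [EdgeMap.update_self h, hC]) (W.update γ C h) rfl
      exact ⟨W', fun δ => (EdgeMap.update_equiv h δ).trans _ _ _ (hW' δ), hcan⟩

/-! ### Shifts of the vertex weights -/

/-- The shifts of the vertex weights that can be realized without changing the edge map. -/
def shifts (W : EdgeMap S) : AddSubgroup (VtxGt2 S.graph → ℤ) where
  carrier := {h | ∀ w, StateEquiv (W, w) (W, w + h)}
  zero_mem' w := by
    rw [add_zero]
    exact .refl _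
  add_mem' {h h'} hh hh' w := by
    rw [← add_assoc]
    exact .trans _ _ _ (hh w) (hh' _)
  neg_mem' {h} hh w := by
    have := (hh (w + -h)).symm
    rwa [neg_add_cancel_right] at this

/-- The self-equivalence with shift (1, -1) along γ moves a unit of weight between its ends without
altering any sequence. -/
theorem endShift_mem_shifts {W : EdgeMap S} {γ : PSeq S.graph} (h : seqDet (W.toFun γ) = 0) :
    endShift γ 1 (-1) ∈ shifts W := by
  rw [← neg_mem_iff]
  intro w
  refine (framedEquiv_self_of_seqDet_eq_zero h).stateEquiv γ rfl rfl (fun _ _ _ => rfl) ?_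
  exact (sub_eq_add_neg w _).symm

open Classical in
theorem single_sub_mem_shifts_of_adj {W : EdgeMap S} {x y : VtxGt2 S.graph}
    (h : (sharp S (Quotient.mk _ W)).Adj x y) :
    Pi.single x 1 - Pi.single y 1 ∈ shifts W := by
  have key : ∀ x y : VtxGt2 S.graph, (∃ γ : PSeq S.graph, γ.verts = [x.1, y.1] ∧
      Omega.DetZeroAt (Quotient.mk _ W : Omega S) γ) →
      Pi.single x 1 - Pi.single y 1 ∈ shifts W := by
    rintro x y ⟨γ, hγ, h⟩
    convert endShift_mem_shifts (Omega.detZeroAt_mk.1 h) using 1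
    funext z
    have h1 : γ.first = x.toNe2 := Subtype.ext (by simp [PSeq.first, hγ, VtxGt2.toNe2])
    have h2 : γ.last = y.toNe2 := Subtype.ext (by simp [PSeq.last, hγ, VtxGt2.toNe2])
    simp only [endShift, h1, h2, Pi.sub_apply, Pi.single_apply, VtxGt2.toNe2,
      Subtype.ext_iff, eq_comm (a := z.1)]
    split_ifs <;> ring
  replace h := (SimpleGraph.fromRel_adj _ _ _).1 h
  rcases h.2 with h | h
  · exact key x y h
  · rw [← neg_sub]
    exact neg_mem (key y x h)

open Classical in
-- Along a γ of type (+,-) the far end carries no recorded vertex weight, so the transfer changes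
-- only the weight at x.
theorem single_mem_shifts_of_isSpecial {W : EdgeMap S} {x : VtxGt2 S.graph}
    (h : IsSpecial (Quotient.mk _ W : Omega S) x) : Pi.single x 1 ∈ shifts W := by
  obtain ⟨y, γ, hγ, ht, h⟩ := h
  convert endShift_mem_shifts (Omega.detZeroAt_mk.1 h) using 1
  funext z
  have h1 : γ.first = x.toNe2 := Subtype.ext (by simp [PSeq.first, hγ, VtxGt2.toNe2])
  have h2 : γ.last ≠ z.toNe2 := by
    intro h
    have h3 := ht.2
    have h4 := z.2
    rw [h] at h3
    exact absurd h3 (not_lt.2 h4.le)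
  rw [endShift, if_neg h2, h1]
  simp only [Pi.single_apply, VtxGt2.toNe2, Subtype.ext_iff, eq_comm (a := z.1)]
  simp

open Classical in
theorem single_sub_mem_shifts_of_reachable {W : EdgeMap S} {x y : VtxGt2 S.graph}
    (h : (sharp S (Quotient.mk _ W)).Reachable x y) :
    Pi.single x 1 - Pi.single y 1 ∈ shifts W := by
  obtain ⟨p⟩ := h
  induction p with
  | nil => simp
  | cons h _ ih => simpa using add_mem (single_sub_mem_shifts_of_adj h) ih

/-- Transfers along edges of (S, ω)^♯ gather the values of z on each component at one
representative. The total there is zero, or else it can be discharged through a special vertex of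
the component. -/
theorem ZSub_subset_shifts {W : EdgeMap S} {z : VtxGt2 S.graph → ℤ}
    (hz : z ∈ ZSub S (Quotient.mk _ W)) : z ∈ shifts W := by
  classical
  have : Fintype (VtxGt2 S.graph) := Fintype.ofFinite _
  set Γ := sharp S (Quotient.mk _ W) with hΓ
  have : Fintype Γ.ConnectedComponent := Fintype.ofFinite _
  choose rep hrep using fun C : Γ.ConnectedComponent => C.exists_rep
  have hr : ∀ x, Γ.Reachable x (rep (Γ.connectedComponentMk x)) := fun x =>
    SimpleGraph.ConnectedComponent.exact (hrep _).symm
  -- The first sum collects the transfers from each x to the representative of its component; the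
  -- second is supported on the representatives.
  have hz1 : z = ∑ x, z x • (Pi.single x 1 - Pi.single (rep (Γ.connectedComponentMk x)) 1) +
      ∑ x, z x • Pi.single (rep (Γ.connectedComponentMk x)) (1 : ℤ) := by
    rw [← Finset.sum_add_distrib]
    funext y
    simp only [← smul_add, sub_add_cancel, Finset.sum_apply, Pi.smul_apply, Pi.single_apply]
    simp
  rw [hz1]
  refine add_mem (sum_mem fun x _ => zsmul_mem (single_sub_mem_shifts_of_reachable (hr x)) _) ?_
  rw [← Finset.sum_fiberwise (g := fun x => Γ.connectedComponentMk x)]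
  refine sum_mem fun C _ => ?_
  have : ∑ x with Γ.connectedComponentMk x = C,
      z x • Pi.single (M := fun _ => ℤ) (rep (Γ.connectedComponentMk x)) (1 : ℤ) =
      (∑ x with Γ.connectedComponentMk x = C, z x) • Pi.single (rep C) 1 := by
    rw [Finset.sum_smul]
    refine Finset.sum_congr rfl fun x hx => ?_
    simp only [Finset.mem_filter] at hx
    rw [hx.2]
  rw [this]
  by_cases hC : ∀ x ∈ C.supp, ¬ IsSpecial (Quotient.mk _ W : Omega S) x
  · have h0 := hz C hC
    rw [finsum_mem_eq_finite_toFinset_sum _ (Set.toFinite _)] at h0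
    have : ∑ x with Γ.connectedComponentMk x = C, z x = 0 := by
      rw [← h0]
      refine Finset.sum_congr ?_ fun _ _ => rfl
      ext x
      simp only [Finset.mem_filter, Finset.mem_univ, true_and, Set.Finite.mem_toFinset]
      exact (SimpleGraph.ConnectedComponent.mem_supp_iff _ _).symm
    rw [this, zero_smul]
    exact zero_mem _
  · push Not at hC
    obtain ⟨x, hx, hs⟩ := hC
    refine zsmul_mem ?_ _
    have h1 : Γ.Reachable (rep C) x := by
      refine SimpleGraph.ConnectedComponent.exact ?_
      rw [SimpleGraph.ConnectedComponent.mem_supp_iff] at hx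
      rw [hx]
      exact hrep C
    simpa using add_mem (single_sub_mem_shifts_of_reachable h1) (single_mem_shifts_of_isSpecial hs)

/-! ### The corrected weights -/

open Classical in
/-- The weight of a vertex, corrected by the contributions of the sequences starting there. -/
noncomputable def corrWeight (t : WState S) (x : VtxGt2 S.graph) : ℚ :=
  t.2 x + ∑ᶠ γ : PSeq S.graph, if γ.first = x.toNe2 then endCorr (t.1.toFun γ) else 0

open Classical in
-- Only γ and its reversal can contribute to the difference, and they are distinct; the reversal
-- starts where γ ends.
theorem corrWeight_sub_of_agreeOff {γ : PSeq S.graph} {t t' : WState S}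
    (h : EdgeMap.AgreeOff γ t.1 t'.1) (x : VtxGt2 S.graph) :
    corrWeight t' x - corrWeight t x = t'.2 x - t.2 x +
      (if γ.first = x.toNe2 then endCorr (t'.1.toFun γ) - endCorr (t.1.toFun γ) else 0) +
      (if γ.last = x.toNe2 then endCorr (t'.1.toFun γ).reverse - endCorr (t.1.toFun γ).reverse
        else 0) := by
  have : Fintype (PSeq S.graph) := Fintype.ofFinite _
  rw [corrWeight, corrWeight, finsum_eq_sum_of_fintype, finsum_eq_sum_of_fintype,
    add_sub_add_comm, ← Finset.sum_sub_distrib,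
    Fintype.sum_eq_add γ γ.rev (Skeleton.rev_ne γ).symm]
  · simp only [PSeq.rev_first, EdgeMap.rev]
    split_ifs <;> ring
  · rintro δ ⟨h1, h2⟩
    simp [h δ h1 h2]

/-- For nonzero determinant each end correction grows by precisely what the weight loses. For
determinant zero only the sum over the two ends balances. -/
theorem corrWeight_sub_of_isMoveAt {γ : PSeq S.graph} {t t' : WState S} (h : IsMoveAt γ t t') :
    corrWeight t' = corrWeight t ∨
    (seqDet (t.1.toFun γ) = 0 ∧ ∃ c : ℤ, ∀ x,
      corrWeight t' x - corrWeight t x = endShift γ c (-c) x / 2) := by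
  obtain ⟨a, b, h1, h2, h3⟩ := h
  have h := FramedEquiv.step h1
  by_cases h0 : seqMat (t.1.toFun γ) 0 0 = 0
  · refine Or.inr ⟨(seqDet_eq _).trans h0, b - a, fun x => ?_⟩
    have e1 := h.endCorr_of_eq h0
    have e2 := h.reverse.endCorr_of_eq (by rwa [seqMat_reverse_zero_zero])
    rw [corrWeight_sub_of_agreeOff h2, h3, e1, e2]
    simp only [endShift, Pi.sub_apply]
    split_ifs <;> push_cast <;> ring
  · left
    funext x
    have e1 := h.endCorr_of_ne h0
    have e2 := h.reverse.endCorr_of_ne (by rwa [seqMat_reverse_zero_zero])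
    rw [← sub_eq_zero, corrWeight_sub_of_agreeOff h2, h3, e1, e2]
    simp only [endShift, Pi.sub_apply]
    split_ifs <;> push_cast <;> ring

/-- When γ has determinant zero and C has no special vertex, both ends of γ lie in C or neither
does, so the contributions c and -c cancel. -/
theorem sum_endShift_eq_zero {W : EdgeMap S} {ω : Omega S} (hω : Quotient.mk _ W = ω)
    {γ : PSeq S.graph} (h : seqDet (W.toFun γ) = 0) (C : (sharp S ω).ConnectedComponent)
    (hC : ∀ x ∈ C.supp, ¬ IsSpecial ω x) (c : ℤ) :
    ∑ᶠ x ∈ C.supp, endShift γ c (-c) x = 0 := by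
  classical
  subst hω
  have hz : Omega.DetZeroAt (Quotient.mk _ W : Omega S) γ := Omega.detZeroAt_mk.2 h
  have hz' : Omega.DetZeroAt (Quotient.mk _ W : Omega S) γ.rev := by
    refine Omega.detZeroAt_mk.2 ?_
    rw [W.rev, seqDet_eq, seqMat_reverse_zero_zero, ← seqDet_eq, h]
  have hlast : ∀ δ : PSeq S.graph, Omega.DetZeroAt (Quotient.mk _ W : Omega S) δ →
      ∀ x ∈ C.supp, δ.first = x.toNe2 → ∃ y ∈ C.supp, δ.last = y.toNe2 := by
    intro δ hδ x hx h1
    have hx1 : δ.first.1 = x.1 := congrArg Subtype.val h1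
    by_cases hy : 2 < deg S.graph δ.last.1
    · refine ⟨⟨δ.last.1, hy⟩, ?_, rfl⟩
      refine C.mem_supp_of_adj_mem_supp hx ?_
      refine (SimpleGraph.fromRel_adj _ _ _).2
        ⟨fun h => Skeleton.first_ne_last δ (Subtype.ext ?_), Or.inl ⟨δ, ?_, hδ⟩⟩
      · rw [hx1, h]
      · rw [Skeleton.verts_eq, hx1]
    -- If the far end is not a branch vertex, δ has type (+,-) and makes x special.
    · refine absurd ⟨δ.last.1, δ, ?_, ⟨?_, ?_⟩, hδ⟩ (hC x hx)
      · rw [Skeleton.verts_eq, hx1]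
      · rw [hx1]
        exact x.2
      · have := δ.last.2
        omega
  have inj : ∀ x y : VtxGt2 S.graph, x.toNe2 = y.toNe2 ↔ x = y := by
    intro x y
    simp [VtxGt2.toNe2, Subtype.ext_iff]
  by_cases hf : ∃ x ∈ C.supp, γ.first = x.toNe2
  · obtain ⟨x, hx, h1⟩ := hf
    obtain ⟨y, hy, h2⟩ := hlast γ hz x hx h1
    rw [finsum_mem_eq_finite_toFinset_sum _ (Set.toFinite _)]
    simp only [endShift, h1, h2, inj]
    rw [Finset.sum_add_distrib, Finset.sum_ite_eq, Finset.sum_ite_eq]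
    simp [hx, hy]
  · refine finsum_mem_eq_zero_of_forall_eq_zero fun x hx => ?_
    have n1 : γ.first ≠ x.toNe2 := fun h => hf ⟨x, hx, h⟩
    have n2 : γ.last ≠ x.toNe2 := by
      intro h
      obtain ⟨y, hy, h'⟩ := hlast γ.rev hz' x hx (by rwa [PSeq.rev_first])
      exact hf ⟨y, hy, by rwa [PSeq.rev_last] at h'⟩
    simp [endShift, n1, n2]

theorem EdgeMap.AgreeOff.equiv {γ : PSeq S.graph} {W W' : EdgeMap S} (h : AgreeOff γ W W')
    (hγ : SeqEquiv (W.toFun γ) (W'.toFun γ)) (δ : PSeq S.graph) :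
    SeqEquiv (W.toFun δ) (W'.toFun δ) := by
  by_cases h1 : δ = γ
  · rwa [h1]
  by_cases h2 : δ = γ.rev
  · rw [h2, W.rev, W'.rev]
    exact hγ.reverse
  rw [h δ h1 h2]
  exact .refl _

theorem StateEquiv.edgeMap_equiv {t t' : WState S} (h : StateEquiv t t') (γ : PSeq S.graph) :
    SeqEquiv (t.1.toFun γ) (t'.1.toFun γ) := by
  induction h with
  | rel t t' h =>
    obtain ⟨δ, a, b, h1, h2, -⟩ := h
    exact h2.equiv (.rel _ _ h1.seqBlowUp) γ
  | refl t => exact .refl _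
  | symm t t' _ ih => exact .symm _ _ ih
  | trans _ _ _ _ _ ih ih' => exact .trans _ _ _ ih ih'

theorem StateEquiv.sum_corrWeight {t t' : WState S} (h : StateEquiv t t') {ω : Omega S}
    (hω : Quotient.mk _ t.1 = ω) (C : (sharp S ω).ConnectedComponent)
    (hC : ∀ x ∈ C.supp, ¬ IsSpecial ω x) :
    ∑ᶠ x ∈ C.supp, corrWeight t' x = ∑ᶠ x ∈ C.supp, corrWeight t x := by
  induction h with
  | rel t t' h =>
    obtain ⟨γ, h⟩ := h
    rcases corrWeight_sub_of_isMoveAt h with h | ⟨h0, c, h⟩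
    · rw [h]
    · have := sum_endShift_eq_zero hω h0 C hC c
      rw [← sub_eq_zero, ← finsum_mem_sub_distrib _ _ (Set.toFinite _)]
      simp only [h]
      rw [finsum_mem_eq_finite_toFinset_sum _ (Set.toFinite _)] at this ⊢
      rw [← Finset.sum_div, ← Int.cast_sum, this]
      simp
  | refl t => rfl
  | symm t t' h ih =>
    refine (ih ?_).symm
    rw [← hω]
    exact Quotient.sound (StateEquiv.edgeMap_equiv h)
  | trans t t' t'' h h' ih ih' =>
    rw [ih' ?_, ih hω]
    rw [← hω]
    exact (Quotient.sound (StateEquiv.edgeMap_equiv h)).symm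

/-- States with canonical edge maps are equivalent if and only if they define the same element of
`𝔛(S)`. -/
theorem stateEquiv_iff_of_isCanonical {t t' : WState S} (ht : t.1.IsCanonical)
    (ht' : t'.1.IsCanonical) : StateEquiv t t' ↔
      (∀ γ, SeqEquiv (t.1.toFun γ) (t'.1.toFun γ)) ∧
        t'.2 - t.2 ∈ ZSub S (Quotient.mk _ t.1) := by
  -- When the end corrections coincide, the rational invariants compare as the plain integer
  -- weights, and equality on all non-special components is membership in Z(S, ω).
  have key : ∀ s s' : WState S, (∀ γ, endCorr (s'.1.toFun γ) = endCorr (s.1.toFun γ)) →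
      ((∀ C : (sharp S (Quotient.mk _ t.1)).ConnectedComponent,
        (∀ x ∈ C.supp, ¬ IsSpecial (Quotient.mk _ t.1 : Omega S) x) →
        ∑ᶠ x ∈ C.supp, corrWeight s' x = ∑ᶠ x ∈ C.supp, corrWeight s x) ↔
        s'.2 - s.2 ∈ ZSub S (Quotient.mk _ t.1)) := by
    intro s s' h
    refine forall_congr' fun C => imp_congr_right fun hC => ?_
    rw [← sub_eq_zero, ← finsum_mem_sub_distrib _ _ (Set.toFinite _)]
    have e : ∀ x, corrWeight s' x - corrWeight s x = ((s'.2 - s.2) x : ℤ) := by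
      intro x
      simp [corrWeight, h]
    simp only [e]
    rw [finsum_mem_eq_finite_toFinset_sum _ (Set.toFinite _),
      finsum_mem_eq_finite_toFinset_sum _ (Set.toFinite _), ← Int.cast_sum, Int.cast_eq_zero]
  have hcorr : (∀ γ, SeqEquiv (t.1.toFun γ) (t'.1.toFun γ)) →
      ∀ γ, endCorr (t'.1.toFun γ) = endCorr (t.1.toFun γ) := fun h γ =>
    (endCorr_eq_of_isCanonicalSeq (h γ) (ht γ) (ht' γ)).symm
  constructor
  · intro h
    refine ⟨h.edgeMap_equiv, (key t t' (hcorr h.edgeMap_equiv)).1 fun C hC => ?_⟩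
    exact h.sum_corrWeight rfl C hC
  · rintro ⟨h, hz⟩
    -- Reaching the right edge map leaves unknown weights w. The invariants put w - t.2 in Z(S, ω),
    -- hence also t'.2 - w, and a shift corrects the rest.
    obtain ⟨w, hw⟩ := exists_stateEquiv_of_edgeMap_equiv t t'.1 h
    refine hw.trans _ _ _ ?_
    have hω : (Quotient.mk _ t.1 : Omega S) = Quotient.mk _ t'.1 := Quotient.sound h
    have h1 := (key t (t'.1, w) (hcorr h)).1 fun C hC => hw.sum_corrWeight rfl C hC
    have h2 : t'.2 - w ∈ ZSub S (Quotient.mk _ t.1) := by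
      have := sub_mem hz h1
      simpa using this
    rw [hω] at h2
    have := ZSub_subset_shifts h2 w
    rwa [add_sub_cancel] at this

end Blowing

namespace Blowing

/-! ## The elements of `P(G)` for a forest `G` -/

section Paths

variable {V : Type u} {G : SimpleGraph V}

theorem isPSeq_cons_append_iff {a z : V} {m : List V} :
    IsPSeq G (a :: (m ++ [z])) ↔ (a :: (m ++ [z])).Nodup ∧ (a :: (m ++ [z])).IsChain G.Adj ∧
      deg G a ≠ 2 ∧ deg G z ≠ 2 ∧ ∀ u ∈ m, deg G u = 2 := by
  constructor
  · rintro (⟨x, h, -⟩ | ⟨-, h2, h3, h4⟩)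
    · simp at h
    · refine ⟨h2, h3, ?_, ?_, ?_⟩
      · have := (h4 0 (by simp)).2 (Or.inl rfl)
        simpa using this
      · have := (h4 (m.length + 1) (by simp)).2 (Or.inr (by simp))
        simpa using this
      · intro u hu
        obtain ⟨i, hi, rfl⟩ := List.getElem_of_mem hu
        by_contra hcon
        have := (h4 (i + 1) (by simp; omega)).1 (by simpa [List.getElem_append_left hi] using hcon)
        simp at this
        omega
  · rintro ⟨h1, h2, h3, h4, h5⟩
    refine Or.inr ⟨by simp, h1, h2, ?_⟩
    intro i hi
    rcases i with _ | i
    · simpa using h3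
    · by_cases hi' : i < m.length
      · have e : (a :: (m ++ [z]))[i + 1] = m[i] := by simp [List.getElem_append_left hi']
        rw [e]
        have := h5 _ (List.getElem_mem hi')
        simp [this]
        omega
      · have : i = m.length := by
          simp at hi
          omega
        subst this
        simpa using h4

theorem IsPSeq.eq_singleton_or {l : List V} (h : IsPSeq G l) :
    (∃ x, l = [x] ∧ deg G x = 0) ∨ ∃ a m z, l = a :: (m ++ [z]) := by
  rcases h with h | ⟨h1, -⟩
  · exact Or.inl h
  · right
    obtain ⟨a, t, rfl⟩ := List.exists_cons_of_ne_nil (List.ne_nil_of_length_pos (by omega : 0 < l.length))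
    have ht : t ≠ [] := by
      rintro rfl
      simp at h1
    exact ⟨a, t.dropLast, t.getLast ht, by rw [List.dropLast_append_getLast]⟩

theorem IsPSeq.run {l r : List V} {a b : V} (h : IsPSeq G (l ++ a :: b :: r)) :
    (∀ u ∈ (b :: r).dropLast, deg G u = 2) ∧ deg G ((b :: r).getLast (by simp)) ≠ 2 := by
  obtain ⟨r', z, hr⟩ : ∃ r' z, b :: r = r' ++ [z] :=
    ⟨_, _, (List.dropLast_append_getLast (by simp : b :: r ≠ [])).symm⟩
  simp only [hr]
  rw [List.dropLast_concat, List.getLast_concat]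
  rw [hr] at h
  rcases l with _ | ⟨c, l⟩
  · have := isPSeq_cons_append_iff.1 h
    exact ⟨this.2.2.2.2, this.2.2.2.1⟩
  · rw [show c :: l ++ a :: (r' ++ [z]) = c :: ((l ++ a :: r') ++ [z]) by simp] at h
    have := isPSeq_cons_append_iff.1 h
    exact ⟨fun u hu => this.2.2.2.2 u (by simp [hu]), this.2.2.2.1⟩

/-- A path starting with a given edge and continuing until the first vertex of degree different
from two is unique. -/
theorem run_unique {t t' : List V} {x y : V}
    (hc : (x :: y :: t).IsChain G.Adj) (hc' : (x :: y :: t').IsChain G.Adj)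
    (hn : (x :: y :: t).Nodup) (hn' : (x :: y :: t').Nodup)
    (hr : (∀ u ∈ (y :: t).dropLast, deg G u = 2) ∧ deg G ((y :: t).getLast (by simp)) ≠ 2)
    (hr' : (∀ u ∈ (y :: t').dropLast, deg G u = 2) ∧ deg G ((y :: t').getLast (by simp)) ≠ 2) :
    t = t' := by
  induction t generalizing t' x y with
  | nil =>
    rcases t' with _ | ⟨z, t'⟩
    · rfl
    · exact absurd (hr'.1 y (by simp)) (by simpa using hr.2)
  | cons z t ih =>
    rcases t' with _ | ⟨z', t'⟩
    · exact absurd (hr.1 y (by simp)) (by simpa using hr'.2)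
    · have hy : deg G y = 2 := hr.1 y (by simp)
      have hzz : z = z' := by
        by_contra hne
        simp only [List.isChain_cons_cons] at hc hc'
        simp only [List.nodup_cons, List.mem_cons, not_or] at hn hn'
        have hfin : (G.neighborSet y).Finite := Set.finite_of_ncard_ne_zero
          (by change deg G y ≠ 0; omega)
        -- Two different continuations, together with the predecessor x, would be three neighbours
        -- of a vertex of degree 2.
        have h3 : ({x, z, z'} : Set V).ncard = 3 := Set.ncard_eq_three.2
          ⟨x, z, z', hn.1.2.1, hn'.1.2.1, hne, rfl⟩
        have : ({x, z, z'} : Set V).ncard ≤ (G.neighborSet y).ncard := by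
          refine Set.ncard_le_ncard ?_ hfin
          intro w hw
          simp only [Set.mem_insert_iff, Set.mem_singleton_iff] at hw
          rcases hw with rfl | rfl | rfl
          · exact hc.1.symm
          · exact hc.2.1
          · exact hc'.2.1
        change _ ≤ deg G y at this
        omega
      subst hzz
      rw [ih hc.tail hc'.tail hn.of_cons hn'.of_cons ?_ ?_]
      · exact ⟨fun u hu => hr.1 u (by simp [hu]), by simpa using hr.2⟩
      · exact ⟨fun u hu => hr'.1 u (by simp [hu]), by simpa using hr'.2⟩

namespace PSeq

theorem edge_unique_right {γ γ' : PSeq G} {l r l' r' : List V} {a b : V}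
    (h : γ.verts = l ++ a :: b :: r) (h' : γ'.verts = l' ++ a :: b :: r') : r = r' := by
  have p := γ.isPSeq
  have p' := γ'.isPSeq
  rw [h] at p
  rw [h'] at p'
  exact run_unique p.isChain.right_of_append p'.isChain.right_of_append
    p.nodup.of_append_right p'.nodup.of_append_right p.run p'.run

/-- An element of `P(G)` is determined by any of its (oriented) edges. -/
theorem edge_unique {γ γ' : PSeq G} {l r l' r' : List V} {a b : V}
    (h : γ.verts = l ++ a :: b :: r) (h' : γ'.verts = l' ++ a :: b :: r') : γ = γ' := by
  have hr := edge_unique_right h h'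
  have hl := edge_unique_right (γ := γ.rev) (γ' := γ'.rev)
    (l := r.reverse) (r := l.reverse) (l' := r'.reverse) (r' := l'.reverse) (a := b) (b := a)
    (by simp [rev, h]) (by simp [rev, h'])
  ext1
  rw [h, h', hr, List.reverse_injective hl]

/-- The vertices next to x on γ exhaust its neighbours: there are two of them when x is interior,
and an end of γ has degree ≠ 2, hence at most 1 here. -/
theorem exists_edge_of_mem [Finite V] {γ : PSeq G} {x b : V} (hx : x ∈ γ.verts) (hd : deg G x ≤ 2)
    (hb : G.Adj x b) :
    ∃ l r, γ.verts = l ++ x :: b :: r ∨ γ.verts = l ++ b :: x :: r := by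
  have hb0 : 0 < deg G x := (Set.ncard_pos (Set.toFinite _)).2 ⟨b, hb⟩
  have hmem : ∀ s : Finset V, (∀ y ∈ s, G.Adj x y) → deg G x ≤ s.card → b ∈ s := by
    intro s hs hc
    have : (s : Set V) = G.neighborSet x := Set.eq_of_subset_of_ncard_le hs
      (by rwa [Set.ncard_coe_finset]) (Set.toFinite _)
    have hb' : b ∈ (s : Set V) := by rw [this]; exact hb
    exact hb'
  classical
  have p := γ.isPSeq
  obtain ⟨l, r, h⟩ := List.append_of_mem hx
  rw [h] at p ⊢
  have hnext : ∀ y ∈ r.head?, G.Adj x y := by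
    intro y hy
    have := p.isChain.right_of_append
    rcases r with _ | ⟨n, r⟩
    · simp at hy
    · simp at hy
      subst hy
      simp at this
      exact this.1
  have hprev : ∀ y ∈ l.getLast?, G.Adj x y := by
    intro y hy
    rw [Option.mem_def, List.getLast?_eq_some_iff] at hy
    obtain ⟨l', rfl⟩ := hy
    have := p.isChain
    rw [List.append_assoc, List.singleton_append] at this
    have := this.right_of_append
    simp at this
    exact this.1.symm
  rcases List.eq_nil_or_concat l with rfl | ⟨l, q, rfl⟩ <;> rcases r with _ | ⟨n, r⟩
  · exfalso
    rcases p with ⟨y, hy, h0⟩ | ⟨h1, -⟩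
    · simp at hy
      subst hy
      omega
    · simp at h1
  · have hd1 : deg G x ≠ 2 := by
      have := p.deg_head
      simpa using this
    have := hmem {n} (by simpa using hnext) (by rw [Finset.card_singleton]; omega)
    simp at this
    subst this
    exact ⟨[], r, Or.inl rfl⟩
  · have hd1 : deg G x ≠ 2 := by
      have := p.deg_getLast
      simpa using this
    have := hmem {q} (by simpa using hprev) (by rw [Finset.card_singleton]; omega)
    simp at this
    subst this
    exact ⟨l, [], Or.inr (by simp)⟩
  · have hne : q ≠ n := by
      rintro rfl
      have := p.nodup
      simp [List.nodup_append] at this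
    have := hmem {q, n} (by simpa using ⟨by simpa using hprev, by simpa using hnext⟩)
      (by rwa [Finset.card_pair hne])
    simp at this
    rcases this with rfl | rfl
    · exact ⟨l, n :: r, Or.inr (by simp)⟩
    · exact ⟨l ++ [q], r, Or.inl (by simp)⟩

theorem verts_of_deg_eq_zero [Finite V] {γ : PSeq G} {x : V} (hx : x ∈ γ.verts)
    (hd : deg G x = 0) : γ.verts = [x] := by
  have hno : ∀ b, ¬ G.Adj x b := by
    intro b hb
    have : 0 < deg G x := (Set.ncard_pos (Set.toFinite _)).2 ⟨b, hb⟩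
    omega
  have p := γ.isPSeq
  obtain ⟨l, r, h⟩ := List.append_of_mem hx
  rw [h] at p ⊢
  have hr : r = [] := by
    rcases r with _ | ⟨n, r⟩
    · rfl
    · have := p.isChain.right_of_append
      simp at this
      exact absurd this.1 (hno n)
  have hl : l = [] := by
    rcases List.eq_nil_or_concat l with rfl | ⟨l, q, rfl⟩
    · rfl
    · have := p.isChain
      rw [List.concat_eq_append, List.append_assoc, List.singleton_append] at this
      have := this.right_of_append
      simp at this
      exact absurd this.1.symm (hno q)
  simp [hl, hr]

/-- A vertex of degree at most two is on only one element of `P(G)`, up to reversal. -/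
theorem eq_or_eq_rev_of_mem [Finite V] {γ γ' : PSeq G} {x : V} (hx : x ∈ γ.verts)
    (hx' : x ∈ γ'.verts) (hd : deg G x ≤ 2) : γ' = γ ∨ γ' = γ.rev := by
  rcases Nat.eq_zero_or_pos (deg G x) with h0 | h0
  · left
    ext1
    rw [verts_of_deg_eq_zero hx h0, verts_of_deg_eq_zero hx' h0]
  · obtain ⟨b, hb⟩ := (Set.ncard_pos (Set.toFinite (G.neighborSet x))).1 h0
    obtain ⟨l, r, h⟩ := exists_edge_of_mem hx hd hb
    obtain ⟨l', r', h'⟩ := exists_edge_of_mem hx' hd hb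
    rcases h with h | h <;> rcases h' with h' | h'
    · exact Or.inl (edge_unique h' h)
    · exact Or.inr (edge_unique (γ' := γ.rev) (l' := r.reverse) (r' := l.reverse) h'
        (by simp [rev, h]))
    · exact Or.inr (edge_unique (γ' := γ.rev) (l' := r.reverse) (r' := l.reverse) h'
        (by simp [rev, h]))
    · exact Or.inl (edge_unique h' h)

end PSeq

/-- Prolong the path to the left as long as its first vertex has degree 2, using the neighbour not
yet on it. Acyclicity makes that neighbour new, so finiteness stops the process, at z. -/
theorem exists_extension [Finite V] (hG : G.IsAcyclic) (x y : V) (t : List V)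
    (hnd : (x :: y :: t).Nodup) (hch : (x :: y :: t).IsChain G.Adj) :
    ∃ m z s, m ++ [x] = z :: s ∧ deg G z ≠ 2 ∧ (∀ u ∈ s, deg G u = 2) ∧
      (m ++ x :: y :: t).Nodup ∧ (m ++ x :: y :: t).IsChain G.Adj := by
  induction hn : Nat.card V - t.length using Nat.strong_induction_on generalizing x y t with
  | _ n ih =>
  by_cases hx : deg G x = 2
  swap
  · exact ⟨[], x, [], rfl, hx, by simp, hnd, hch⟩
  obtain ⟨w, hw, hwy⟩ : ∃ w ∈ G.neighborSet x, w ≠ y := by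
    apply Set.exists_ne_of_one_lt_ncard
    change 1 < deg G x
    omega
  have hp : (SimpleGraph.Walk.ofSupport (x :: y :: t) (by simp) hch).IsPath := by
    rw [SimpleGraph.Walk.isPath_def, SimpleGraph.Walk.support_ofSupport]; exact hnd
  have hwn : w ∉ x :: y :: t := by
    intro hmem
    have := hG.eq_snd_of_adj_start hp hw
      (by rw [SimpleGraph.Walk.support_ofSupport]; exact hmem)
    exact hwy (this.trans (SimpleGraph.Walk.getVert_zero _))
  have hnd' : (w :: x :: y :: t).Nodup := List.nodup_cons.2 ⟨hwn, hnd⟩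
  have hle := hnd'.length_le_natCard
  simp only [List.length_cons] at hle
  obtain ⟨m, z, s, h1, h2, h3, h4, h5⟩ := ih _ (by rw [← hn, List.length_cons]; omega) w x (y :: t)
    hnd' (List.isChain_cons_cons.2 ⟨SimpleGraph.Adj.symm hw, hch⟩) rfl
  refine ⟨m ++ [w], z, s ++ [x], by simp [h1], h2, ?_, by simpa using h4, by simpa using h5⟩
  intro u hu
  rcases List.mem_append.1 hu with hu | hu
  · exact h3 u hu
  · rw [List.mem_singleton.1 hu, hx]

/-- Every edge of a forest `G` is on some element of `P(G)`. -/
theorem exists_pSeq_of_adj [Finite V] (hG : G.IsAcyclic) {a b : V} (hab : G.Adj a b) :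
    ∃ (γ : PSeq G) (l r : List V), γ.verts = l ++ a :: b :: r := by
  obtain ⟨m, z, s, h1, h2, h3, h4, h5⟩ := exists_extension hG a b [] (by simpa using hab.ne)
    (by simpa using hab)
  have e : (m ++ [a, b]).reverse = b :: a :: m.reverse := by simp
  have h4' : (b :: a :: m.reverse).Nodup := by
    rw [← e]
    exact List.nodup_reverse.2 h4
  have h5' : (b :: a :: m.reverse).IsChain G.Adj := by
    rw [← e, List.isChain_reverse]
    exact h5.imp fun _ _ h => h.symm
  obtain ⟨m', z', s', h1', h2', h3', h4', h5'⟩ := exists_extension hG b a m.reverse h4' h5'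
  have key : m' ++ b :: a :: m.reverse = z' :: ((s' ++ s.reverse) ++ [z]) := by
    have e1 : a :: m.reverse = (z :: s).reverse := by
      rw [← h1]
      simp
    rw [show m' ++ b :: a :: m.reverse = (m' ++ [b]) ++ (a :: m.reverse) by simp, h1', e1]
    simp
  let γ : PSeq G := ⟨m' ++ b :: a :: m.reverse, by
    rw [key] at h4' h5' ⊢
    refine isPSeq_cons_append_iff.2 ⟨h4', h5', h2', h2, ?_⟩
    intro u hu
    rcases List.mem_append.1 hu with hu | hu
    · exact h3' u hu
    · exact h3 u (List.mem_reverse.1 hu)⟩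
  exact ⟨γ.rev, m, m'.reverse, by simp [PSeq.rev, γ]⟩

/-- Every vertex of a forest `G` is on some element of `P(G)`. -/
theorem exists_pSeq_of_mem [Finite V] (hG : G.IsAcyclic) (a : V) :
    ∃ γ : PSeq G, a ∈ γ.verts := by
  rcases Nat.eq_zero_or_pos (deg G a) with h0 | h0
  · exact ⟨⟨[a], Or.inl ⟨a, rfl, h0⟩⟩, by simp⟩
  · obtain ⟨b, hb⟩ := (Set.ncard_pos (Set.toFinite (G.neighborSet a))).1 h0
    obtain ⟨γ, l, r, h⟩ := exists_pSeq_of_adj hG hb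
    exact ⟨γ, by simp [h]⟩

theorem IsAcyclic.eq_of_adj_adj (hG : G.IsAcyclic) {x y z : V} (h1 : G.Adj x y)
    (h2 : G.Adj y z) (h3 : G.Adj x z) : False := by
  have := (hG.subsingleton_path x z).elim ⟨.cons h1 (.cons h2 .nil), by simp [h1.ne, h2.ne, h3.ne]⟩
    ⟨.cons h3 .nil, by simp [h3.ne]⟩
  simp at this
  exact h2.ne this.1

end Paths

/-! ## Forests with a skeletal map -/

/-- A weighted forest with a skeletal map from `S` to it. -/
structure Marked (S : Skeleton.{u}) where
  forest : WeightedForest.{v}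
  σ : VtxNe2 S.graph → VtxNe2 forest.graph
  isSkeletal : IsSkeletal σ

namespace Marked

variable {S : Skeleton.{u}} (m : Marked.{u, v} S)

/-- The element of `P(G)` corresponding to an element of `P(S)`. -/
noncomputable def path (γ : PSeq S.graph) : PSeq m.forest.graph :=
  vec m.σ m.isSkeletal.isPreSkeletal γ

theorem path_first (γ : PSeq S.graph) : (m.path γ).first = m.σ γ.first := vec_first _ _ _

theorem path_last (γ : PSeq S.graph) : (m.path γ).last = m.σ γ.last := vec_last _ _ _

theorem path_eq {γ : PSeq S.graph} {δ : PSeq m.forest.graph} (h1 : δ.first = m.σ γ.first)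
    (h2 : δ.last = m.σ γ.last) : m.path γ = δ :=
  PSeq.eq_of_ends m.forest.isAcyclic _ _ (by rw [h1, path_first]) (by rw [h2, path_last])

theorem path_rev (γ : PSeq S.graph) : m.path γ.rev = (m.path γ).rev :=
  m.path_eq (by rw [PSeq.rev_first, PSeq.rev_first, path_last])
    (by rw [PSeq.rev_last, PSeq.rev_last, path_first])

theorem path_surjective : Function.Surjective m.path := m.isSkeletal.surjective

/-- Distinct vertices of `S` with the same image are adjacent, with image of degree zero. -/
theorem adj_of_σ_eq {x y : VtxNe2 S.graph} (hne : x ≠ y) (h : m.σ x = m.σ y) :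
    S.graph.Adj x.1 y.1 ∧ deg m.forest.graph (m.σ x).1 = 0 := by
  obtain ⟨γ, rfl, rfl⟩ := m.isSkeletal.joined x y hne h
  refine ⟨Skeleton.adj_first_last γ, ?_⟩
  have := (m.path γ).deg_eq_zero (by rw [path_first, path_last, h])
  rwa [path_first] at this

/-- A vertex of `S`, as a vertex of degree different from two. -/
def vtx (x : S.V) : VtxNe2 S.graph := ⟨x, (S.deg_ne x).2⟩

/-- Identified vertices are adjacent, so y and y' would form a triangle with x. -/
theorem σ_injOn_neighborSet {x y y' : S.V} (h : S.graph.Adj x y) (h' : S.graph.Adj x y')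
    (he : m.σ (vtx y) = m.σ (vtx y')) : y = y' := by
  by_contra hne
  have := (m.adj_of_σ_eq (fun h => hne (congrArg Subtype.val h)) he).1
  exact IsAcyclic.eq_of_adj_adj S.isAcyclic h this h'

/-- Send a neighbour y of x to the second vertex of the path from σ x to the image of y. This is
injective: equal second vertices give equal paths by `PSeq.edge_unique`, hence equal ends. -/
theorem deg_le {x : VtxNe2 S.graph} (hx : 2 < deg S.graph x.1) :
    deg S.graph x.1 ≤ deg m.forest.graph (m.σ x).1 := by
  have key : ∀ y : S.graph.neighborSet x.1, ∃ b r, (m.path (Skeleton.pair y.2)).verts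
      = (m.σ x).1 :: b :: r := by
    intro y
    have hf : (m.path (Skeleton.pair y.2)).first = m.σ x := m.path_first _
    have hl : (m.path (Skeleton.pair y.2)).last = m.σ (vtx y.1) := m.path_last _
    rcases (m.path (Skeleton.pair y.2)).isPSeq.eq_singleton_or with ⟨a, h, h0⟩ | ⟨a, t, z, h⟩
    · exfalso
      simp only [PSeq.first, h] at hf
      have hσ : deg m.forest.graph (m.σ x).1 = 0 := by
        rw [← hf]
        exact h0
      -- If σ x were isolated, all paths from it would be the single vertex σ x, so two distinct
      -- neighbours of x would have the same image.
      obtain ⟨z, hz, hzy⟩ := Set.exists_ne_of_one_lt_ncard (s := S.graph.neighborSet x.1)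
        (by change 1 < deg _ _; omega) y.1
      refine hzy (m.σ_injOn_neighborSet hz y.2 ?_)
      have e : ∀ (w : S.V) (hw : S.graph.Adj x.1 w), m.σ (vtx w) = m.σ x := by
        intro w hw
        have h1 : (m.path (Skeleton.pair hw)).first = m.σ x := m.path_first _
        have h2 : (m.path (Skeleton.pair hw)).last = m.σ (vtx w) := m.path_last _
        have h3 := PSeq.verts_of_deg_eq_zero (γ := m.path (Skeleton.pair hw)) (x := (m.σ x).1)
          (by rw [← h1]; exact List.head_mem _) hσ
        rw [← h2]
        ext
        simp [PSeq.last, h3]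
      rw [e z hz, e y.1 y.2]
    · have ha : (m.σ x).1 = a := by
        rw [← hf]
        simp [PSeq.first, h]
      rw [h, ha]
      rcases t with _ | ⟨b, t⟩
      · exact ⟨z, [], rfl⟩
      · exact ⟨b, t ++ [z], rfl⟩
  choose f r hf using key
  have hmem : ∀ y, f y ∈ m.forest.graph.neighborSet (m.σ x).1 := by
    intro y
    have := (m.path (Skeleton.pair y.2)).isPSeq.isChain
    rw [hf] at this
    simp at this
    exact this.1
  have hinj : Function.Injective f := by
    intro y y' h
    have := PSeq.edge_unique (l := []) (l' := []) (hf y) (by rw [hf y', h]; rfl)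
    have h1 : (m.path (Skeleton.pair y.2)).last = m.σ (vtx y.1) := m.path_last _
    have h2 : (m.path (Skeleton.pair y'.2)).last = m.σ (vtx y'.1) := m.path_last _
    rw [this, h2] at h1
    exact Subtype.ext (m.σ_injOn_neighborSet y.2 y'.2 h1.symm)
  unfold deg
  rw [← Nat.card_coe_set_eq, ← Nat.card_coe_set_eq]
  exact Nat.card_le_card_of_injective (fun y => (⟨f y, hmem y⟩ : m.forest.graph.neighborSet _))
    fun y y' h => hinj (congrArg Subtype.val h)

theorem two_lt_deg_iff {x : VtxNe2 S.graph} :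
    2 < deg m.forest.graph (m.σ x).1 ↔ 2 < deg S.graph x.1 :=
  ⟨m.isSkeletal.two_lt_deg m.forest.isAcyclic S.deg_ne x, fun h => h.trans_le (m.deg_le h)⟩

theorem deg_eq_one_of_σ_eq {x y : VtxNe2 S.graph} (hne : x ≠ y) (h : m.σ x = m.σ y) :
    deg S.graph x.1 = 1 := by
  have h0 := (m.adj_of_σ_eq hne h).2
  have h1 := m.two_lt_deg_iff (x := x)
  have := S.deg_ne x.1
  omega

/-- The map `P(S) → P(G)` is injective up to reversal. -/
theorem eq_or_eq_rev_of_path_eq {γ δ : PSeq S.graph} (h : m.path γ = m.path δ) :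
    γ = δ ∨ γ = δ.rev := by
  have h1 : m.σ γ.first = m.σ δ.first := by rw [← path_first, h, path_first]
  have h2 : m.σ γ.last = m.σ δ.last := by rw [← path_last, h, path_last]
  have nbr : ∀ {x : S.V} {y z : S.V}, deg S.graph x = 1 → S.graph.Adj x y → S.graph.Adj x z →
      y = z := by
    intro x y z hx hy hz
    obtain ⟨p, hp⟩ := Set.ncard_eq_one.1 hx
    have hy' : y ∈ S.graph.neighborSet x := hy
    have hz' : z ∈ S.graph.neighborSet x := hz
    rw [hp] at hy' hz'
    rw [Set.mem_singleton_iff.1 hy', Set.mem_singleton_iff.1 hz']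
  have aγ := Skeleton.adj_first_last γ
  have aδ := Skeleton.adj_first_last δ
  by_cases e1 : γ.first = δ.first
  · by_cases e2 : γ.last = δ.last
    · exact Or.inl (Skeleton.pSeq_ext e1 e2)
    · have := (m.adj_of_σ_eq e2 h2).1
      rw [e1] at aγ
      exact (IsAcyclic.eq_of_adj_adj S.isAcyclic aγ this aδ).elim
  -- The distinct first vertices have one image, so they are adjacent vertices of degree 1. Each of
  -- γ and δ must then be the edge joining them, in opposite directions.
  · have a1 := (m.adj_of_σ_eq e1 h1).1
    have d1 := m.deg_eq_one_of_σ_eq e1 h1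
    have d2 := m.deg_eq_one_of_σ_eq (Ne.symm e1) h1.symm
    right
    refine Skeleton.pSeq_ext ?_ ?_
    · rw [PSeq.rev_first]
      exact Subtype.ext (nbr d2 a1.symm aδ)
    · rw [PSeq.rev_last]
      exact Subtype.ext (nbr d1 aγ a1)

/-- The sequence of weights associated to an element of `P(S)`. -/
noncomputable def seqWeights (γ : PSeq S.graph) : List ℤ := m.forest.pathWeights (m.path γ)

/-- The weights of the vertices of degree greater than two. -/
def vertexWeights (x : VtxGt2 S.graph) : ℤ := m.forest.weight (m.σ x.toNe2).1

theorem seqWeights_rev (γ : PSeq S.graph) : m.seqWeights γ.rev = (m.seqWeights γ).reverse := by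
  rw [seqWeights, path_rev]
  simp [seqWeights, WeightedForest.pathWeights, PSeq.rev, List.filter_reverse, List.map_reverse]

/-- The end weight at a vertex, if its degree is greater than two. -/
noncomputable def _root_.Blowing.endWeight (w : VtxGt2 S.graph → ℤ) (x : VtxNe2 S.graph) :
    List ℤ :=
  if h : 2 < deg S.graph x.1 then [w ⟨x.1, h⟩] else []

/-- Only the ends of a path can be branch vertices, so adding back their weights recovers the full
list. In particular the state determines the number of vertices of every path. -/
theorem map_weight_path (γ : PSeq S.graph) : (m.path γ).verts.map m.forest.weight =
    endWeight m.vertexWeights γ.first ++ m.seqWeights γ ++ endWeight m.vertexWeights γ.last := by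
  have e : ∀ x : VtxNe2 S.graph, endWeight m.vertexWeights x =
      if 2 < deg m.forest.graph (m.σ x).1 then [m.forest.weight (m.σ x).1] else [] := by
    intro x
    unfold endWeight
    simp only [m.two_lt_deg_iff]
    split_ifs <;> rfl
  rw [e, e, ← path_first, ← path_last, seqWeights, WeightedForest.pathWeights]
  have p := (m.path γ).isPSeq
  rcases p.eq_singleton_or with ⟨x, h, h0⟩ | ⟨a, t, z, h⟩
  · simp [PSeq.first, PSeq.last, h, h0]
  · rw [h] at p
    obtain ⟨-, -, ha, hz, ht⟩ := isPSeq_cons_append_iff.1 p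
    have hf : t.filter (fun x => deg m.forest.graph x < 3) = t := by
      rw [List.filter_eq_self]
      intro u hu
      simp [ht u hu]
    simp only [PSeq.first, PSeq.last, h, List.head_cons]
    rw [List.filter_cons, List.filter_append, hf]
    have : ∀ (l : List m.forest.V) (hl : l = a :: (t ++ [z])) (hl' : l ≠ []),
        l.getLast hl' = z := by
      rintro _ rfl _
      simp
    rw [this _ rfl]
    by_cases h1 : 2 < deg m.forest.graph a <;> by_cases h2 : 2 < deg m.forest.graph z <;>
      simp [h1, h2, show (deg m.forest.graph a < 3) ↔ ¬ (2 < deg m.forest.graph a) by omega,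
        show (deg m.forest.graph z < 3) ↔ ¬ (2 < deg m.forest.graph z) by omega]

end Marked

end Blowing

namespace Blowing

/-! ## Isomorphisms -/

section Iso

variable {V : Type u} {V' : Type v} {G : SimpleGraph V} {G' : SimpleGraph V'}

theorem deg_iso (e : G ≃g G') (x : V) : deg G' (e x) = deg G x := by
  unfold deg
  rw [← Nat.card_coe_set_eq, ← Nat.card_coe_set_eq]
  exact (Nat.card_congr (e.mapNeighborSet x)).symm

/-- The image of an element of `P(G)` under an isomorphism. -/
def PSeq.map (e : G ≃g G') (γ : PSeq G) : PSeq G' where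
  verts := γ.verts.map e
  isPSeq := by
    rcases γ.isPSeq with ⟨x, h, h0⟩ | ⟨h1, h2, h3, h4⟩
    · exact Or.inl ⟨e x, by simp [h], by rw [deg_iso, h0]⟩
    · refine Or.inr ⟨by simpa using h1, h2.map e.injective, ?_, ?_⟩
      · rw [List.isChain_map]
        exact h3.imp fun a b h => e.map_adj_iff.2 h
      · intro i hi
        rw [List.getElem_map, deg_iso, h4, List.length_map]

theorem PSeq.map_first (e : G ≃g G') (γ : PSeq G) : (γ.map e).first.1 = e γ.first.1 := by
  simp [PSeq.first, PSeq.map]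

theorem PSeq.map_last (e : G ≃g G') (γ : PSeq G) : (γ.map e).last.1 = e γ.last.1 := by
  simp [PSeq.last, PSeq.map]

end Iso

variable {S : Skeleton.{u}}

namespace Marked

/-- Isomorphism of weighted forests with skeletal maps. -/
def IsIsomorphic (m m' : Marked.{u, v} S) : Prop :=
  ∃ f : m.forest.toWeightedGraph.Iso m'.forest.toWeightedGraph,
    ∀ s, f.toIso (m.σ s).1 = (m'.σ s).1

variable {m m' : Marked.{u, v} S}

theorem IsIsomorphic.vertexWeights_eq (h : m.IsIsomorphic m') :
    m'.vertexWeights = m.vertexWeights := by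
  obtain ⟨f, hf⟩ := h
  funext x
  rw [vertexWeights, vertexWeights, ← hf, f.weight_eq]

theorem IsIsomorphic.seqWeights_eq (h : m.IsIsomorphic m') :
    m'.seqWeights = m.seqWeights := by
  obtain ⟨f, hf⟩ := h
  funext γ
  have : m'.path γ = (m.path γ).map f.toIso := m'.path_eq
    (Subtype.ext (by rw [PSeq.map_first, path_first, hf]))
    (Subtype.ext (by rw [PSeq.map_last, path_last, hf]))
  rw [seqWeights, seqWeights, this, WeightedForest.pathWeights, WeightedForest.pathWeights,
    PSeq.map, List.filter_map, List.map_map]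
  congr 1
  · funext x
    exact f.weight_eq x
  · congr 1
    funext x
    simp [deg_iso]

/-- Vertices occupying corresponding positions. -/
def Corr (m m' : Marked.{u, v} S) (a : m.forest.V) (b : m'.forest.V) : Prop :=
  ∃ (γ : PSeq S.graph) (i : ℕ), (m.path γ).verts[i]? = some a ∧ (m'.path γ).verts[i]? = some b

theorem Corr.symm {a : m.forest.V} {b : m'.forest.V} (h : Corr m m' a b) : Corr m' m b a := by
  obtain ⟨γ, i, h1, h2⟩ := h
  exact ⟨γ, i, h2, h1⟩

theorem _root_.Blowing.PSeq.getElem?_zero {V : Type u} {G : SimpleGraph V} (γ : PSeq G) :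
    γ.verts[0]? = some γ.first.1 := by
  rw [← List.head?_eq_getElem?, List.head?_eq_some_head γ.isPSeq.ne_nil]
  rfl

theorem _root_.Blowing.PSeq.getElem?_last {V : Type u} {G : SimpleGraph V} (γ : PSeq G) :
    γ.verts[γ.verts.length - 1]? = some γ.last.1 := by
  rw [← List.getLast?_eq_getElem?, List.getLast?_eq_some_getLast γ.isPSeq.ne_nil]
  rfl

theorem Corr.eq_σ (hlen : ∀ γ, (m.path γ).verts.length = (m'.path γ).verts.length)
    {a : m.forest.V} {b : m'.forest.V} (h : Corr m m' a b) (ha : deg m.forest.graph a ≠ 2) :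
    ∃ x, a = (m.σ x).1 ∧ b = (m'.σ x).1 := by
  obtain ⟨γ, i, h1, h2⟩ := h
  obtain ⟨hi, ha'⟩ := List.getElem?_eq_some_iff.1 h1
  have hend : i = 0 ∨ i + 1 = (m.path γ).verts.length := by
    rcases (m.path γ).isPSeq with ⟨x, h, -⟩ | ⟨-, -, -, h4⟩
    · rw [h] at hi
      simp at hi
      exact Or.inl hi
    · exact (h4 i hi).1 (by rwa [ha'])
  rcases hend with rfl | hend
  · rw [PSeq.getElem?_zero, path_first] at h1 h2
    exact ⟨_, (Option.some_inj.1 h1).symm, (Option.some_inj.1 h2).symm⟩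
  · obtain rfl : i = (m.path γ).verts.length - 1 := by omega
    rw [PSeq.getElem?_last, path_last] at h1
    rw [hlen, PSeq.getElem?_last, path_last] at h2
    exact ⟨_, (Option.some_inj.1 h1).symm, (Option.some_inj.1 h2).symm⟩

/-- A vertex of degree at most 2 occurs at one position of one path, up to reversal, and equal
lengths make reversal compatible on both sides. A branch vertex has a unique preimage under σ. -/
theorem Corr.unique (hlen : ∀ γ, (m.path γ).verts.length = (m'.path γ).verts.length)
    {a : m.forest.V} {b b' : m'.forest.V} (h : Corr m m' a b) (h' : Corr m m' a b') : b = b' := by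
  by_cases ha : deg m.forest.graph a ≤ 2
  · obtain ⟨γ, i, h1, h2⟩ := h
    obtain ⟨δ, j, h1', h2'⟩ := h'
    obtain ⟨hi, e⟩ := List.getElem?_eq_some_iff.1 h1
    obtain ⟨hj, e'⟩ := List.getElem?_eq_some_iff.1 h1'
    have key : δ = γ ∨ δ = γ.rev := by
      rcases PSeq.eq_or_eq_rev_of_mem (List.mem_of_getElem? h1) (List.mem_of_getElem? h1') ha with
        h | h
      · exact m.eq_or_eq_rev_of_path_eq h
      · rw [← path_rev] at h
        rcases m.eq_or_eq_rev_of_path_eq h with h | h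
        · exact Or.inr h
        · exact Or.inl (by rw [h, PSeq.rev_rev])
    rcases key with rfl | rfl
    · have : i = j := ((m.path δ).isPSeq.nodup.getElem_inj_iff).1 (e.trans e'.symm)
      subst this
      exact Option.some_inj.1 (h2.symm.trans h2')
    · rw [path_rev] at h1' h2' hj
      simp only [PSeq.rev, List.length_reverse] at h1' h2' hj
      rw [List.getElem?_reverse hj] at h1'
      rw [List.getElem?_reverse (by rwa [← hlen])] at h2'
      obtain ⟨hj', e'⟩ := List.getElem?_eq_some_iff.1 h1'
      have : i = (m.path γ).verts.length - 1 - j :=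
        ((m.path γ).isPSeq.nodup.getElem_inj_iff).1 (e.trans e'.symm)
      rw [← hlen, ← this] at h2'
      exact Option.some_inj.1 (h2.symm.trans h2')
  · obtain ⟨x, hx, rfl⟩ := h.eq_σ hlen (by omega)
    obtain ⟨y, hy, rfl⟩ := h'.eq_σ hlen (by omega)
    have : x = y := by
      by_contra hne
      have := (m.adj_of_σ_eq hne (Subtype.ext (hx.symm.trans hy))).2
      rw [← hx] at this
      omega
    rw [this]

theorem exists_corr (hlen : ∀ γ, (m.path γ).verts.length = (m'.path γ).verts.length)
    (a : m.forest.V) : ∃ b, Corr m m' a b := by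
  obtain ⟨δ, hδ⟩ := exists_pSeq_of_mem m.forest.isAcyclic a
  obtain ⟨γ, rfl⟩ := m.path_surjective δ
  obtain ⟨i, hi, h⟩ := List.getElem_of_mem hδ
  exact ⟨_, γ, i, List.getElem?_eq_some_iff.2 ⟨hi, h⟩,
    List.getElem?_eq_some_iff.2 ⟨by rwa [← hlen], rfl⟩⟩

theorem Corr.adj (hlen : ∀ γ, (m.path γ).verts.length = (m'.path γ).verts.length)
    {a b : m.forest.V} {a' b' : m'.forest.V} (ha : Corr m m' a a') (hb : Corr m m' b b')
    (hab : m.forest.graph.Adj a b) : m'.forest.graph.Adj a' b' := by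
  obtain ⟨δ, l, r, hδ⟩ := exists_pSeq_of_adj m.forest.isAcyclic hab
  obtain ⟨γ, rfl⟩ := m.path_surjective δ
  have hi : l.length + 1 < (m'.path γ).verts.length := by
    rw [← hlen, hδ]
    simp
  have h1 : Corr m m' a (m'.path γ).verts[l.length] := ⟨γ, l.length, by simp [hδ], by simp⟩
  have h2 : Corr m m' b (m'.path γ).verts[l.length + 1] := ⟨γ, l.length + 1, by
    rw [hδ, List.getElem?_append_right (by simp)]
    simp, by simp⟩
  rw [ha.unique hlen h1, hb.unique hlen h2]
  exact (m'.path γ).isPSeq.isChain.getElem _ hi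

/-- A weighted forest with a skeletal map is determined up to isomorphism by its weights. -/
theorem isIsomorphic_of_weights_eq (h1 : m'.seqWeights = m.seqWeights)
    (h2 : m'.vertexWeights = m.vertexWeights) : m.IsIsomorphic m' := by
  have hmap : ∀ γ, (m.path γ).verts.map m.forest.weight
      = (m'.path γ).verts.map m'.forest.weight := by
    intro γ
    rw [map_weight_path, map_weight_path, h1, h2]
  have hlen : ∀ γ, (m.path γ).verts.length = (m'.path γ).verts.length := by
    intro γ
    simpa using congrArg List.length (hmap γ)
  have hlen' := fun γ => (hlen γ).symm
  choose f hf using exists_corr hlen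
  choose g hg using exists_corr hlen'
  refine ⟨⟨⟨⟨f, g, fun a => ?_, fun b => ?_⟩, fun {a b} => ⟨fun h => ?_, fun h => ?_⟩⟩, fun a => ?_⟩,
    fun x => ?_⟩
  · exact (hg (f a)).unique hlen' (hf a).symm
  · exact (hf (g b)).unique hlen (hg b).symm
  · exact (hf a).symm.adj hlen' (hf b).symm h
  · exact (hf a).adj hlen (hf b) h
  · change m'.forest.weight (f a) = _
    obtain ⟨γ, i, e1, e2⟩ := hf a
    have := congrArg (fun l => l[i]?) (hmap γ)
    simp only [List.getElem?_map, e1, e2] at this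
    exact (Option.some_inj.1 this).symm
  · change f (m.σ x).1 = _
    obtain ⟨y, hy⟩ := (Set.ncard_pos (Set.toFinite (S.graph.neighborSet x.1))).1
      (Nat.pos_of_ne_zero (S.deg_ne x.1).1)
    have e : ∀ m : Marked.{u, v} S, (m.path (Skeleton.pair hy)).verts[0]? = some (m.σ x).1 := by
      intro m
      rw [PSeq.getElem?_zero, path_first]
      rfl
    exact (hf _).unique hlen ⟨Skeleton.pair hy, 0, e m, e m'⟩

end Marked

end Blowing

namespace Blowing

/-! ## Subdivision of an edge and addition of a leaf -/

theorem PSeq.rev_verts {V : Type u} {G : SimpleGraph V} (γ : PSeq G) :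
    γ.rev.verts = γ.verts.reverse := rfl

theorem PSeq.first_eq_iff {V : Type u} {G : SimpleGraph V} {γ : PSeq G} {x : VtxNe2 G} :
    γ.first = x ↔ γ.verts.head? = some x.1 := by
  rw [List.head?_eq_some_head γ.isPSeq.ne_nil, Option.some_inj, Subtype.ext_iff]
  rfl

theorem PSeq.last_eq_iff {V : Type u} {G : SimpleGraph V} {γ : PSeq G} {x : VtxNe2 G} :
    γ.last = x ↔ γ.verts.getLast? = some x.1 := by
  rw [List.getLast?_eq_some_getLast γ.isPSeq.ne_nil, Option.some_inj, Subtype.ext_iff]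
  rfl

section Graph

variable {V : Type v}

/-- Subdivision of the edge `{a, b}`. -/
def subdivide (G : SimpleGraph V) (a b : V) : SimpleGraph (Option V) where
  Adj := fun
    | some x, some y => G.Adj x y ∧ s(x, y) ≠ s(a, b)
    | some x, none => x = a ∨ x = b
    | none, some y => y = a ∨ y = b
    | none, none => False
  symm := ⟨by
    rintro (_ | x) (_ | y) h
    · exact h
    · exact h
    · exact h
    · exact ⟨SimpleGraph.Adj.symm h.1, by rw [Sym2.eq_swap]; exact h.2⟩⟩
  loopless := ⟨by
    rintro (_ | x) h
    · exact h
    · exact G.loopless.irrefl _ h.1⟩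

/-- Addition of a new vertex, joined to `a`. -/
def addLeaf (G : SimpleGraph V) (a : V) : SimpleGraph (Option V) where
  Adj := fun
    | some x, some y => G.Adj x y
    | some x, none => x = a
    | none, some y => y = a
    | none, none => False
  symm := ⟨by rintro (_ | x) (_ | y) h <;> first | exact h | exact SimpleGraph.Adj.symm h⟩
  loopless := ⟨by rintro (_ | x) h <;> first | exact h | exact G.loopless.irrefl _ h⟩

variable {G : SimpleGraph V} {a b : V}

theorem deg_subdivide_none (hab : a ≠ b) : deg (subdivide G a b) none = 2 := by
  unfold deg
  have : (subdivide G a b).neighborSet none = {some a, some b} := by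
    ext (_ | x)
    · simp [subdivide]
    · simp [subdivide]
  rw [this, Set.ncard_pair (by simpa using hab)]

/-- At each end of the subdivided edge, `none` takes the place of the opposite end as a neighbour.
-/
theorem deg_subdivide_some (hab : G.Adj a b) (x : V) :
    deg (subdivide G a b) (some x) = deg G x := by
  classical
  unfold deg
  symm
  refine Set.ncard_congr (fun y _ => if s(x, y) = s(a, b) then none else some y) ?_ ?_ ?_
  · intro y hy
    split_ifs with h
    · have : x ∈ s(a, b) := by rw [← h]; simp
      simpa [subdivide] using this
    · exact ⟨hy, h⟩
  · intro y z hy hz h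
    split_ifs at h with h1 h2
    · exact Sym2.congr_right.1 (h1.trans h2.symm)
    · exact Option.some_inj.1 h
  · rintro (_ | y) hy
    · rcases hy with rfl | rfl
      · exact ⟨b, hab, by simp⟩
      · exact ⟨a, hab.symm, by simp [Sym2.eq_swap]⟩
    · exact ⟨y, hy.1, if_neg hy.2⟩

theorem deg_addLeaf_none : deg (addLeaf G a) none = 1 := by
  unfold deg
  have : (addLeaf G a).neighborSet none = {some a} := by
    ext (_ | x)
    · simp [addLeaf]
    · simp [addLeaf]
  rw [this, Set.ncard_singleton]

theorem deg_addLeaf_of_ne {x : V} (h : x ≠ a) : deg (addLeaf G a) (some x) = deg G x := by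
  unfold deg
  have : (addLeaf G a).neighborSet (some x) = some '' G.neighborSet x := by
    ext (_ | y)
    · simp [addLeaf, h]
    · simp [addLeaf]
  rw [this, Set.ncard_image_of_injective _ (Option.some_injective _)]

theorem deg_addLeaf_self [Finite V] : deg (addLeaf G a) (some a) = deg G a + 1 := by
  unfold deg
  have : (addLeaf G a).neighborSet (some a) = insert none (some '' G.neighborSet a) := by
    ext (_ | y)
    · simp [addLeaf]
    · simp [addLeaf]
  rw [this, Set.ncard_insert_of_notMem (by simp),
    Set.ncard_image_of_injective _ (Option.some_injective _)]

theorem reachable_of_map {W : Type*} {H : SimpleGraph W} {K : SimpleGraph V} (f : V → W)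
    (hf : ∀ x y, K.Adj x y → H.Reachable (f x) (f y)) {x y : V} (h : K.Reachable x y) :
    H.Reachable (f x) (f y) := by
  obtain ⟨p⟩ := h
  induction p with
  | nil => rfl
  | cons h _ ih => exact (hf _ _ h).trans ih

/-- Every edge is a bridge: collapsing `none` onto a suitable end of the old edge turns a detour
around an edge of the subdivision into a detour around the corresponding edge of G. -/
theorem isAcyclic_subdivide (hG : G.IsAcyclic) (hab : G.Adj a b) :
    (subdivide G a b).IsAcyclic := by
  have hbr := SimpleGraph.isAcyclic_iff_forall_adj_isBridge.1 hG
  rw [SimpleGraph.isAcyclic_iff_forall_adj_isBridge]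
  have key1 : ∀ x y, (subdivide G a b).Adj (some x) (some y) →
      (subdivide G a b).IsBridge s(some x, some y) := by
    rintro x y ⟨h1, h2⟩ h
    refine hbr h1 (reachable_of_map (fun o => o.getD a) ?_ h)
    have hab' : (G.deleteEdges {s(x, y)}).Adj a b :=
      SimpleGraph.deleteEdges_adj.2 ⟨hab, fun h => h2 h.symm⟩
    rintro (_ | u) (_ | w) huw
    · rfl
    · rcases (SimpleGraph.deleteEdges_adj.1 huw).1 with rfl | rfl
      · rfl
      · exact hab'.reachable
    · rcases (SimpleGraph.deleteEdges_adj.1 huw).1 with rfl | rfl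
      · rfl
      · exact hab'.symm.reachable
    · refine SimpleGraph.Adj.reachable (SimpleGraph.deleteEdges_adj.2 ?_)
      obtain ⟨⟨h3, -⟩, h4⟩ := SimpleGraph.deleteEdges_adj.1 huw
      refine ⟨h3, fun h5 => h4 ?_⟩
      rcases Sym2.eq_iff.1 h5 with ⟨rfl, rfl⟩ | ⟨rfl, rfl⟩
      · rfl
      · exact Sym2.eq_swap
  have key2 : ∀ c d, s(c, d) = s(a, b) → (subdivide G a b).IsBridge s(some c, none) := by
    intro c d hcd h
    have hadj : G.Adj c d := by
      rcases Sym2.eq_iff.1 hcd with ⟨rfl, rfl⟩ | ⟨rfl, rfl⟩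
      · exact hab
      · exact hab.symm
    have hmem : ∀ x, (x = a ∨ x = b) ↔ (x = c ∨ x = d) := by
      intro x
      rw [← Sym2.mem_iff, ← hcd, Sym2.mem_iff]
    -- The deleted half is {c, none}, so `none` collapses onto d, the end to which it stays joined.
    refine hbr hadj (reachable_of_map (fun o => o.getD d) ?_ h)
    rintro (_ | u) (_ | w) huw
    · rfl
    · obtain ⟨h3, h4⟩ := SimpleGraph.deleteEdges_adj.1 huw
      rcases (hmem w).1 h3 with rfl | rfl
      · exact absurd Sym2.eq_swap h4
      · rfl
    · obtain ⟨h3, h4⟩ := SimpleGraph.deleteEdges_adj.1 huw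
      rcases (hmem u).1 h3 with rfl | rfl
      · exact absurd rfl h4
      · rfl
    · obtain ⟨⟨h3, h4⟩, -⟩ := SimpleGraph.deleteEdges_adj.1 huw
      exact SimpleGraph.Adj.reachable
        (SimpleGraph.deleteEdges_adj.2 ⟨h3, fun h5 => h4 (h5.trans hcd)⟩)
  have key3 : ∀ c, (c = a ∨ c = b) → (subdivide G a b).IsBridge s(some c, none) := by
    rintro c (rfl | rfl)
    · exact key2 c b rfl
    · exact key2 c a Sym2.eq_swap
  rintro (_ | x) (_ | y) h
  · exact h.elim
  · rw [Sym2.eq_swap]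
    exact key3 y h
  · exact key3 x h
  · exact key1 x y h

theorem isAcyclic_addLeaf (hG : G.IsAcyclic) : (addLeaf G a).IsAcyclic := by
  have hbr := SimpleGraph.isAcyclic_iff_forall_adj_isBridge.1 hG
  rw [SimpleGraph.isAcyclic_iff_forall_adj_isBridge]
  have key : (addLeaf G a).IsBridge s(some a, none) := by
    intro h
    -- Without the new edge, `Option.isSome` is constant along edges, so it separates `none` from
    -- the old vertices.
    have := reachable_of_map (H := (⊥ : SimpleGraph Bool)) Option.isSome ?_ h
    · simp at this
    · rintro (_ | u) (_ | w) huw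
      · rfl
      · obtain ⟨h3, h4⟩ := SimpleGraph.deleteEdges_adj.1 huw
        obtain rfl : w = a := h3
        exact absurd Sym2.eq_swap h4
      · obtain ⟨h3, h4⟩ := SimpleGraph.deleteEdges_adj.1 huw
        obtain rfl : u = a := h3
        exact absurd rfl h4
      · rfl
  rintro (_ | x) (_ | y) h
  · exact h.elim
  · obtain rfl : y = a := h
    rw [Sym2.eq_swap]
    exact key
  · obtain rfl : x = a := h
    exact key
  · intro h'
    refine hbr h (reachable_of_map (fun o => o.getD a) ?_ h')
    rintro (_ | u) (_ | w) huw
    · rfl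
    · obtain ⟨h3, h4⟩ := SimpleGraph.deleteEdges_adj.1 huw
      obtain rfl : w = a := h3
      rfl
    · obtain ⟨h3, h4⟩ := SimpleGraph.deleteEdges_adj.1 huw
      obtain rfl : u = a := h3
      rfl
    · obtain ⟨h3, h4⟩ := SimpleGraph.deleteEdges_adj.1 huw
      refine SimpleGraph.Adj.reachable (SimpleGraph.deleteEdges_adj.2 ⟨h3, fun h5 => h4 ?_⟩)
      rcases Sym2.eq_iff.1 h5 with ⟨rfl, rfl⟩ | ⟨rfl, rfl⟩
      · rfl
      · exact Sym2.eq_swap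

theorem isChain_of_forall_infix {α : Type*} {R : α → α → Prop} {l : List α}
    (h : ∀ l₁ x y l₂, l = l₁ ++ x :: y :: l₂ → R x y) : l.IsChain R := by
  induction l with
  | nil => simp
  | cons a l ih =>
    rcases l with _ | ⟨b, l⟩
    · simp
    · rw [List.isChain_cons_cons]
      exact ⟨h [] a b l rfl, ih fun l₁ x y l₂ e => h (a :: l₁) x y l₂ (by simp [e])⟩

theorem IsChain.rel_of_eq {α : Type*} {R : α → α → Prop} {l l₁ l₂ : List α} {x y : α}
    (h : l.IsChain R) (e : l = l₁ ++ x :: y :: l₂) : R x y := by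
  subst e
  have := h.right_of_append
  rw [List.isChain_cons_cons] at this
  exact this.1

theorem isChain_map_some_subdivide {l : List V} (h : l.IsChain G.Adj)
    (h' : ∀ l₁ x y l₂, l = l₁ ++ x :: y :: l₂ → s(x, y) ≠ s(a, b)) :
    (l.map some).IsChain (subdivide G a b).Adj := by
  rw [List.isChain_map]
  exact isChain_of_forall_infix fun l₁ x y l₂ e => ⟨IsChain.rel_of_eq h e, h' l₁ x y l₂ e⟩

theorem isPSeq_map_some_of_deg_eq {H : SimpleGraph (Option V)} {l : List V} (h : IsPSeq G l)
    (hd : ∀ x ∈ l, deg H (some x) = deg G x) (hc : (l.map some).IsChain H.Adj) :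
    IsPSeq H (l.map some) := by
  rcases h with ⟨x, rfl, h0⟩ | ⟨h1, h2, h3, h4⟩
  · exact Or.inl ⟨some x, rfl, by rw [hd x (by simp), h0]⟩
  · refine Or.inr ⟨by simpa using h1, h2.map (Option.some_injective _), hc, ?_⟩
    intro i hi
    rw [List.getElem_map, hd _ (List.getElem_mem _), h4, List.length_map]

theorem isPSeq_subdivide {l₁ l₂ : List V} (hab : G.Adj a b) (h : IsPSeq G (l₁ ++ a :: b :: l₂)) :
    IsPSeq (subdivide G a b) (l₁.map some ++ some a :: none :: some b :: l₂.map some) := by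
  obtain ⟨c, p, hp⟩ : ∃ c p, l₁ ++ [a] = c :: p := by
    rcases l₁ with _ | ⟨c, l₁⟩
    · exact ⟨a, [], rfl⟩
    · exact ⟨c, l₁ ++ [a], rfl⟩
  obtain ⟨q, z, hq⟩ : ∃ q z, b :: l₂ = q ++ [z] :=
    ⟨_, _, (List.dropLast_append_getLast (by simp : b :: l₂ ≠ [])).symm⟩
  have e1 : l₁ ++ a :: b :: l₂ = c :: ((p ++ q) ++ [z]) := by
    rw [show l₁ ++ a :: b :: l₂ = (l₁ ++ [a]) ++ b :: l₂ by simp, hp, hq]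
    simp
  have e2 : l₁.map some ++ some a :: none :: some b :: l₂.map some =
      some c :: ((p.map some ++ none :: q.map some) ++ [some z]) := by
    rw [show l₁.map some ++ some a :: none :: some b :: l₂.map some
      = (l₁ ++ [a]).map some ++ none :: (b :: l₂).map some by simp, hp, hq]
    simp
  have hnd := h.nodup
  have hch := h.isChain
  rw [e1] at h
  obtain ⟨h1, h2, h3, h4, h5⟩ := isPSeq_cons_append_iff.1 h
  rw [e2, isPSeq_cons_append_iff, deg_subdivide_some hab, deg_subdivide_some hab]
  refine ⟨?_, ?_, h3, h4, ?_⟩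
  · rw [show some c :: (p.map some ++ none :: q.map some ++ [some z])
      = (some c :: p.map some) ++ none :: (q.map some ++ [some z]) by simp, List.nodup_middle]
    have := h1.map (Option.some_injective V)
    rw [List.nodup_cons]
    exact ⟨by simp, by simpa using this⟩
  · rw [← e2]
    have c1 : ((l₁ ++ [a]).map some).IsChain (subdivide G a b).Adj := by
      refine isChain_map_some_subdivide ?_ ?_
      · rw [show l₁ ++ a :: b :: l₂ = (l₁ ++ [a]) ++ b :: l₂ by simp] at hch
        exact hch.left_of_append
      -- The removed edge cannot occur in this half, which does not contain b.
      · intro m₁ x y m₂ e he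
        have hb : b ∈ l₁ ++ [a] := by
          have : b ∈ s(x, y) := by rw [he]; simp
          rw [e]
          rcases Sym2.mem_iff.1 this with h | h <;> simp [h]
        rw [show l₁ ++ a :: b :: l₂ = (l₁ ++ [a]) ++ b :: l₂ by simp] at hnd
        exact (List.disjoint_of_nodup_append hnd) hb (by simp)
    have c2 : ((b :: l₂).map some).IsChain (subdivide G a b).Adj := by
      refine isChain_map_some_subdivide ?_ ?_
      · exact (hch.right_of_append).tail
      · intro m₁ x y m₂ e he
        have ha : a ∈ b :: l₂ := by
          have : a ∈ s(x, y) := by rw [he]; simp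
          rw [e]
          rcases Sym2.mem_iff.1 this with h | h <;> simp [h]
        exact (List.nodup_cons.1 (hnd.of_append_right)).1 ha
    have c2' : (none :: (b :: l₂).map some).IsChain (subdivide G a b).Adj :=
      List.isChain_cons_cons.2 ⟨Or.inr rfl, c2⟩
    have c3 : (some a :: none :: (b :: l₂).map some).IsChain (subdivide G a b).Adj :=
      List.isChain_cons_cons.2 ⟨Or.inl rfl, c2'⟩
    rw [List.map_append, List.map_singleton] at c1
    exact List.isChain_split.2 ⟨c1, c3⟩
  · intro u hu
    rcases List.mem_append.1 hu with hu | hu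
    · obtain ⟨x, hx, rfl⟩ := List.mem_map.1 hu
      rw [deg_subdivide_some hab]
      exact h5 x (List.mem_append_left _ hx)
    · rcases List.mem_cons.1 hu with rfl | hu
      · exact deg_subdivide_none hab.ne
      · obtain ⟨x, hx, rfl⟩ := List.mem_map.1 hu
        rw [deg_subdivide_some hab]
        exact h5 x (List.mem_append_right _ hx)

/-- The new leaf becomes the end of the path. If a had degree 1 it becomes an interior vertex of
degree 2; if it was isolated it becomes the other end, of degree 1. -/
theorem isPSeq_addLeaf [Finite V] {t : List V} (ha : deg G a ≤ 1) (h : IsPSeq G (a :: t)) :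
    IsPSeq (addLeaf G a) (none :: some a :: t.map some) := by
  have hch : (none :: some a :: t.map some).IsChain (addLeaf G a).Adj := by
    have : ((a :: t).map some).IsChain (addLeaf G a).Adj := by
      rw [List.isChain_map]
      exact h.isChain
    exact List.isChain_cons_cons.2 ⟨rfl, this⟩
  have hnd : (none :: some a :: t.map some).Nodup := by
    have := h.nodup.map (Option.some_injective V)
    exact List.nodup_cons.2 ⟨by simp, this⟩
  rcases h.eq_singleton_or with ⟨x, hx, h0⟩ | ⟨c, m, z, he⟩
  · simp only [List.cons.injEq] at hx
    obtain ⟨rfl, rfl⟩ := hx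
    refine (isPSeq_cons_append_iff (m := [])).2 ⟨hnd, hch, ?_, ?_, by simp⟩
    · rw [deg_addLeaf_none]
      omega
    · rw [deg_addLeaf_self, h0]
      omega
  · rw [he] at h
    obtain ⟨h1, h2, h3, h4, h5⟩ := isPSeq_cons_append_iff.1 h
    simp only [List.cons.injEq] at he
    obtain ⟨rfl, rfl⟩ := he
    have hm : ∀ u ∈ m ++ [z], u ≠ a := by
      rintro u hu rfl
      exact (List.nodup_cons.1 h1).1 hu
    have ha0 : deg G a ≠ 0 := by
      obtain ⟨d, r, hd⟩ : ∃ d r, m ++ [z] = d :: r := by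
        rcases m with _ | ⟨d, m⟩
        · exact ⟨z, [], rfl⟩
        · exact ⟨d, m ++ [z], rfl⟩
      rw [hd, List.isChain_cons_cons] at h2
      exact ((Set.ncard_pos (Set.toFinite _)).2 ⟨d, h2.1⟩).ne'
    have e : none :: some a :: (m ++ [z]).map some = none :: ((some a :: m.map some) ++ [some z]) := by
      simp
    rw [e] at hnd hch ⊢
    refine isPSeq_cons_append_iff.2 ⟨hnd, hch, ?_, ?_, ?_⟩
    · rw [deg_addLeaf_none]
      omega
    · rwa [deg_addLeaf_of_ne (hm z (by simp))]
    · intro u hu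
      rcases List.mem_cons.1 hu with rfl | hu
      · rw [deg_addLeaf_self]
        omega
      · obtain ⟨x, hx, rfl⟩ := List.mem_map.1 hu
        rw [deg_addLeaf_of_ne (hm x (by simp [hx]))]
        exact h5 x hx

end Graph

/-! ### Skeletal maps to blowings-up -/

variable {S : Skeleton.{u}}

/-- In a forest the induced map must be f, since its values have the right ends. Surjectivity
reduces to covering edges and isolated vertices, because one oriented edge determines an element of
P(G). -/
theorem isSkeletal_of_cover {V : Type v} [Finite V] {G : SimpleGraph V} (hG : G.IsAcyclic)
    (σ : VtxNe2 S.graph → VtxNe2 G) (f : PSeq S.graph → PSeq G)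
    (h1 : ∀ γ, (f γ).first = σ γ.first) (h2 : ∀ γ, (f γ).last = σ γ.last)
    (hedge : ∀ a b, G.Adj a b → ∃ γ l r, (f γ).verts = l ++ a :: b :: r ∨
      (f γ).verts = l ++ b :: a :: r)
    (hzero : ∀ a, deg G a = 0 → ∃ γ, a ∈ (f γ).verts)
    (hjoin : ∀ x y, x ≠ y → σ x = σ y → S.graph.Adj x.1 y.1) : IsSkeletal σ := by
  have hpre : IsPreSkeletal σ := fun γ => ⟨f γ, (h1 γ).symm, (h2 γ).symm⟩
  have hvec : ∀ γ, vec σ hpre γ = f γ := fun γ =>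
    PSeq.eq_of_ends hG _ _ (by rw [vec_first, h1]) (by rw [vec_last, h2])
  have hrev : ∀ γ, f γ.rev = (f γ).rev := fun γ => PSeq.eq_of_ends hG _ _
    (by rw [h1, PSeq.rev_first, PSeq.rev_first, h2])
    (by rw [h2, PSeq.rev_last, PSeq.rev_last, h1])
  refine ⟨hpre, fun δ => ?_, fun x y hne h => ?_⟩
  · simp only [hvec]
    rcases δ.isPSeq.eq_singleton_or with ⟨x, hx, h0⟩ | ⟨a, m, z, he⟩
    · obtain ⟨γ, hγ⟩ := hzero x h0
      exact ⟨γ, PSeq.ext (by rw [hx, PSeq.verts_of_deg_eq_zero hγ h0])⟩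
    · obtain ⟨b, r, hb⟩ : ∃ b r, m ++ [z] = b :: r := by
        rcases m with _ | ⟨d, m⟩
        · exact ⟨z, [], rfl⟩
        · exact ⟨d, m ++ [z], rfl⟩
      rw [hb] at he
      have hab : G.Adj a b := IsChain.rel_of_eq (l₁ := []) δ.isPSeq.isChain he
      obtain ⟨γ, l, r', h | h⟩ := hedge a b hab
      · exact ⟨γ, PSeq.edge_unique (l' := []) h he⟩
      · refine ⟨γ.rev, ?_⟩
        rw [hrev]
        exact PSeq.edge_unique (l := r'.reverse) (r := l.reverse) (l' := [])
          (by simp [PSeq.rev, h]) he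
  · exact ⟨Skeleton.pair (hjoin x y hne h), rfl, rfl⟩

namespace Marked

variable (m : Marked.{u, v} S) {γ₀ : PSeq S.graph} {l₁ l₂ : List m.forest.V} {a b : m.forest.V}

theorem adj_of_path (h : (m.path γ₀).verts = l₁ ++ a :: b :: l₂) : m.forest.graph.Adj a b :=
  IsChain.rel_of_eq (m.path γ₀).isPSeq.isChain h

/-- The forest obtained by subdividing an edge, with arbitrary weights. -/
def subdivideForest (F : WeightedForest.{v}) {a b : F.V} (hab : F.graph.Adj a b)
    (w : Option F.V → ℤ) : WeightedForest.{v} where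
  V := Option F.V
  finite := inferInstance
  graph := subdivide F.graph a b
  weight := w
  isAcyclic := isAcyclic_subdivide F.isAcyclic hab

/-- The map to the subdivided forest. -/
def subdivideσ {a b : m.forest.V} (hab : m.forest.graph.Adj a b) (x : VtxNe2 S.graph) :
    VtxNe2 (subdivide m.forest.graph a b) :=
  ⟨some (m.σ x).1, by rw [deg_subdivide_some hab]; exact (m.σ x).2⟩

/-- The edge {a, b} lies only on the paths of γ₀ and its reversal; every other path survives
unchanged. -/
theorem exists_subdivide_path (h : (m.path γ₀).verts = l₁ ++ a :: b :: l₂) (γ : PSeq S.graph) :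
    ∃ δ : PSeq (subdivide m.forest.graph a b),
      (δ.first = m.subdivideσ (m.adj_of_path h) γ.first ∧
        δ.last = m.subdivideσ (m.adj_of_path h) γ.last) ∧
      (γ = γ₀ → δ.verts = l₁.map some ++ some a :: none :: some b :: l₂.map some) ∧
      (γ ≠ γ₀ → γ ≠ γ₀.rev → δ.verts = (m.path γ).verts.map some) := by
  have hab := m.adj_of_path h
  let δ₀ : PSeq (subdivide m.forest.graph a b) :=
    ⟨l₁.map some ++ some a :: none :: some b :: l₂.map some, isPSeq_subdivide hab
      (h ▸ (m.path γ₀).isPSeq)⟩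
  have hf : δ₀.first = m.subdivideσ hab γ₀.first := by
    have := PSeq.first_eq_iff.1 (m.path_first γ₀)
    rw [h] at this
    rw [PSeq.first_eq_iff]
    simp only [δ₀, subdivideσ]
    rcases l₁ with _ | ⟨c, l⟩ <;> simpa using this
  have hl : δ₀.last = m.subdivideσ hab γ₀.last := by
    have := PSeq.last_eq_iff.1 (m.path_last γ₀)
    obtain ⟨q, z, hq⟩ : ∃ q z, b :: l₂ = q ++ [z] :=
      ⟨_, _, (List.dropLast_append_getLast (by simp : b :: l₂ ≠ [])).symm⟩
    rw [h, hq, ← List.cons_append, ← List.append_assoc, List.getLast?_concat,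
      Option.some_inj] at this
    rw [PSeq.last_eq_iff]
    simp only [δ₀, subdivideσ]
    rw [← this, show l₁.map some ++ some a :: none :: some b :: l₂.map some
      = l₁.map some ++ some a :: none :: (b :: l₂).map some by simp, hq]
    rw [List.map_append, List.map_singleton, ← List.cons_append, ← List.cons_append,
      ← List.append_assoc, List.getLast?_concat]
  by_cases h1 : γ = γ₀
  · subst h1
    exact ⟨δ₀, ⟨hf, hl⟩, fun _ => rfl, fun h => absurd rfl h⟩
  by_cases h2 : γ = γ₀.rev
  · subst h2
    refine ⟨δ₀.rev, ⟨?_, ?_⟩, fun h => absurd h h1, fun _ h => absurd rfl h⟩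
    · rw [PSeq.rev_first, PSeq.rev_first, hl]
    · rw [PSeq.rev_last, PSeq.rev_last, hf]
  · refine ⟨⟨(m.path γ).verts.map some, isPSeq_map_some_of_deg_eq (m.path γ).isPSeq
      (fun x _ => deg_subdivide_some hab x)
      (isChain_map_some_subdivide (m.path γ).isPSeq.isChain ?_)⟩, ⟨?_, ?_⟩, fun h => absurd h h1,
        fun _ _ => rfl⟩
    · intro m₁ x y m₂ e he
      rcases Sym2.eq_iff.1 he with ⟨rfl, rfl⟩ | ⟨rfl, rfl⟩
      · rcases m.eq_or_eq_rev_of_path_eq (PSeq.edge_unique e h) with h | h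
        · exact h1 h
        · exact h2 h
      · have := PSeq.edge_unique (γ' := (m.path γ₀).rev) (l' := l₂.reverse) (r' := l₁.reverse) e
          (by simp [PSeq.rev, h])
        rw [← path_rev] at this
        rcases m.eq_or_eq_rev_of_path_eq this with h | h
        · exact h2 h
        · exact h1 (by rw [h, PSeq.rev_rev])
    · have := PSeq.first_eq_iff.1 (m.path_first γ)
      simp [PSeq.first_eq_iff, subdivideσ, this]
    · have := PSeq.last_eq_iff.1 (m.path_last γ)
      simp [PSeq.last_eq_iff, subdivideσ, this]

theorem consecutive_cases {α : Type*} {l₁ l₂ l r : List α} {a b x y : α}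
    (h : l₁ ++ a :: b :: l₂ = l ++ x :: y :: r) :
    (a = x ∧ b = y) ∨ (∃ r', l₁ ++ [a] = l ++ x :: y :: r') ∨ ∃ l', b :: l₂ = l' ++ x :: y :: r := by
  induction l₁ generalizing l with
  | nil =>
    rcases l with _ | ⟨c, l⟩
    · simp at h
      exact Or.inl ⟨h.1, h.2.1⟩
    · simp at h
      exact Or.inr (Or.inr ⟨l, h.2⟩)
  | cons d l₁ ih =>
    rcases l with _ | ⟨c, l⟩
    · simp at h
      obtain ⟨rfl, h⟩ := h
      right; left
      rcases l₁ with _ | ⟨e, l₁⟩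
      · simp at h
        exact ⟨[], by simp [h.1]⟩
      · simp at h
        exact ⟨l₁ ++ [a], by simp [h.1]⟩
    · simp at h
      obtain ⟨rfl, h⟩ := h
      rcases ih h with h | ⟨r', h⟩ | h
      · exact Or.inl h
      · exact Or.inr (Or.inl ⟨r', by simp [h]⟩)
      · exact Or.inr (Or.inr h)

theorem isSkeletal_subdivideσ (h : (m.path γ₀).verts = l₁ ++ a :: b :: l₂) :
    IsSkeletal (m.subdivideσ (m.adj_of_path h)) := by
  choose f hf hf₀ hf₁ using m.exists_subdivide_path h
  have hab := m.adj_of_path h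
  have edge : ∀ (γ : PSeq S.graph) (l r) (x y), γ ≠ γ₀.rev →
      (m.path γ).verts = l ++ x :: y :: r → s(x, y) ≠ s(a, b) →
      ∃ l' r', (f γ).verts = l' ++ some x :: some y :: r' := by
    intro γ l r x y hγ e hne
    by_cases h1 : γ = γ₀
    · rw [hf₀ γ h1]
      subst h1
      rw [h] at e
      rcases consecutive_cases e with ⟨rfl, rfl⟩ | ⟨r', e⟩ | ⟨l', e⟩
      · exact absurd rfl hne
      · refine ⟨l.map some, r'.map some ++ none :: some b :: l₂.map some, ?_⟩
        have := congrArg (List.map some) e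
        simp only [List.map_append, List.map_cons, List.map_nil] at this
        rw [show l₁.map some ++ some a :: none :: some b :: l₂.map some =
          (l₁.map some ++ [some a]) ++ none :: some b :: l₂.map some by simp, this]
        simp
      · refine ⟨l₁.map some ++ some a :: none :: l'.map some, r.map some, ?_⟩
        have := congrArg (List.map some) e
        simp only [List.map_append, List.map_cons] at this
        rw [this]
        simp
    · rw [hf₁ γ h1 hγ, e]
      exact ⟨l.map some, r.map some, by simp⟩
  refine isSkeletal_of_cover (isAcyclic_subdivide m.forest.isAcyclic hab) _ f
    (fun γ => (hf γ).1) (fun γ => (hf γ).2) ?_ ?_ ?_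
  · have key : ∀ x, (x = a ∨ x = b) → ∃ γ l r, (f γ).verts = l ++ some x :: none :: r ∨
      (f γ).verts = l ++ none :: some x :: r := by
      rintro x (rfl | rfl)
      · exact ⟨γ₀, l₁.map some, some b :: l₂.map some, Or.inl (hf₀ _ rfl)⟩
      · exact ⟨γ₀, l₁.map some ++ [some a], l₂.map some, Or.inr (by rw [hf₀ _ rfl]; simp)⟩
    rintro (_ | x) (_ | y) hxy
    · exact hxy.elim
    · obtain ⟨γ, l, r, h⟩ := key y hxy
      exact ⟨γ, l, r, h.symm⟩
    · exact key x hxy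
    · obtain ⟨δ, l, r, hδ⟩ := exists_pSeq_of_adj m.forest.isAcyclic hxy.1
      obtain ⟨γ, rfl⟩ := m.path_surjective δ
      by_cases h2 : γ = γ₀.rev
      · obtain ⟨l', r', h'⟩ := edge γ₀ r.reverse l.reverse y x (Skeleton.rev_ne γ₀).symm (by
          rw [← PSeq.rev_rev γ₀, ← h2, path_rev, PSeq.rev_verts, hδ]
          simp) (by rw [Sym2.eq_swap]; exact hxy.2)
        exact ⟨γ₀, l', r', Or.inr h'⟩
      · obtain ⟨l', r', h'⟩ := edge γ l r x y h2 hδ hxy.2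
        exact ⟨γ, l', r', Or.inl h'⟩
  · rintro (_ | x) h0
    · rw [deg_subdivide_none hab.ne] at h0
      omega
    · rw [deg_subdivide_some hab] at h0
      obtain ⟨δ, hδ⟩ := exists_pSeq_of_mem m.forest.isAcyclic x
      obtain ⟨γ, rfl⟩ := m.path_surjective δ
      have hv := PSeq.verts_of_deg_eq_zero hδ h0
      refine ⟨γ, ?_⟩
      rw [hf₁ γ, hv]
      · simp
      · rintro rfl
        rw [h] at hv
        have := congrArg List.length hv
        simp at this
        omega
      · rintro rfl
        rw [path_rev, PSeq.rev_verts, h] at hv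
        have := congrArg List.length hv
        simp at this
        omega
  · intro x y hne he
    refine (m.adj_of_σ_eq hne (Subtype.ext ?_)).1
    exact Option.some_inj.1 (congrArg Subtype.val he)

/-- Subdivision of an edge of a forest with a skeletal map, with arbitrary weights. -/
def subdivide (h : (m.path γ₀).verts = l₁ ++ a :: b :: l₂) (w : Option m.forest.V → ℤ) :
    Marked.{u, v} S where
  forest := subdivideForest m.forest (m.adj_of_path h) w
  σ := m.subdivideσ (m.adj_of_path h)
  isSkeletal := m.isSkeletal_subdivideσ h

theorem subdivide_path_self (h : (m.path γ₀).verts = l₁ ++ a :: b :: l₂)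
    (w : Option m.forest.V → ℤ) : ((m.subdivide h w).path γ₀).verts =
      (l₁.map some ++ some a :: none :: some b :: l₂.map some : List (Option m.forest.V)) := by
  obtain ⟨δ, h1, h2, -⟩ := m.exists_subdivide_path h γ₀
  rw [← h2 rfl]
  exact congrArg PSeq.verts ((m.subdivide h w).path_eq (δ := δ) h1.1 h1.2)

theorem subdivide_path_of_ne (h : (m.path γ₀).verts = l₁ ++ a :: b :: l₂)
    (w : Option m.forest.V → ℤ) {γ : PSeq S.graph} (hγ : γ ≠ γ₀) (hγ' : γ ≠ γ₀.rev) :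
    ((m.subdivide h w).path γ).verts =
      ((m.path γ).verts.map some : List (Option m.forest.V)) := by
  obtain ⟨δ, h1, -, h2⟩ := m.exists_subdivide_path h γ
  rw [← h2 hγ hγ']
  exact congrArg PSeq.verts ((m.subdivide h w).path_eq (δ := δ) h1.1 h1.2)

end Marked

end Blowing

namespace Blowing

variable {S : Skeleton.{u}}

theorem PSeq.eq_nil_left {V : Type u} {G : SimpleGraph V} {γ : PSeq G} {l₁ l₂ : List V} {a b : V}
    (h : γ.verts = l₁ ++ a :: b :: l₂) (ha : deg G a ≠ 2) : l₁ = [] := by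
  rcases List.eq_nil_or_concat l₁ with rfl | ⟨l, c, rfl⟩
  · rfl
  · have p := γ.isPSeq
    rw [h, List.concat_eq_append, List.append_assoc, List.singleton_append] at p
    exact absurd (p.run.1 a (by simp)) ha

theorem PSeq.eq_nil_right {V : Type u} {G : SimpleGraph V} {γ : PSeq G} {l₁ l₂ : List V} {a b : V}
    (h : γ.verts = l₁ ++ a :: b :: l₂) (hb : deg G b ≠ 2) : l₂ = [] := by
  rcases l₂ with _ | ⟨c, l⟩
  · rfl
  · have p := γ.isPSeq
    rw [h] at p
    exact absurd (p.run.1 b (by simp)) hb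

namespace Marked

variable (m : Marked.{u, v} S) {γ₀ : PSeq S.graph} {l₁ l₂ t : List m.forest.V} {a b : m.forest.V}

/-! ### Addition of a leaf -/

theorem σ_first_eq (h : (m.path γ₀).verts = a :: t) : (m.σ γ₀.first).1 = a := by
  have := PSeq.first_eq_iff.1 (m.path_first γ₀)
  rw [h] at this
  simpa using this.symm

/-- If another vertex of S also lies over a, then a was isolated and now has degree 1. -/
theorem deg_addLeaf_σ (h : (m.path γ₀).verts = a :: t) {x : VtxNe2 S.graph} (hx : x ≠ γ₀.first) :
    deg (addLeaf m.forest.graph a) (some (m.σ x).1) ≠ 2 := by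
  by_cases he : (m.σ x).1 = a
  · have h0 := (m.adj_of_σ_eq hx (Subtype.ext (he.trans (m.σ_first_eq h).symm))).2
    rw [he] at h0 ⊢
    rw [deg_addLeaf_self, h0]
    omega
  · rw [deg_addLeaf_of_ne he]
    exact (m.σ x).2

open Classical in
/-- The map to the forest with an additional leaf. -/
noncomputable def addLeafσ (h : (m.path γ₀).verts = a :: t) (x : VtxNe2 S.graph) :
    VtxNe2 (addLeaf m.forest.graph a) :=
  -- Only the first vertex of γ₀ moves to the new leaf. If both ends of γ₀ were mapped to an
  -- isolated a, this separates them.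
  if hx : x = γ₀.first then ⟨none, by rw [deg_addLeaf_none]; omega⟩
  else ⟨some (m.σ x).1, m.deg_addLeaf_σ h hx⟩

theorem addLeafσ_first (h : (m.path γ₀).verts = a :: t) : (m.addLeafσ h γ₀.first).1 = none := by
  simp [addLeafσ]

theorem addLeafσ_of_ne (h : (m.path γ₀).verts = a :: t) {x : VtxNe2 S.graph}
    (hx : x ≠ γ₀.first) : (m.addLeafσ h x).1 = some (m.σ x).1 := by
  simp [addLeafσ, hx]

theorem notMem_path (h : (m.path γ₀).verts = a :: t) (ha : deg m.forest.graph a ≤ 1)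
    {γ : PSeq S.graph} (h1 : γ ≠ γ₀) (h2 : γ ≠ γ₀.rev) : a ∉ (m.path γ).verts := by
  intro hmem
  rcases PSeq.eq_or_eq_rev_of_mem (γ := m.path γ₀) (by rw [h]; simp) hmem (by omega) with e | e
  · rcases m.eq_or_eq_rev_of_path_eq e with e | e
    · exact h1 e
    · exact h2 e
  · rw [← path_rev] at e
    rcases m.eq_or_eq_rev_of_path_eq e with e | e
    · exact h2 e
    · exact h1 (by rw [e, PSeq.rev_rev])

theorem exists_addLeaf_path (h : (m.path γ₀).verts = a :: t) (ha : deg m.forest.graph a ≤ 1)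
    (γ : PSeq S.graph) : ∃ δ : PSeq (addLeaf m.forest.graph a),
      (δ.first = m.addLeafσ h γ.first ∧ δ.last = m.addLeafσ h γ.last) ∧
      (γ = γ₀ → δ.verts = none :: some a :: t.map some) ∧
      (γ ≠ γ₀ → γ ≠ γ₀.rev → δ.verts = (m.path γ).verts.map some) := by
  let δ₀ : PSeq (addLeaf m.forest.graph a) := ⟨none :: some a :: t.map some,
    isPSeq_addLeaf ha (h ▸ (m.path γ₀).isPSeq)⟩
  have hf : δ₀.first = m.addLeafσ h γ₀.first := by
    rw [PSeq.first_eq_iff, addLeafσ_first]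
    rfl
  have hl : δ₀.last = m.addLeafσ h γ₀.last := by
    have := PSeq.last_eq_iff.1 (m.path_last γ₀)
    rw [h] at this
    rw [PSeq.last_eq_iff, m.addLeafσ_of_ne h (Skeleton.first_ne_last γ₀).symm]
    change (none :: (a :: t).map some).getLast? = _
    rw [List.getLast?_cons, List.getLast?_map, this]
    rfl
  by_cases h1 : γ = γ₀
  · subst h1
    exact ⟨δ₀, ⟨hf, hl⟩, fun _ => rfl, fun h => absurd rfl h⟩
  by_cases h2 : γ = γ₀.rev
  · subst h2
    refine ⟨δ₀.rev, ⟨?_, ?_⟩, fun h => absurd h h1, fun _ h => absurd rfl h⟩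
    · rw [PSeq.rev_first, PSeq.rev_first, hl]
    · rw [PSeq.rev_last, PSeq.rev_last, hf]
  · have hna := m.notMem_path h ha h1 h2
    have hne : ∀ x : VtxNe2 S.graph, (m.σ x).1 ∈ (m.path γ).verts → x ≠ γ₀.first := by
      rintro x hx rfl
      rw [m.σ_first_eq h] at hx
      exact hna hx
    refine ⟨⟨(m.path γ).verts.map some, isPSeq_map_some_of_deg_eq (m.path γ).isPSeq
      (fun x hx => deg_addLeaf_of_ne ?_) ?_⟩, ⟨?_, ?_⟩, fun h => absurd h h1, fun _ _ => rfl⟩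
    · rintro rfl
      exact hna hx
    · rw [List.isChain_map]
      exact (m.path γ).isPSeq.isChain
    · have := PSeq.first_eq_iff.1 (m.path_first γ)
      rw [PSeq.first_eq_iff, m.addLeafσ_of_ne h (hne _ (List.mem_of_mem_head? this))]
      simp [this]
    · have := PSeq.last_eq_iff.1 (m.path_last γ)
      rw [PSeq.last_eq_iff, m.addLeafσ_of_ne h (hne _ (List.mem_of_getLast? this))]
      simp [this]

theorem isSkeletal_addLeafσ (h : (m.path γ₀).verts = a :: t) (ha : deg m.forest.graph a ≤ 1) :
    IsSkeletal (m.addLeafσ h) := by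
  choose f hf hf₀ hf₁ using m.exists_addLeaf_path h ha
  have edge : ∀ (γ : PSeq S.graph) (l r) (x y), γ ≠ γ₀.rev →
      (m.path γ).verts = l ++ x :: y :: r →
      ∃ l' r', (f γ).verts = l' ++ some x :: some y :: r' := by
    intro γ l r x y hγ e
    by_cases h1 : γ = γ₀
    · refine ⟨none :: l.map some, r.map some, ?_⟩
      rw [hf₀ γ h1]
      subst h1
      rw [h] at e
      simpa using congrArg (List.map some) e
    · rw [hf₁ γ h1 hγ, e]
      exact ⟨l.map some, r.map some, by simp⟩
  refine isSkeletal_of_cover (isAcyclic_addLeaf m.forest.isAcyclic) _ f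
    (fun γ => (hf γ).1) (fun γ => (hf γ).2) ?_ ?_ ?_
  · rintro (_ | x) (_ | y) hxy
    · exact hxy.elim
    · obtain rfl : y = a := hxy
      exact ⟨γ₀, [], t.map some, Or.inl (hf₀ _ rfl)⟩
    · obtain rfl : x = a := hxy
      exact ⟨γ₀, [], t.map some, Or.inr (hf₀ _ rfl)⟩
    · obtain ⟨δ, l, r, hδ⟩ := exists_pSeq_of_adj m.forest.isAcyclic hxy
      obtain ⟨γ, rfl⟩ := m.path_surjective δ
      by_cases h2 : γ = γ₀.rev
      · obtain ⟨l', r', h'⟩ := edge γ₀ r.reverse l.reverse y x (Skeleton.rev_ne γ₀).symm (by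
          rw [← PSeq.rev_rev γ₀, ← h2, path_rev, PSeq.rev_verts, hδ]
          simp)
        exact ⟨γ₀, l', r', Or.inr h'⟩
      · obtain ⟨l', r', h'⟩ := edge γ l r x y h2 hδ
        exact ⟨γ, l', r', Or.inl h'⟩
  · rintro (_ | x) h0
    · rw [deg_addLeaf_none] at h0
      omega
    · have hxa : x ≠ a := by
        rintro rfl
        rw [deg_addLeaf_self] at h0
        omega
      rw [deg_addLeaf_of_ne hxa] at h0
      obtain ⟨δ, hδ⟩ := exists_pSeq_of_mem m.forest.isAcyclic x
      obtain ⟨γ, rfl⟩ := m.path_surjective δ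
      have hv := PSeq.verts_of_deg_eq_zero hδ h0
      refine ⟨γ, ?_⟩
      rw [hf₁ γ, hv]
      · simp
      · rintro rfl
        rw [h] at hv
        simp at hv
        exact hxa hv.1.symm
      · rintro rfl
        rw [path_rev, PSeq.rev_verts, h] at hv
        have := congrArg List.reverse hv
        simp at this
        exact hxa this.1.symm
  · intro x y hne he
    by_cases hx : x = γ₀.first
    · subst hx
      have := congrArg Subtype.val he
      rw [addLeafσ_first, m.addLeafσ_of_ne h hne.symm] at this
      cases this
    by_cases hy : y = γ₀.first
    · subst hy
      have := congrArg Subtype.val he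
      rw [addLeafσ_first, m.addLeafσ_of_ne h hne] at this
      cases this
    · refine (m.adj_of_σ_eq hne (Subtype.ext ?_)).1
      have := congrArg Subtype.val he
      rw [m.addLeafσ_of_ne h hx, m.addLeafσ_of_ne h hy] at this
      exact Option.some_inj.1 this

/-- The forest obtained by adding a leaf, with arbitrary weights. -/
def addLeafForest (F : WeightedForest.{v}) (a : F.V) (w : Option F.V → ℤ) :
    WeightedForest.{v} where
  V := Option F.V
  finite := inferInstance
  graph := Blowing.addLeaf F.graph a
  weight := w
  isAcyclic := isAcyclic_addLeaf F.isAcyclic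

/-- Addition of a leaf to a forest with a skeletal map, with arbitrary weights. -/
noncomputable def addLeaf (h : (m.path γ₀).verts = a :: t) (ha : deg m.forest.graph a ≤ 1)
    (w : Option m.forest.V → ℤ) : Marked.{u, v} S where
  forest := addLeafForest m.forest a w
  σ := m.addLeafσ h
  isSkeletal := m.isSkeletal_addLeafσ h ha

theorem addLeaf_path_self (h : (m.path γ₀).verts = a :: t) (ha : deg m.forest.graph a ≤ 1)
    (w : Option m.forest.V → ℤ) : ((m.addLeaf h ha w).path γ₀).verts =
      (none :: some a :: t.map some : List (Option m.forest.V)) := by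
  obtain ⟨δ, h1, h2, -⟩ := m.exists_addLeaf_path h ha γ₀
  rw [← h2 rfl]
  exact congrArg PSeq.verts ((m.addLeaf h ha w).path_eq (δ := δ) h1.1 h1.2)

theorem addLeaf_path_of_ne (h : (m.path γ₀).verts = a :: t) (ha : deg m.forest.graph a ≤ 1)
    (w : Option m.forest.V → ℤ) {γ : PSeq S.graph} (hγ : γ ≠ γ₀) (hγ' : γ ≠ γ₀.rev) :
    ((m.addLeaf h ha w).path γ).verts =
      ((m.path γ).verts.map some : List (Option m.forest.V)) := by
  obtain ⟨δ, h1, -, h2⟩ := m.exists_addLeaf_path h ha γ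
  rw [← h2 hγ hγ']
  exact congrArg PSeq.verts ((m.addLeaf h ha w).path_eq (δ := δ) h1.1 h1.2)

/-! ### Weights of the blowings-up -/

section Weights

variable {V V' : Type*}

/-- The weights of the vertices of degree at most two in a list of vertices. -/
noncomputable def _root_.Blowing.listWeights (G : SimpleGraph V) (w : V → ℤ) (l : List V) :
    List ℤ :=
  (l.filter fun x => deg G x < 3).map w

theorem listWeights_append (G : SimpleGraph V) (w : V → ℤ) (l l' : List V) :
    listWeights G w (l ++ l') = listWeights G w l ++ listWeights G w l' := by
  simp [listWeights]

theorem listWeights_nil (G : SimpleGraph V) (w : V → ℤ) : listWeights G w [] = [] := rfl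

theorem listWeights_cons (G : SimpleGraph V) (w : V → ℤ) (x : V) (l : List V) :
    listWeights G w (x :: l) = (if deg G x < 3 then [w x] else []) ++ listWeights G w l := by
  by_cases h : deg G x < 3 <;> simp [listWeights, h]

theorem listWeights_map {G : SimpleGraph V} {G' : SimpleGraph V'} {w : V → ℤ} {w' : V' → ℤ}
    (g : V → V') {l : List V} (hd : ∀ x ∈ l, deg G' (g x) = deg G x)
    (hw : ∀ x ∈ l, deg G x < 3 → w' (g x) = w x) :
    listWeights G' w' (l.map g) = listWeights G w l := by
  induction l with
  | nil => rfl
  | cons x l ih =>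
    rw [List.map_cons, listWeights_cons, listWeights_cons, hd x (by simp),
      ih (fun y hy => hd y (by simp [hy])) (fun y hy => hw y (by simp [hy]))]
    split_ifs with h
    · rw [hw x (by simp) h]
    · rfl

open Classical in
/-- The weights of the blowing-up at an edge. -/
noncomputable def edgeWeight (w : V → ℤ) (a b : V) : Option V → ℤ
  | some x => if x = a ∨ x = b then w x - 1 else w x
  | none => -1

open Classical in
/-- The weights of the blowing-up at a vertex. -/
noncomputable def leafWeight (w : V → ℤ) (a : V) : Option V → ℤ
  | some x => if x = a then w x - 1 else w x
  | none => -1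

theorem edgeWeight_some {w : V → ℤ} {a b x : V} (h1 : x ≠ a) (h2 : x ≠ b) :
    edgeWeight w a b (some x) = w x :=
  if_neg (by simp [h1, h2])

theorem edgeWeight_left {w : V → ℤ} {a b : V} : edgeWeight w a b (some a) = w a - 1 :=
  if_pos (by simp)

theorem edgeWeight_right {w : V → ℤ} {a b : V} : edgeWeight w a b (some b) = w b - 1 :=
  if_pos (by simp)

theorem leafWeight_some {w : V → ℤ} {a x : V} (h : x ≠ a) : leafWeight w a (some x) = w x :=
  if_neg h

theorem leafWeight_self {w : V → ℤ} {a : V} : leafWeight w a (some a) = w a - 1 := if_pos rfl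

end Weights

theorem seqWeights_eq (γ : PSeq S.graph) :
    m.seqWeights γ = listWeights m.forest.graph m.forest.weight (m.path γ).verts := rfl

theorem subdivide_seqWeights (h : (m.path γ₀).verts = l₁ ++ a :: b :: l₂)
    (w : Option m.forest.V → ℤ) {γ : PSeq S.graph} {l : List (Option m.forest.V)}
    (hl : ((m.subdivide h w).path γ).verts = l) :
    (m.subdivide h w).seqWeights γ = listWeights (Blowing.subdivide m.forest.graph a b) w l := by
  subst hl; rfl

theorem addLeaf_seqWeights (h : (m.path γ₀).verts = a :: t) (ha : deg m.forest.graph a ≤ 1)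
    (w : Option m.forest.V → ℤ) {γ : PSeq S.graph} {l : List (Option m.forest.V)}
    (hl : ((m.addLeaf h ha w).path γ).verts = l) :
    (m.addLeaf h ha w).seqWeights γ = listWeights (Blowing.addLeaf m.forest.graph a) w l := by
  subst hl; rfl

/-- Blowing-up at an edge of a forest with a skeletal map. -/
noncomputable def blowUpEdge (h : (m.path γ₀).verts = l₁ ++ a :: b :: l₂) : Marked.{u, v} S :=
  m.subdivide h (edgeWeight m.forest.weight a b)

/-- Blowing-up at an end of a forest with a skeletal map. -/
noncomputable def blowUpVertex (h : (m.path γ₀).verts = a :: t)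
    (ha : deg m.forest.graph a ≤ 1) : Marked.{u, v} S :=
  m.addLeaf h ha (leafWeight m.forest.weight a)

theorem notMem_of_path (h : (m.path γ₀).verts = l₁ ++ a :: b :: l₂) :
    (a ∉ l₁ ∧ a ∉ l₂) ∧ (b ∉ l₁ ∧ b ∉ l₂) := by
  have := (m.path γ₀).isPSeq.nodup
  rw [h] at this
  simp only [List.nodup_append, List.nodup_cons, List.mem_cons, not_or] at this
  obtain ⟨-, ⟨⟨-, h1⟩, h2, -⟩, h3⟩ := this
  exact ⟨⟨fun h => h3 a h a (by simp) rfl, h1⟩, fun h => h3 b h b (by simp) rfl, h2⟩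

/-- The new weights are left arbitrary at a, b and `none`, because the formula serves both for
blowing up and for inserting a vertex of prescribed weight. -/
theorem subdivide_seqWeights_self (h : (m.path γ₀).verts = l₁ ++ a :: b :: l₂)
    (w : Option m.forest.V → ℤ)
    (hw : ∀ x, deg m.forest.graph x < 3 → x ≠ a → x ≠ b → w (some x) = m.forest.weight x) :
    (m.subdivide h w).seqWeights γ₀ = listWeights m.forest.graph m.forest.weight l₁ ++
      ((if deg m.forest.graph a < 3 then [w (some a)] else []) ++ [w none] ++
      (if deg m.forest.graph b < 3 then [w (some b)] else [])) ++
      listWeights m.forest.graph m.forest.weight l₂ := by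
  obtain ⟨⟨h1, h2⟩, h3, h4⟩ := m.notMem_of_path h
  rw [m.subdivide_seqWeights h _ (m.subdivide_path_self h _)]
  have hab := m.adj_of_path h
  have key : ∀ l : List m.forest.V, a ∉ l → b ∉ l →
      listWeights (Blowing.subdivide m.forest.graph a b) w (l.map some) =
      listWeights m.forest.graph m.forest.weight l := by
    intro l ha hb
    refine listWeights_map some (fun x _ => deg_subdivide_some hab x) ?_
    intro x hx hd
    exact hw x hd (fun e => ha (e ▸ hx)) (fun e => hb (e ▸ hx))
  rw [listWeights_append, listWeights_cons, listWeights_cons, listWeights_cons, key l₁ h1 h3,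
    key l₂ h2 h4, deg_subdivide_some hab, deg_subdivide_none hab.ne, deg_subdivide_some hab,
    if_pos (show 2 < 3 by omega)]
  simp

theorem subdivide_seqWeights_of_ne (h : (m.path γ₀).verts = l₁ ++ a :: b :: l₂)
    (w : Option m.forest.V → ℤ)
    (hw : ∀ x, deg m.forest.graph x < 3 → x ≠ a → x ≠ b → w (some x) = m.forest.weight x)
    {γ : PSeq S.graph} (hγ : γ ≠ γ₀) (hγ' : γ ≠ γ₀.rev) :
    (m.subdivide h w).seqWeights γ = m.seqWeights γ := by
  rw [m.subdivide_seqWeights h _ (m.subdivide_path_of_ne h _ hγ hγ'), seqWeights_eq]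
  refine listWeights_map some (fun x _ => deg_subdivide_some (m.adj_of_path h) x) ?_
  intro x hx hd
  have hm : x ∉ (m.path γ₀).verts := by
    intro hx'
    rcases PSeq.eq_or_eq_rev_of_mem hx' hx (by omega) with e | e
    · rcases m.eq_or_eq_rev_of_path_eq e with e | e
      · exact hγ e
      · exact hγ' e
    · rw [← path_rev] at e
      rcases m.eq_or_eq_rev_of_path_eq e with e | e
      · exact hγ' e
      · exact hγ (by rw [e, PSeq.rev_rev])
  rw [h] at hm
  exact hw x hd (by rintro rfl; simp at hm) (by rintro rfl; simp at hm)

theorem blowUpEdge_seqWeights_self (h : (m.path γ₀).verts = l₁ ++ a :: b :: l₂) :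
    (m.blowUpEdge h).seqWeights γ₀ = listWeights m.forest.graph m.forest.weight l₁ ++
      ((if deg m.forest.graph a < 3 then [m.forest.weight a - 1] else []) ++ [-1] ++
      (if deg m.forest.graph b < 3 then [m.forest.weight b - 1] else [])) ++
      listWeights m.forest.graph m.forest.weight l₂ := by
  have := m.subdivide_seqWeights_self h (edgeWeight m.forest.weight a b)
    fun x _ => edgeWeight_some
  rwa [edgeWeight_left, edgeWeight_right] at this

theorem blowUpEdge_seqWeights_of_ne (h : (m.path γ₀).verts = l₁ ++ a :: b :: l₂)
    {γ : PSeq S.graph} (hγ : γ ≠ γ₀) (hγ' : γ ≠ γ₀.rev) :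
    (m.blowUpEdge h).seqWeights γ = m.seqWeights γ :=
  m.subdivide_seqWeights_of_ne h _ (fun _ _ => edgeWeight_some) hγ hγ'

theorem σ_eq_iff {x y : VtxNe2 S.graph} (hx : 2 < deg S.graph x.1) : m.σ x = m.σ y ↔ x = y := by
  refine ⟨fun h => ?_, fun h => by rw [h]⟩
  by_contra hne
  have := m.deg_eq_one_of_σ_eq hne h
  omega

/-- A branch vertex on a path is one of its ends. Thus a, which has a successor, is a branch vertex
only if it is the first vertex. -/
theorem σ_eq_left_iff (h : (m.path γ₀).verts = l₁ ++ a :: b :: l₂) (x : VtxGt2 S.graph) :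
    (m.σ x.toNe2).1 = a ↔ 2 < deg m.forest.graph a ∧ γ₀.first = x.toNe2 := by
  have hf := PSeq.first_eq_iff.1 (m.path_first γ₀)
  have hx := m.two_lt_deg_iff (x := x.toNe2) |>.2 x.2
  rw [h] at hf
  constructor
  · rintro rfl
    obtain rfl := PSeq.eq_nil_left h (by omega)
    rw [List.nil_append, List.head?_cons, Option.some_inj] at hf
    exact ⟨hx, ((m.σ_eq_iff x.2).1 (Subtype.ext hf)).symm⟩
  · rintro ⟨ha, hfx⟩
    obtain rfl := PSeq.eq_nil_left h (by omega)
    rw [List.nil_append, List.head?_cons, Option.some_inj] at hf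
    rw [← hfx, hf]

theorem σ_eq_right_iff (h : (m.path γ₀).verts = l₁ ++ a :: b :: l₂) (x : VtxGt2 S.graph) :
    (m.σ x.toNe2).1 = b ↔ 2 < deg m.forest.graph b ∧ γ₀.last = x.toNe2 := by
  have := m.σ_eq_left_iff (γ₀ := γ₀.rev) (l₁ := l₂.reverse) (l₂ := l₁.reverse) (a := b) (b := a)
    (by rw [path_rev, PSeq.rev_verts, h]; simp) x
  rwa [PSeq.rev_first] at this

/-- Blowing-up at an edge of the path `γ₀` is a framed blowing-up along `γ₀`. -/
theorem blowUpEdge_move (h : (m.path γ₀).verts = l₁ ++ a :: b :: l₂) :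
    ∃ c d, FramedBlowUp (m.seqWeights γ₀) ((m.blowUpEdge h).seqWeights γ₀) c d ∧
      (c = if 2 < deg m.forest.graph a then 1 else 0) ∧
      (d = if 2 < deg m.forest.graph b then 1 else 0) ∧
      (m.blowUpEdge h).vertexWeights = m.vertexWeights - endShift γ₀ c d := by
  refine ⟨_, _, ?_, rfl, rfl, ?_⟩
  · rw [blowUpEdge_seqWeights_self, seqWeights_eq, h, listWeights_append, listWeights_cons,
      listWeights_cons]
    -- Whether a and b are branch vertices selects the kind of framed blowing-up: both, `empty`;
    -- only a, `left`; only b, `right`; neither, `middle`.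
    by_cases ha : 2 < deg m.forest.graph a <;> by_cases hb : 2 < deg m.forest.graph b
    · obtain rfl := PSeq.eq_nil_left h (by omega)
      obtain rfl := PSeq.eq_nil_right h (by omega)
      have ha' := show ¬ deg m.forest.graph a < 3 by omega
      have hb' := show ¬ deg m.forest.graph b < 3 by omega
      simp only [ha, hb, ha', hb', if_true, if_false, listWeights_nil]
      exact .empty
    · obtain rfl := PSeq.eq_nil_left h (by omega)
      have ha' := show ¬ deg m.forest.graph a < 3 by omega
      have hb' := show deg m.forest.graph b < 3 by omega
      simp only [ha, hb, ha', hb', if_true, if_false, listWeights_nil]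
      exact .left _ _
    · obtain rfl := PSeq.eq_nil_right h (by omega)
      have ha' := show deg m.forest.graph a < 3 by omega
      have hb' := show ¬ deg m.forest.graph b < 3 by omega
      simp only [ha, hb, ha', hb', if_true, if_false, listWeights_nil]
      simpa using FramedBlowUp.right (listWeights m.forest.graph m.forest.weight l₁)
        (m.forest.weight a)
    · have ha' := show deg m.forest.graph a < 3 by omega
      have hb' := show deg m.forest.graph b < 3 by omega
      simp only [ha, hb, ha', hb', if_true, if_false]
      simpa using FramedBlowUp.middle (listWeights m.forest.graph m.forest.weight l₁)
        (m.forest.weight a) (m.forest.weight b) (listWeights m.forest.graph m.forest.weight l₂)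
  · classical
    funext x
    have hab := (m.adj_of_path h).ne
    have e : (m.blowUpEdge h).vertexWeights x =
      edgeWeight m.forest.weight a b (some (m.σ x.toNe2).1) := rfl
    rw [e, Pi.sub_apply, endShift, vertexWeights]
    by_cases h1 : (m.σ x.toNe2).1 = a
    · have h2 : (m.σ x.toNe2).1 ≠ b := fun h => hab (h1.symm.trans h)
      have i1 := (m.σ_eq_left_iff h x).1 h1
      have i2 := mt (m.σ_eq_right_iff h x).2 h2
      rw [h1, edgeWeight_left, if_pos i1.1, if_pos i1.2]
      by_cases hb : 2 < deg m.forest.graph b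
      · rw [if_neg (fun h => i2 ⟨hb, h⟩), add_zero]
      · simp [hb]
    · have i1 := mt (m.σ_eq_left_iff h x).2 h1
      have z1 : (if γ₀.first = x.toNe2 then (if 2 < deg m.forest.graph a then (1 : ℤ) else 0)
          else 0) = 0 := by
        split_ifs with c1 c2
        · exact absurd ⟨c2, c1⟩ i1
        · rfl
        · rfl
      rw [z1, zero_add]
      by_cases h2 : (m.σ x.toNe2).1 = b
      · have i2 := (m.σ_eq_right_iff h x).1 h2
        rw [h2, edgeWeight_right, if_pos i2.1, if_pos i2.2]
      · have i2 := mt (m.σ_eq_right_iff h x).2 h2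
        rw [edgeWeight_some h1 h2]
        split_ifs with c1 c2
        · exact absurd ⟨c2, c1⟩ i2
        · simp
        · simp

theorem listWeights_addLeaf (F : WeightedForest.{v}) {a : F.V} {l : List F.V} (hl : a ∉ l) :
    listWeights (Blowing.addLeaf F.graph a) (leafWeight F.weight a) (l.map some) =
      listWeights F.graph F.weight l := by
  refine listWeights_map some (fun x hx => deg_addLeaf_of_ne ?_) fun x hx _ => leafWeight_some ?_
  · rintro rfl
    exact hl hx
  · rintro rfl
    exact hl hx

/-- Blowing-up at the first vertex of the path `γ₀` is a framed blowing-up along `γ₀`. -/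
theorem blowUpVertex_move (h : (m.path γ₀).verts = a :: t) (ha : deg m.forest.graph a ≤ 1) :
    (∃ x l, m.seqWeights γ₀ = x :: l ∧
      (m.blowUpVertex h ha).seqWeights γ₀ = -1 :: (x - 1) :: l) ∧
      (∀ γ, γ ≠ γ₀ → γ ≠ γ₀.rev → (m.blowUpVertex h ha).seqWeights γ = m.seqWeights γ) ∧
      (m.blowUpVertex h ha).vertexWeights = m.vertexWeights - endShift γ₀ 1 0 := by
  refine ⟨⟨m.forest.weight a, listWeights m.forest.graph m.forest.weight t, ?_, ?_⟩, ?_, ?_⟩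
  · rw [seqWeights_eq, h, listWeights_cons, if_pos (by omega)]
    rfl
  · have hat : a ∉ t := by
      have := (m.path γ₀).isPSeq.nodup
      rw [h] at this
      exact (List.nodup_cons.1 this).1
    have d1 : deg (Blowing.addLeaf m.forest.graph a) none < 3 := by
      rw [deg_addLeaf_none]
      omega
    have d2 : deg (Blowing.addLeaf m.forest.graph a) (some a) < 3 := by
      rw [deg_addLeaf_self]
      omega
    refine (m.addLeaf_seqWeights h ha _ (m.addLeaf_path_self h ha _)).trans ?_
    rw [listWeights_cons, listWeights_cons, listWeights_addLeaf _ hat, if_pos d1, if_pos d2,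
      leafWeight_self]
    rfl
  · intro γ h1 h2
    refine (m.addLeaf_seqWeights h ha _ (m.addLeaf_path_of_ne h ha _ h1 h2)).trans ?_
    exact listWeights_addLeaf _ (m.notMem_path h ha h1 h2)
  · funext x
    have hd := (m.two_lt_deg_iff (x := x.toNe2)).2 x.2
    have hne : x.toNe2 ≠ γ₀.first := by
      intro e
      rw [e, m.σ_first_eq h] at hd
      omega
    have e : (m.blowUpVertex h ha).vertexWeights x =
        leafWeight m.forest.weight a (m.addLeafσ h x.toNe2).1 := rfl
    rw [e, m.addLeafσ_of_ne h hne, Pi.sub_apply, endShift, if_neg hne.symm,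
      leafWeight_some (by rintro e; rw [e] at hd; omega)]
    simp [vertexWeights]

end Marked

end Blowing

/-! ### Blowings-down of forests correspond to moves of weights -/

namespace Blowing

variable {S : Skeleton.{u}}

namespace Marked

variable (m : Marked.{u, v} S) {γ₀ : PSeq S.graph} {l₁ l₂ t : List m.forest.V} {a b : m.forest.V}

/-- Blowings-down of forests with a skeletal map. -/
def IsBlowDown (m m' : Marked.{u, v} S) : Prop :=
  ∃ π, m.forest.IsStrictBlowDownMap m'.forest π ∧ π ∘ m.σ = m'.σ

/-- Framed blowing-up of the weights along `γ`. -/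
def IsMoveAt (γ : PSeq S.graph) (c d : ℤ) (m m' : Marked.{u, v} S) : Prop :=
  (∀ δ, δ ≠ γ → δ ≠ γ.rev → m'.seqWeights δ = m.seqWeights δ) ∧
    m'.vertexWeights = m.vertexWeights - endShift γ c d

/-- The two descriptions of the blowing-up at an edge agree. -/
noncomputable def blowUpEdgeIso (h : (m.path γ₀).verts = l₁ ++ a :: b :: l₂) :
    (m.forest.toWeightedGraph.blowUpEdge a b).Iso (m.blowUpEdge h).forest.toWeightedGraph where
  toIso := ⟨Equiv.refl (Option m.forest.V), by rintro (_ | x) (_ | y) <;> exact Iff.rfl⟩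
  weight_eq := by rintro (_ | x) <;> rfl

/-- The two descriptions of the blowing-up at a vertex agree. -/
noncomputable def blowUpVertexIso (h : (m.path γ₀).verts = a :: t)
    (ha : deg m.forest.graph a ≤ 1) :
    (m.forest.toWeightedGraph.blowUpVertex a).Iso
      (m.blowUpVertex h ha).forest.toWeightedGraph where
  toIso := ⟨Equiv.refl (Option m.forest.V), by rintro (_ | x) (_ | y) <;> exact Iff.rfl⟩
  weight_eq := by rintro (_ | x) <;> rfl

/-- The inverse of an isomorphism of weighted graphs. -/
def _root_.Blowing.WeightedGraph.Iso.symm {G H : WeightedGraph.{v}} (f : G.Iso H) : H.Iso G where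
  toIso := f.toIso.symm
  weight_eq x := by
    rw [← f.weight_eq]
    exact congrArg _ (f.toIso.apply_symm_apply x)

/-- The composition of isomorphisms of weighted graphs. -/
def _root_.Blowing.WeightedGraph.Iso.trans {G H K : WeightedGraph.{v}} (f : G.Iso H)
    (g : H.Iso K) : G.Iso K where
  toIso := f.toIso.trans g.toIso
  weight_eq x := (g.weight_eq _).trans (f.weight_eq x)

theorem blowUpEdge_isBlowDown (h : (m.path γ₀).verts = l₁ ++ a :: b :: l₂) :
    (m.blowUpEdge h).IsBlowDown m := by
  have hab := m.adj_of_path h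
  have key : ∀ x : VtxNe2 (Blowing.subdivide m.forest.graph a b),
      ∃ y : VtxNe2 m.forest.graph, x.1 = some y.1 := by
    rintro ⟨_ | x, hx⟩
    · exact absurd (deg_subdivide_none hab.ne) hx
    · exact ⟨⟨x, by rwa [deg_subdivide_some hab] at hx⟩, rfl⟩
  choose π hπ using key
  refine ⟨π, Or.inr ⟨a, b, hab, (m.blowUpEdgeIso h).symm, hπ⟩, ?_⟩
  funext x
  exact Subtype.ext (Option.some_inj.1 (hπ ((m.blowUpEdge h).σ x)).symm)

theorem blowUpVertex_isBlowDown (h : (m.path γ₀).verts = a :: t)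
    (ha : deg m.forest.graph a ≤ 1) : (m.blowUpVertex h ha).IsBlowDown m := by
  have key : ∀ x : VtxNe2 (Blowing.addLeaf m.forest.graph a),
      ∃ y : VtxNe2 m.forest.graph, (x.1 = none → y.1 = a) ∧ ∀ z, x.1 = some z → y.1 = z := by
    rintro ⟨_ | x, hx⟩
    · exact ⟨⟨a, by omega⟩, fun _ => rfl, nofun⟩
    · refine ⟨⟨x, ?_⟩, nofun, fun z h => Option.some_inj.1 h⟩
      by_cases hxa : x = a
      · rw [hxa]
        omega
      · rwa [deg_addLeaf_of_ne hxa] at hx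
  choose π hπ using key
  refine ⟨π, Or.inl ⟨a, ha, (m.blowUpVertexIso h ha).symm, hπ⟩, ?_⟩
  funext x
  apply Subtype.ext
  by_cases hx : x = γ₀.first
  · subst hx
    rw [m.σ_first_eq h]
    exact (hπ _).1 (m.addLeafσ_first h)
  · exact (hπ _).2 _ (m.addLeafσ_of_ne h hx)

/-- Some path covers x, and by surjectivity it comes from S; a vertex of degree ≠ 2 can only be an
end of it. -/
theorem exists_path_first (m : Marked.{u, v} S) {x : m.forest.V} (hx : deg m.forest.graph x ≠ 2) :
    ∃ s, (m.σ s).1 = x := by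
  obtain ⟨δ, hδ⟩ := exists_pSeq_of_mem m.forest.isAcyclic x
  obtain ⟨γ, rfl⟩ := m.path_surjective δ
  have p := (m.path γ).isPSeq
  have hf := PSeq.first_eq_iff.1 (m.path_first γ)
  have hl := PSeq.last_eq_iff.1 (m.path_last γ)
  rcases p.eq_singleton_or with ⟨y, h, h0⟩ | ⟨a, t, z, h⟩
  · rw [h] at hf hδ
    simp at hf hδ
    exact ⟨_, by rw [← hf, hδ]⟩
  · rw [h] at hf hl hδ p
    obtain ⟨-, -, -, -, h2⟩ := isPSeq_cons_append_iff.1 p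
    simp at hf hl hδ
    rcases hδ with rfl | hδ | rfl
    · exact ⟨_, hf.symm⟩
    · exact absurd (h2 _ hδ) hx
    · rw [List.getLast?_cons, List.getLast?_append] at hl
      simp at hl
      exact ⟨_, hl.symm⟩

theorem exists_first_eq (s : VtxNe2 S.graph) : ∃ γ : PSeq S.graph, γ.first = s := by
  obtain ⟨y, hy⟩ := (Set.ncard_pos (Set.toFinite (S.graph.neighborSet s.1))).1
    (Nat.pos_of_ne_zero (S.deg_ne s.1).1)
  exact ⟨Skeleton.pair hy, rfl⟩

/-- Up to isomorphism, a blowing-down is the inverse of one of the two kinds of blowing-up. -/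
theorem IsBlowDown.exists_isIsomorphic {m m' : Marked.{u, v} S} (h : m.IsBlowDown m') :
    (∃ (γ₀ : PSeq S.graph) (l₁ l₂ : List m'.forest.V) (a b : m'.forest.V)
      (h : (m'.path γ₀).verts = l₁ ++ a :: b :: l₂), m.IsIsomorphic (m'.blowUpEdge h)) ∨
    ∃ (γ₀ : PSeq S.graph) (t : List m'.forest.V) (a : m'.forest.V)
      (h : (m'.path γ₀).verts = a :: t) (ha : deg m'.forest.graph a ≤ 1),
      m.IsIsomorphic (m'.blowUpVertex h ha) := by
  obtain ⟨π, ⟨v, hv, φ, hφ⟩ | ⟨v₁, v₂, hadj, φ, hφ⟩, hπ⟩ := h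
  · right
    have hd : deg m.forest.graph (φ.toIso.symm none) = 1 := by
      refine (deg_iso φ.toIso.symm none).trans ?_
      have e : (m'.forest.toWeightedGraph.blowUpVertex v).graph =
          Blowing.addLeaf m'.forest.graph v := by
        ext (_ | x) (_ | y) <;> exact Iff.rfl
      rw [e]
      exact deg_addLeaf_none (G := m'.forest.graph) (a := v)
    -- The created vertex is a leaf, hence the image of some s₀ in S. An edge of S starting at s₀
    -- gives the γ₀ along which to blow up.
    obtain ⟨s₀, hs₀⟩ := m.exists_path_first (x := φ.toIso.symm none) (by omega)
    have e0 : φ.toIso (m.σ s₀).1 = none := by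
      rw [hs₀]
      exact φ.toIso.apply_symm_apply none
    have e1 : (m'.σ s₀).1 = v := by
      rw [← hπ]
      exact (hφ _).1 e0
    obtain ⟨γ₀, rfl⟩ := exists_first_eq s₀
    have hf := PSeq.first_eq_iff.1 (m'.path_first γ₀)
    rw [e1] at hf
    obtain ⟨t, ht⟩ := List.head?_eq_some_iff.1 hf
    refine ⟨γ₀, t, v, ht, hv, φ.trans (m'.blowUpVertexIso ht hv), fun s => ?_⟩
    change φ.toIso (m.σ s).1 = _
    by_cases hs : s = γ₀.first
    · subst hs
      exact e0.trans (m'.addLeafσ_first ht).symm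
    · refine Eq.trans ?_ (m'.addLeafσ_of_ne ht hs).symm
      rcases hy : φ.toIso (m.σ s).1 with _ | y
      -- Two vertices of S over the created vertex would make its degree 0, whereas it is 1.
      · exfalso
        have := (m.adj_of_σ_eq hs (Subtype.ext (φ.toIso.injective (hy.trans e0.symm)))).2
        have h2 : (m.σ s).1 = φ.toIso.symm none := by
          rw [← hs₀]
          exact φ.toIso.injective (hy.trans e0.symm)
        rw [h2] at this
        omega
      · rw [← (hφ _).2 y hy, ← hπ]
        rfl
  · left
    obtain ⟨δ, l₁, l₂, h⟩ := exists_pSeq_of_adj m'.forest.isAcyclic hadj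
    obtain ⟨γ₀, rfl⟩ := m'.path_surjective δ
    refine ⟨γ₀, l₁, l₂, v₁, v₂, h, φ.trans (m'.blowUpEdgeIso h), fun s => ?_⟩
    change φ.toIso (m.σ s).1 = _
    exact (hφ _).trans (congrArg (fun f => (some (f s).1 : Option m'.forest.V)) hπ)

theorem IsBlowDown.exists_isMoveAt {m m' : Marked.{u, v} S} (h : m.IsBlowDown m') :
    ∃ γ c d, FramedBlowUp (m'.seqWeights γ) (m.seqWeights γ) c d ∧ IsMoveAt γ c d m' m := by
  rcases h.exists_isIsomorphic with ⟨γ, l₁, l₂, a, b, h, hi⟩ | ⟨γ, t, a, h, ha, hi⟩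
  · obtain ⟨c, d, h1, -, -, h2⟩ := m'.blowUpEdge_move h
    rw [hi.seqWeights_eq] at h1
    rw [hi.vertexWeights_eq] at h2
    refine ⟨γ, c, d, h1, fun δ h3 h4 => ?_, h2⟩
    rw [← hi.seqWeights_eq, m'.blowUpEdge_seqWeights_of_ne h h3 h4]
  · obtain ⟨⟨x, l, h1, h2⟩, h3, h4⟩ := m'.blowUpVertex_move h ha
    rw [hi.seqWeights_eq] at h2 h3
    rw [hi.vertexWeights_eq] at h4
    refine ⟨γ, 1, 0, ?_, h3, h4⟩
    rw [h1, h2]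
    exact .left _ _

theorem IsMoveAt.rev {m m' : Marked.{u, v} S} {γ : PSeq S.graph} {c d : ℤ}
    (h : IsMoveAt γ.rev c d m m') : IsMoveAt γ d c m m' := by
  refine ⟨fun δ h1 h2 => h.1 δ h2 (by rwa [PSeq.rev_rev]), ?_⟩
  rw [h.2, endShift_rev]

/-- If the path starts at a vertex of degree at most 1, then x is its weight and one blows up that
vertex. If it starts at a branch vertex, x is the weight of the second vertex and one blows up the
first edge. -/
theorem exists_blowUp_left (m : Marked.{u, v} S) {γ : PSeq S.graph} {x : ℤ} {l : List ℤ}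
    (h : m.seqWeights γ = x :: l) : ∃ m' : Marked.{u, v} S, m'.IsBlowDown m ∧
      m'.seqWeights γ = -1 :: (x - 1) :: l ∧ IsMoveAt γ 1 0 m m' := by
  obtain ⟨a, t, ht⟩ := List.exists_cons_of_ne_nil (m.path γ).isPSeq.ne_nil
  have hσ := m.σ_first_eq ht
  have ha2 : deg m.forest.graph a ≠ 2 := by
    rw [← hσ]
    exact (m.σ _).2
  by_cases ha : deg m.forest.graph a ≤ 1
  · obtain ⟨⟨x', l', h1, h2⟩, h3⟩ := m.blowUpVertex_move ht ha
    rw [h] at h1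
    cases h1
    exact ⟨_, m.blowUpVertex_isBlowDown ht ha, h2, h3⟩
  · rw [seqWeights_eq, ht] at h
    have ha' : ¬ deg m.forest.graph a < 3 := by omega
    have ha'' : 2 < deg m.forest.graph a := by omega
    rcases t with _ | ⟨b, t⟩
    · simp [listWeights_cons, ha', listWeights_nil] at h
    have hb : ¬ 2 < deg m.forest.graph b := by
      intro hb
      obtain rfl := PSeq.eq_nil_right (l₁ := []) ht (by omega)
      simp [listWeights_cons, ha', listWeights_nil, show ¬ deg m.forest.graph b < 3 by omega] at h
    have hb' : deg m.forest.graph b < 3 := by omega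
    simp only [listWeights_cons, ha', hb', if_true, if_false, List.nil_append,
      List.singleton_append, List.cons.injEq] at h
    obtain ⟨c, d, h1, rfl, rfl, h2⟩ := m.blowUpEdge_move (l₁ := []) ht
    rw [if_pos ha'', if_neg hb] at h2
    refine ⟨_, m.blowUpEdge_isBlowDown (l₁ := []) ht, ?_,
      fun δ => m.blowUpEdge_seqWeights_of_ne (l₁ := []) ht, h2⟩
    rw [blowUpEdge_seqWeights_self]
    simp [ha', hb', h, listWeights_nil]

/-- Every formal blowing-up of a sequence is realized geometrically. The empty sequence belongs to a
single edge between branch vertices, the right end reduces to the left one by reversal, and a middle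
position is an edge between two vertices of degree at most 2. -/
theorem exists_blowUp (m : Marked.{u, v} S) {γ : PSeq S.graph} {Y : List ℤ} {c d : ℤ}
    (h : FramedBlowUp (m.seqWeights γ) Y c d) : ∃ m' : Marked.{u, v} S, m'.IsBlowDown m ∧
      m'.seqWeights γ = Y ∧ IsMoveAt γ c d m m' := by
  generalize hX : m.seqWeights γ = X at h
  cases h with
  | empty =>
    have p := (m.path γ).isPSeq
    rw [seqWeights_eq] at hX
    have hX' : ∀ x ∈ (m.path γ).verts, ¬ deg m.forest.graph x < 3 := by
      simpa [listWeights] using hX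
    rcases p.eq_singleton_or with ⟨y, h, h0⟩ | ⟨a, t, z, h⟩
    · exact absurd (show deg m.forest.graph y < 3 by omega) (hX' y (by simp [h]))
    · rw [h] at p hX'
      obtain ⟨-, -, -, -, h2⟩ := isPSeq_cons_append_iff.1 p
      have ht : t = [] := by
        refine List.eq_nil_iff_forall_not_mem.2 fun u hu => hX' u (by simp [hu]) ?_
        rw [h2 u hu]
        omega
      subst ht
      have ha := hX' a (by simp)
      have hz := hX' z (by simp)
      obtain ⟨c, d, h1, rfl, rfl, h2⟩ := m.blowUpEdge_move (l₁ := []) (l₂ := []) h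
      rw [if_pos (by omega), if_pos (by omega)] at h2
      refine ⟨_, m.blowUpEdge_isBlowDown (l₁ := []) (l₂ := []) h, ?_,
        fun δ => m.blowUpEdge_seqWeights_of_ne (l₁ := []) (l₂ := []) h, h2⟩
      rw [blowUpEdge_seqWeights_self]
      simp [ha, hz, listWeights_nil]
  | left x l => exact m.exists_blowUp_left hX
  | right l x =>
    obtain ⟨m', h1, h2, h3⟩ := m.exists_blowUp_left (γ := γ.rev) (x := x) (l := l.reverse)
      (by rw [seqWeights_rev, hX]; simp)
    refine ⟨m', h1, ?_, h3.rev⟩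
    rw [← γ.rev_rev, seqWeights_rev, h2]
    simp
  | middle L x y R =>
    rw [seqWeights_eq, listWeights, List.map_eq_append_iff] at hX
    obtain ⟨f₁, f₂, hf, rfl, hf₂⟩ := hX
    obtain ⟨a, f₃, rfl, rfl, hf₃⟩ := List.map_eq_cons_iff.1 hf₂
    obtain ⟨b, f₂, rfl, rfl, rfl⟩ := List.map_eq_cons_iff.1 hf₃
    obtain ⟨g₁, g₂, hg, rfl, hg₂⟩ := List.filter_eq_append_iff.1 hf
    obtain ⟨k₁, k₂, rfl, hk₁, ha, hk₂⟩ := List.filter_eq_cons_iff.1 hg₂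
    obtain ⟨j₁, j₂, rfl, hj₁, hb, rfl⟩ := List.filter_eq_cons_iff.1 hk₂
    -- Consecutive weights come from consecutive vertices: a vertex skipped by the filter has degree
    -- > 2 and cannot be interior to a path.
    have hj : j₁ = [] := by
      rcases j₁ with _ | ⟨u, j₁⟩
      · rfl
      · have := PSeq.eq_nil_right (γ := m.path γ) (l₁ := g₁ ++ k₁) (a := a) (b := u)
          (l₂ := j₁ ++ b :: j₂) (by rw [hg]; simp) (by
            have := hj₁ u (by simp)
            simp at this
            omega)
        simp at this
    subst hj
    simp at ha hb
    have h : (m.path γ).verts = (g₁ ++ k₁) ++ a :: b :: j₂ := by rw [hg]; simp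
    obtain ⟨c, d, h1, rfl, rfl, h2⟩ := m.blowUpEdge_move h
    rw [if_neg (by omega), if_neg (by omega)] at h2
    refine ⟨_, m.blowUpEdge_isBlowDown h, ?_, fun δ => m.blowUpEdge_seqWeights_of_ne h, h2⟩
    have hk : listWeights m.forest.graph m.forest.weight k₁ = [] := by
      rw [listWeights, List.map_eq_nil_iff, List.filter_eq_nil_iff]
      exact hk₁
    rw [blowUpEdge_seqWeights_self, listWeights_append, hk]
    simp [ha, hb, listWeights]

theorem isPseudoMinimal {m : Marked.{u, v} S}
    (h : ∀ γ, SeqEquiv (m.seqWeights γ) [] → γ.IsTypePlusPlus) : m.forest.IsPseudoMinimal := by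
  intro δ hδ
  obtain ⟨γ, rfl⟩ := m.path_surjective δ
  obtain ⟨h1, h2⟩ := h γ hδ
  rw [PSeq.IsTypePlusPlus, path_first, path_last]
  exact ⟨m.two_lt_deg_iff.2 h1, m.two_lt_deg_iff.2 h2⟩

/-- The element of `FO⁺(S)` given by a pseudo-minimal forest with a skeletal map. -/
def toFOPlus (m : Marked.{u, v} S)
    (h : ∀ γ, SeqEquiv (m.seqWeights γ) [] → γ.IsTypePlusPlus) : FOPlus.{u, v} S where
  forest := m.forest
  isPseudoMinimal := isPseudoMinimal h
  σ := m.σ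
  isSkeletal := m.isSkeletal

end Marked

/-! ### Equivalence in FO⁺(S) in terms of states -/

namespace FOPlus

/-- The underlying forest with a skeletal map. -/
def toMarked (p : FOPlus.{u, v} S) : Marked.{u, v} S := ⟨p.forest, p.σ, p.isSkeletal⟩

/-- The edge map and the vertex weights. -/
noncomputable def state (p : FOPlus.{u, v} S) : WState S := (p.edgeMap, p.vertexWeights)

theorem edgeMap_apply (p : FOPlus.{u, v} S) (γ : PSeq S.graph) :
    p.edgeMap.toFun γ = p.toMarked.seqWeights γ := rfl

theorem IsIsomorphic.state_eq {p p' : FOPlus.{u, v} S} (h : p.IsIsomorphic p') :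
    p'.state = p.state := by
  have h' : p.toMarked.IsIsomorphic p'.toMarked := h
  exact Prod.ext (EdgeMap.ext h'.seqWeights_eq) h'.vertexWeights_eq

theorem isIsomorphic_of_state_eq {p p' : FOPlus.{u, v} S} (h : p'.state = p.state) :
    p.IsIsomorphic p' :=
  Marked.isIsomorphic_of_weights_eq (m := p.toMarked) (m' := p'.toMarked)
    (congrArg (fun t => t.1.toFun) h) (congrArg Prod.snd h)

theorem IsBlowDown.isMove {p p' : FOPlus.{u, v} S} (h : p.IsBlowDown p') :
    IsMove p'.state p.state := by
  have h' : p.toMarked.IsBlowDown p'.toMarked := h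
  obtain ⟨γ, c, d, h1, h2, h3⟩ := h'.exists_isMoveAt
  exact ⟨γ, c, d, h1, h2, h3⟩

theorem exists_isBlowDown_of_isMove {p : FOPlus.{u, v} S} {t : WState S} (h : IsMove p.state t) :
    ∃ p', p'.state = t ∧ IsBlowDown p' p := by
  obtain ⟨γ, c, d, h1, h2, h3⟩ := h
  obtain ⟨m', hm, h4, h5, h6⟩ := p.toMarked.exists_blowUp h1
  have hs : ∀ δ, m'.seqWeights δ = t.1.toFun δ := by
    intro δ
    by_cases hδ : δ = γ
    · rw [hδ, h4]
    by_cases hδ' : δ = γ.rev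
    · rw [hδ', Marked.seqWeights_rev, h4, t.1.rev]
    · rw [h5 δ hδ hδ', h2 δ hδ hδ']
      rfl
  refine ⟨m'.toFOPlus (fun δ hδ => t.1.typePlusPlus δ (by rwa [← hs])), ?_, hm⟩
  refine Prod.ext (EdgeMap.ext (funext hs)) ?_
  exact h6.trans h3.symm

theorem Equivalent.stateEquiv {p p' : FOPlus.{u, v} S} (h : p.Equivalent p') :
    StateEquiv p.state p'.state := by
  induction h with
  | rel p p' h =>
    rcases h with h | h
    · rw [h.state_eq]
      exact .refl _
    · exact .symm _ _ (.rel _ _ h.isMove)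
  | refl p => exact .refl _
  | symm p p' _ ih => exact .symm _ _ ih
  | trans p p' p'' _ _ ih ih' => exact .trans _ _ _ ih ih'

/-- Realizability of all states is needed for transitivity, to represent the intermediate states of
a chain by actual pairs. -/
theorem equivalent_of_stateEquiv (hreal : ∀ t : WState S, ∃ p : FOPlus.{u, v} S, p.state = t)
    {t t' : WState S} (h : StateEquiv t t') :
    ∀ p p' : FOPlus.{u, v} S, p.state = t → p'.state = t' → p.Equivalent p' := by
  induction h with
  | rel t t' h =>
    rintro p p' rfl rfl
    obtain ⟨q, hq, hb⟩ := exists_isBlowDown_of_isMove h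
    exact .trans _ q _ (.symm _ _ (.rel _ _ (Or.inr hb)))
      (.rel _ _ (Or.inl (isIsomorphic_of_state_eq hq.symm)))
  | refl t =>
    rintro p p' rfl h
    exact .rel _ _ (Or.inl (isIsomorphic_of_state_eq h))
  | symm t t' _ ih => exact fun p p' h h' => .symm _ _ (ih _ _ h' h)
  | trans t t' t'' _ _ ih ih' =>
    intro p p'' h h''
    obtain ⟨p', h'⟩ := hreal t'
    exact .trans _ p' _ (ih _ _ h h') (ih' _ _ h' h'')

end FOPlus

end Blowing

/-! ### Realization of arbitrary states -/

namespace Blowing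

variable {S : Skeleton.{u}}

theorem Skeleton.pSeq_ext_of_deg_le {γ δ : PSeq S.graph} (h : γ.first = δ.first)
    (hd : ¬ 2 < deg S.graph γ.first.1) : γ = δ := by
  have h1 : deg S.graph γ.first.1 = 1 := by
    have := S.deg_ne γ.first.1
    omega
  obtain ⟨p, hp⟩ := Set.ncard_eq_one.1 h1
  have e1 : γ.last.1 ∈ S.graph.neighborSet γ.first.1 := Skeleton.adj_first_last γ
  have e2 : δ.last.1 ∈ S.graph.neighborSet γ.first.1 := by
    rw [h]
    exact Skeleton.adj_first_last δ
  rw [hp] at e1 e2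
  exact Skeleton.pSeq_ext h (Subtype.ext (e1.trans e2.symm))

theorem deg_induce_of_forall {V : Type v} {G : SimpleGraph V} {s : Set V} {x : s}
    (h : ∀ y, G.Adj x y → y ∈ s) : deg (G.induce s) x = deg G x.1 := by
  unfold deg
  rw [← Set.ncard_image_of_injective _ Subtype.val_injective]
  congr 1
  ext y
  constructor
  · rintro ⟨y, hy, rfl⟩
    exact hy
  · exact fun hy => ⟨⟨y, h y hy⟩, hy, rfl⟩

/-- Realization of the weights, when the elements of `P(S)` carry as few weights as possible. -/
theorem Marked.exists_weights_eq_of_minimal (W : PSeq S.graph → List ℤ)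
    (hrev : ∀ γ, W γ.rev = (W γ).reverse) (w : VtxGt2 S.graph → ℤ)
    (h1 : ∀ γ, 2 < deg S.graph γ.first.1 → 2 < deg S.graph γ.last.1 → W γ = [])
    (h2 : ∀ γ, 2 < deg S.graph γ.first.1 → ¬ 2 < deg S.graph γ.last.1 → (W γ).length = 1)
    (h3 : ∀ γ, ¬ 2 < deg S.graph γ.first.1 → ¬ 2 < deg S.graph γ.last.1 →
      (W γ).length = 1 ∨ (W γ).length = 2) :
    ∃ m : Marked.{u, u} S, m.seqWeights = W ∧ m.vertexWeights = w := by
  classical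
  -- The numbering only breaks ties: it selects which of two leaves joined by an edge is removed
  -- when they must share one vertex.
  obtain ⟨e⟩ : Nonempty (S.V ↪ ℕ) := ⟨(Finite.equivFin S.V).toEmbedding.trans Fin.valEmbedding⟩
  -- An isolated edge of S carrying a single weight has to be contracted to a point. `P` describes
  -- these edges and `R` the end of each that is deleted; the forest is the subgraph on the
  -- remaining vertices.
  let P : S.V → S.V → Prop := fun x y => deg S.graph x = 1 ∧ deg S.graph y = 1 ∧
    ∃ h : S.graph.Adj x y, (W (Skeleton.pair h)).length = 1
  let R : S.V → Prop := fun x => ∃ y, P x y ∧ e x < e y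
  have Psymm : ∀ {x y}, P x y → P y x := by
    rintro x y ⟨hx, hy, h, hW⟩
    refine ⟨hy, hx, h.symm, ?_⟩
    have : Skeleton.pair h.symm = (Skeleton.pair h).rev := rfl
    rw [this, hrev, List.length_reverse, hW]
  have uniq : ∀ {x y z}, deg S.graph x = 1 → S.graph.Adj x y → S.graph.Adj x z → y = z := by
    intro x y z hx hy hz
    obtain ⟨p, hp⟩ := Set.ncard_eq_one.1 hx
    have e1 : y ∈ S.graph.neighborSet x := hy
    have e2 : z ∈ S.graph.neighborSet x := hz
    rw [hp] at e1 e2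
    exact e1.trans e2.symm
  have Puniq : ∀ {x y z}, P x y → S.graph.Adj x z → y = z := fun h h' => uniq h.1 h.2.2.1 h'
  have PR : ∀ {x y}, P x y → (R x ∧ ¬ R y) ∨ (¬ R x ∧ R y) := by
    have aux : ∀ {x y}, P x y → e x < e y → R x ∧ ¬ R y := by
      rintro x y h hlt
      refine ⟨⟨y, h, hlt⟩, ?_⟩
      rintro ⟨z, hz, hlt'⟩
      have := Puniq hz h.2.2.1.symm
      subst this
      omega
    intro x y h
    rcases lt_trichotomy (e x) (e y) with hlt | he | hlt
    · exact Or.inl (aux h hlt)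
    · exact absurd (e.injective he) h.2.2.1.ne
    · exact Or.inr (aux (Psymm h) hlt).symm
  have RP : ∀ {x y}, S.graph.Adj x y → R x → P x y := by
    rintro x y h ⟨z, hz, -⟩
    rwa [← Puniq hz h]
  let s : Set S.V := {x | ¬ R x}
  let G : SimpleGraph s := S.graph.induce s
  have hG : G.IsAcyclic := S.isAcyclic.induce s
  have deg_P : ∀ (x : s) {y}, P x.1 y → deg G x = 0 := by
    intro x y h
    refine (Set.ncard_eq_zero (Set.toFinite _)).2 (Set.eq_empty_iff_forall_notMem.2 ?_)
    intro z hz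
    have := Puniq h hz
    rcases PR h with h' | h'
    · exact x.2 h'.1
    · rw [this] at h'
      exact z.2 h'.2
  have deg_nP : ∀ x : s, (∀ y, ¬ P x.1 y) → deg G x = deg S.graph x.1 := fun x h =>
    deg_induce_of_forall fun y hy hR => h y (Psymm (RP hy.symm hR))
  have deg_ne : ∀ x : s, deg G x ≠ 2 := by
    intro x
    by_cases h : ∃ y, P x.1 y
    · obtain ⟨y, h⟩ := h
      rw [deg_P x h]
      omega
    · rw [deg_nP x (not_exists.1 h)]
      exact (S.deg_ne _).2
  -- The retraction of S onto the surviving vertices: it fixes them and sends a deleted vertex to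
  -- its partner.
  have hρ : ∀ x : S.V, ∃ v : s, (¬ R x → v.1 = x) ∧ (R x → P x v.1) := by
    intro x
    by_cases h : R x
    · obtain ⟨y, hy, -⟩ := id h
      refine ⟨⟨y, ?_⟩, fun h' => absurd h h', fun _ => hy⟩
      rcases PR hy with h' | h'
      · exact h'.2
      · exact absurd h h'.1
    · exact ⟨⟨x, h⟩, fun _ => rfl, fun h' => absurd h' h⟩
  choose ρ hρ1 hρ2 using hρ
  let σ : VtxNe2 S.graph → VtxNe2 G := fun x => ⟨ρ x.1, deg_ne _⟩
  have hf : ∀ γ : PSeq S.graph, ∃ δ : PSeq G, δ.first = σ γ.first ∧ δ.last = σ γ.last ∧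
      (P γ.first.1 γ.last.1 → δ.verts = [ρ γ.first.1]) ∧
      (¬ P γ.first.1 γ.last.1 → δ.verts = [ρ γ.first.1, ρ γ.last.1] ∧
        (ρ γ.first.1).1 = γ.first.1 ∧ (ρ γ.last.1).1 = γ.last.1) := by
    intro γ
    have hadj := Skeleton.adj_first_last γ
    by_cases h : P γ.first.1 γ.last.1
    · have heq : ρ γ.first.1 = ρ γ.last.1 := by
        rcases PR h with h' | h'
        · exact Subtype.ext ((Puniq (hρ2 _ h'.1) hadj).trans (hρ1 _ h'.2).symm)
        · exact Subtype.ext ((hρ1 _ h'.1).trans (Puniq (hρ2 _ h'.2) hadj.symm).symm)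
      have hd : deg G (ρ γ.first.1) = 0 := by
        rcases PR h with h' | h'
        · rw [heq]
          exact deg_P _ (by rw [hρ1 _ h'.2]; exact Psymm h)
        · exact deg_P _ (by rw [hρ1 _ h'.1]; exact h)
      exact ⟨⟨[ρ γ.first.1], Or.inl ⟨_, rfl, hd⟩⟩, rfl, Subtype.ext heq, fun _ => rfl,
        fun h' => absurd h h'⟩
    · have e1 := hρ1 _ (fun hR => h (RP hadj hR))
      have e2 := hρ1 _ (fun hR => h (Psymm (RP hadj.symm hR)))
      have hadj' : G.Adj (ρ γ.first.1) (ρ γ.last.1) := by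
        change S.graph.Adj (ρ γ.first.1).1 (ρ γ.last.1).1
        rwa [e1, e2]
      refine ⟨⟨[ρ γ.first.1, ρ γ.last.1], ?_⟩, rfl, rfl, fun h' => absurd h' h,
        fun _ => ⟨rfl, e1, e2⟩⟩
      exact (isPSeq_cons_append_iff (m := [])).2
        ⟨by simpa using hadj'.ne, by simpa using hadj', deg_ne _, deg_ne _, by simp⟩
  choose f f1 f2 f3 f4 using hf
  have hσ : IsSkeletal σ := by
    refine isSkeletal_of_cover hG σ f f1 f2 ?_ ?_ ?_
    · intro a b hab
      have hab' : S.graph.Adj a.1 b.1 := hab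
      have hnP : ¬ P a.1 b.1 := by
        intro h
        rcases PR h with h' | h'
        · exact a.2 h'.1
        · exact b.2 h'.2
      obtain ⟨h, e1, e2⟩ := f4 (Skeleton.pair hab') hnP
      refine ⟨Skeleton.pair hab', [], [], Or.inl ?_⟩
      rw [h, Subtype.ext e1, Subtype.ext e2]
      rfl
    · intro a ha
      have : ∃ y, P a.1 y := by
        by_contra h
        rw [deg_nP a (not_exists.1 h)] at ha
        exact (S.deg_ne _).1 ha
      obtain ⟨y, hy⟩ := this
      refine ⟨Skeleton.pair hy.2.2.1, ?_⟩
      rw [f3 (Skeleton.pair hy.2.2.1) hy, List.mem_singleton]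
      exact (Subtype.ext (hρ1 a.1 a.2)).symm
    · intro x y hne heq
      have heq' : ρ x.1 = ρ y.1 := congrArg Subtype.val heq
      have key : ∀ {x y : S.V}, x ≠ y → ρ x = ρ y → R x → S.graph.Adj x y := by
        intro x y hne heq hx
        have hP := hρ2 x hx
        by_cases hy : R y
        · have hP' := hρ2 y hy
          rw [← heq] at hP'
          exact absurd (Puniq (Psymm hP) hP'.2.2.1.symm) hne
        · rw [heq, hρ1 y hy] at hP
          exact hP.2.2.1
      have hne' : x.1 ≠ y.1 := fun h => hne (Subtype.ext h)
      by_cases hx : R x.1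
      · exact key hne' heq' hx
      · by_cases hy : R y.1
        · exact (key hne'.symm heq'.symm hy).symm
        · exact absurd ((hρ1 _ hx).symm.trans ((congrArg _ heq').trans (hρ1 _ hy))) hne'
  choose Γ hΓ using fun x : S.V => exists_first_eq (vtx x)
  -- A leaf receives the first weight of the sequence that starts there. The default 0 is never
  -- used, as sequences with a leaf at an end are nonempty by `h2` and `h3`.
  let ω : S.V → ℤ := fun x => if h : 2 < deg S.graph x then w ⟨x, h⟩ else (W (Γ x)).headD 0
  have hω : ∀ γ : PSeq S.graph, ¬ 2 < deg S.graph γ.first.1 →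
      ω γ.first.1 = (W γ).headD 0 := by
    intro γ hd
    have : γ = Γ γ.first.1 := Skeleton.pSeq_ext_of_deg_le (hΓ _).symm hd
    change (if h : _ then _ else _) = _
    rw [dif_neg hd, ← this]
  have hω' : ∀ γ : PSeq S.graph, ¬ 2 < deg S.graph γ.last.1 →
      ω γ.last.1 = (W γ).reverse.headD 0 := by
    intro γ hd
    have := hω γ.rev (by rwa [PSeq.rev_first])
    rwa [PSeq.rev_first, hrev] at this
  let m : Marked.{u, u} S := ⟨⟨⟨s, inferInstance, G, fun v => ω v.1⟩, hG⟩, σ, hσ⟩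
  refine ⟨m, ?_, ?_⟩
  · funext γ
    have hm : m.path γ = f γ := m.path_eq (f1 γ) (f2 γ)
    have hd1 : deg G (ρ γ.first.1) < 3 ↔ ¬ 2 < deg S.graph γ.first.1 := by
      have : 2 < deg G (ρ γ.first.1) ↔ _ := m.two_lt_deg_iff (x := γ.first)
      omega
    have hd2 : deg G (ρ γ.last.1) < 3 ↔ ¬ 2 < deg S.graph γ.last.1 := by
      have : 2 < deg G (ρ γ.last.1) ↔ _ := m.two_lt_deg_iff (x := γ.last)
      omega
    have hs : m.seqWeights γ = listWeights G (fun v => ω v.1) (f γ).verts := by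
      rw [m.seqWeights_eq, hm]
    rw [hs]
    by_cases h : P γ.first.1 γ.last.1
    · rw [f3 γ h, listWeights_cons, if_pos (by rw [hd1, h.1]; omega), listWeights_nil]
      have hγ : Skeleton.pair h.2.2.1 = γ := Skeleton.pSeq_ext rfl rfl
      obtain ⟨c, hc⟩ := List.length_eq_one_iff.1 h.2.2.2
      rw [hγ] at hc
      have e : ω (ρ γ.first.1).1 = c := by
        rcases PR h with h' | h'
        · rw [Puniq (hρ2 _ h'.1) (Skeleton.adj_first_last γ), hω' γ (by rw [h.2.1]; omega), hc]
          rfl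
        · rw [hρ1 _ h'.1, hω γ (by rw [h.1]; omega), hc]
          rfl
      simp [e, hc]
    · obtain ⟨hv, e1, e2⟩ := f4 γ h
      rw [hv, listWeights_cons, listWeights_cons, listWeights_nil]
      simp only [e1, e2, hd1, hd2]
      by_cases c1 : 2 < deg S.graph γ.first.1 <;> by_cases c2 : 2 < deg S.graph γ.last.1
      · simp [c1, c2, h1 γ c1 c2]
      · obtain ⟨c, hc⟩ := List.length_eq_one_iff.1 (h2 γ c1 c2)
        simp [c1, c2, hω' γ c2, hc]
      · have := h2 γ.rev (by rwa [PSeq.rev_first]) (by rwa [PSeq.rev_last])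
        rw [hrev, List.length_reverse] at this
        obtain ⟨c, hc⟩ := List.length_eq_one_iff.1 this
        simp [c1, c2, hω γ c1, hc]
      · have hl : (W γ).length = 2 := by
          refine (h3 γ c1 c2).resolve_left fun hl => h ?_
          have i1 := S.deg_ne γ.first.1
          have i2 := S.deg_ne γ.last.1
          refine ⟨by omega, by omega, Skeleton.adj_first_last γ, ?_⟩
          rwa [show Skeleton.pair (Skeleton.adj_first_last γ) = γ from Skeleton.pSeq_ext rfl rfl]
        obtain ⟨c, d, hc⟩ := List.length_eq_two.1 hl
        simp [c1, c2, hω γ c1, hω' γ c2, hc]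
  · funext x
    have hx : ¬ R x.1 := by
      rintro ⟨y, hy, -⟩
      have := hy.1
      have := x.2
      omega
    change ω (ρ x.1).1 = _
    rw [hρ1 _ hx]
    exact dif_pos x.2

namespace Marked

/-- Insertion of a vertex of arbitrary weight next to the first vertex of the path of `γ₀`. -/
theorem exists_insert (m : Marked.{u, v} S) {γ₀ : PSeq S.graph} {a b : m.forest.V}
    {t : List m.forest.V} (h : (m.path γ₀).verts = a :: b :: t) (x : ℤ) :
    ∃ m' : Marked.{u, v} S, m'.seqWeights γ₀ =
        (if 2 < deg S.graph γ₀.first.1 then x :: m.seqWeights γ₀ else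
          (m.seqWeights γ₀).take 1 ++ x :: (m.seqWeights γ₀).drop 1) ∧
      (∀ γ, γ ≠ γ₀ → γ ≠ γ₀.rev → m'.seqWeights γ = m.seqWeights γ) ∧
      m'.vertexWeights = m.vertexWeights := by
  let w : Option m.forest.V → ℤ := fun y => y.elim x m.forest.weight
  refine ⟨m.subdivide (l₁ := []) h w, ?_,
    fun γ => m.subdivide_seqWeights_of_ne (l₁ := []) h w (fun _ _ _ _ => rfl), rfl⟩
  rw [m.subdivide_seqWeights_self (l₁ := []) h w (fun _ _ _ _ => rfl), m.seqWeights_eq, h,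
    listWeights_cons, listWeights_cons, listWeights_nil]
  have hd := m.two_lt_deg_iff (x := γ₀.first)
  rw [m.σ_first_eq h] at hd
  by_cases ha : 2 < deg m.forest.graph a
  · rw [if_pos (hd.1 ha)]
    simp [show ¬ deg m.forest.graph a < 3 by omega, w]
  · rw [if_neg (mt hd.2 ha)]
    simp [show deg m.forest.graph a < 3 by omega, w]

/-- Every system of weights is that of a forest with a skeletal map. -/
theorem exists_weights_eq (W : PSeq S.graph → List ℤ) (hrev : ∀ γ, W γ.rev = (W γ).reverse)
    (hne : ∀ γ, W γ = [] → γ.IsTypePlusPlus) (w : VtxGt2 S.graph → ℤ) :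
    ∃ m : Marked.{u, u} S, m.seqWeights = W ∧ m.vertexWeights = w := by
  classical
  have : Fintype (PSeq S.graph) := Fintype.ofFinite _
  induction hn : ∑ γ, (W γ).length using Nat.strong_induction_on generalizing W with
  | _ n ih =>
    -- one step of the induction
    have step : ∀ (γ₀ : PSeq S.graph) (Y : List ℤ) (x : ℤ), Y.length < (W γ₀).length →
        (Y = [] → γ₀.IsTypePlusPlus) →
        (¬ 2 < deg S.graph γ₀.first.1 → ¬ 2 < deg S.graph γ₀.last.1 → 2 ≤ Y.length) →
        (W γ₀ = if 2 < deg S.graph γ₀.first.1 then x :: Y else Y.take 1 ++ x :: Y.drop 1) →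
        ∃ m : Marked.{u, u} S, m.seqWeights = W ∧ m.vertexWeights = w := by
      intro γ₀ Y x hlt hY hY2 hW
      -- One term is deleted from W(γ₀), the shorter system is realized by induction, and the term
      -- is put back by subdividing the first edge of the path of γ₀.
      let W' : PSeq S.graph → List ℤ := fun δ =>
        if δ = γ₀ then Y else if δ = γ₀.rev then Y.reverse else W δ
      have hW'0 : W' γ₀ = Y := if_pos rfl
      have hle : ∀ δ, (W' δ).length ≤ (W δ).length := by
        intro δ
        simp only [W']
        split_ifs with h1 h2
        · rw [h1]
          exact hlt.le
        · rw [h2, hrev, List.length_reverse, List.length_reverse]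
          exact hlt.le
        · exact le_rfl
      obtain ⟨m, hm, hmw⟩ := ih (∑ γ, (W' γ).length)
        (by
          rw [← hn]
          exact Finset.sum_lt_sum (fun δ _ => hle δ) ⟨γ₀, Finset.mem_univ _, by rwa [hW'0]⟩)
        W' (by
          intro δ
          simp only [W']
          by_cases h1 : δ = γ₀
          · subst h1
            simp [Skeleton.rev_ne]
          · by_cases h2 : δ = γ₀.rev
            · subst h2
              simp [PSeq.rev_rev, Skeleton.rev_ne]
            · rw [if_neg h1, if_neg h2, if_neg, if_neg, hrev]
              · exact fun h => h1 (PSeq.rev_injective h)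
              · exact fun h => h2 (PSeq.eq_rev_comm.1 h.symm))
        (by
          intro δ hδ
          simp only [W'] at hδ
          split_ifs at hδ with h1 h2
          · rw [h1]
            exact hY hδ
          · obtain ⟨h3, h4⟩ := hY (List.reverse_eq_nil_iff.1 hδ)
            rw [h2, PSeq.IsTypePlusPlus, PSeq.rev_first, PSeq.rev_last]
            exact ⟨h4, h3⟩
          · exact hne δ hδ)
        rfl
      -- There must be an edge to subdivide. A one-vertex path has one weight and neither end of γ₀
      -- is a branch vertex, but then Y was required to have at least two terms.
      have hpath : ∃ a b t, (m.path γ₀).verts = a :: b :: t := by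
        rcases (m.path γ₀).isPSeq.eq_singleton_or with ⟨y, h, h0⟩ | ⟨a, t, z, h⟩
        · exfalso
          have e1 := m.path_first γ₀
          have e2 := m.path_last γ₀
          have e3 : (m.path γ₀).first.1 = y := by simp [PSeq.first, h]
          have e4 : (m.path γ₀).last.1 = y := by simp [PSeq.last, h]
          rw [e1] at e3
          rw [e2] at e4
          have d1 := m.two_lt_deg_iff (x := γ₀.first)
          have d2 := m.two_lt_deg_iff (x := γ₀.last)
          rw [e3, h0] at d1
          rw [e4, h0] at d2
          have := hY2 (by omega) (by omega)
          have hs : m.seqWeights γ₀ = Y := by rw [hm, hW'0]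
          rw [m.seqWeights_eq, h, listWeights_cons, if_pos (by omega), listWeights_nil] at hs
          rw [← hs] at this
          simp at this
        · rcases t with _ | ⟨b, t⟩
          · exact ⟨a, z, [], h⟩
          · exact ⟨a, b, _, h⟩
      obtain ⟨a, b, t, h⟩ := hpath
      obtain ⟨m', h1, h2, h3⟩ := m.exists_insert h x
      refine ⟨m', ?_, h3.trans hmw⟩
      have e0 : m'.seqWeights γ₀ = W γ₀ := by rw [h1, hm, hW'0, hW]
      funext δ
      by_cases c1 : δ = γ₀
      · rw [c1, e0]
      by_cases c2 : δ = γ₀.rev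
      · rw [c2, seqWeights_rev, e0, hrev]
      · rw [h2 δ c1 c2, hm]
        simp [W', c1, c2]
    by_cases c1 : ∃ γ, 2 < deg S.graph γ.first.1 ∧ 2 < deg S.graph γ.last.1 ∧ W γ ≠ []
    · obtain ⟨γ, h1, h2, h3⟩ := c1
      obtain ⟨x, Y, hY⟩ := List.exists_cons_of_ne_nil h3
      exact step γ Y x (by simp [hY]) (fun _ => ⟨h1, h2⟩) (fun h => absurd h1 h)
        (by rw [if_pos h1, hY])
    by_cases c2 : ∃ γ, 2 < deg S.graph γ.first.1 ∧ ¬ 2 < deg S.graph γ.last.1 ∧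
        (W γ).length ≠ 1
    · obtain ⟨γ, h1, h2, h3⟩ := c2
      have h4 : W γ ≠ [] := fun h => h2 (hne γ h).2
      obtain ⟨x, Y, hY⟩ := List.exists_cons_of_ne_nil h4
      refine step γ Y x (by simp [hY]) (fun h => ?_) (fun h => absurd h1 h) (by rw [if_pos h1, hY])
      rw [hY, h] at h3
      exact absurd rfl h3
    by_cases c3 : ∃ γ, ¬ 2 < deg S.graph γ.first.1 ∧ ¬ 2 < deg S.graph γ.last.1 ∧
        (W γ).length ≠ 1 ∧ (W γ).length ≠ 2
    · obtain ⟨γ, h1, h2, h3, h4⟩ := c3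
      obtain ⟨y, x, z, Y, hY⟩ : ∃ y x z Y, W γ = y :: x :: z :: Y := by
        rcases hγ : W γ with _ | ⟨y, _ | ⟨x, _ | ⟨z, Y⟩⟩⟩
        · exact absurd (hne γ hγ).1 h1
        · simp [hγ] at h3
        · simp [hγ] at h4
        · exact ⟨y, x, z, Y, rfl⟩
      exact step γ (y :: z :: Y) x (by simp [hY]) (by simp) (by simp) (by rw [if_neg h1, hY]; rfl)
    -- No further reduction applies: the lengths are 0, 1, and 1 or 2 according to the types of the
    -- ends.
    push Not at c1 c2 c3
    refine exists_weights_eq_of_minimal W hrev w c1 (fun γ h h' => c2 γ h (by omega)) ?_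
    intro γ h h'
    by_contra! hcon
    exact hcon.2 (c3 γ (by omega) (by omega) hcon.1)

end Marked

/-- An empty value is equivalent to ∅, so an edge map allows it only on type (+,+); the same
condition on types makes the realizing forest pseudo-minimal. -/
theorem FOPlus.exists_state_eq (t : WState S) : ∃ p : FOPlus.{u, u} S, p.state = t := by
  obtain ⟨m, h1, h2⟩ := Marked.exists_weights_eq t.1.toFun t.1.rev
    (fun γ h => t.1.typePlusPlus γ (by rw [h]; exact .refl _)) t.2
  exact ⟨m.toFOPlus fun γ h => t.1.typePlusPlus γ (by rwa [← h1]),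
    Prod.ext (EdgeMap.ext h1) h2⟩

end Blowing

/-! ### Canonical representatives and the map Q -/

namespace Blowing

variable {S : Skeleton.{u}}

/-- The element of `𝔛(S)` represented by an edge map and vertex weights. -/
def WState.toXSet (t : WState S) : XSet S := ⟨Quotient.mk _ t.1, (ZSub S (Quotient.mk _ t.1)).mkQ t.2⟩

theorem sigma_mkQ_eq_iff {ω ω' : Omega S} {w w' : VtxGt2 S.graph → ℤ} :
    (⟨ω, (ZSub S ω).mkQ w⟩ : XSet S) = ⟨ω', (ZSub S ω').mkQ w'⟩ ↔
      ω = ω' ∧ w' - w ∈ ZSub S ω := by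
  constructor
  · intro h
    obtain rfl : ω = ω' := congrArg Sigma.fst h
    refine ⟨rfl, ?_⟩
    have h' := eq_of_heq (Sigma.mk.inj h).2
    exact (Submodule.Quotient.eq _).1 h'.symm
  · rintro ⟨rfl, h⟩
    exact congrArg (Sigma.mk ω) ((Submodule.Quotient.eq _).2 h).symm

theorem WState.toXSet_eq_iff {t t' : WState S} : t.toXSet = t'.toXSet ↔
    (∀ γ, SeqEquiv (t.1.toFun γ) (t'.1.toFun γ)) ∧ t'.2 - t.2 ∈ ZSub S (Quotient.mk _ t.1) :=
  sigma_mkQ_eq_iff.trans (and_congr_left fun _ => Quotient.eq)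

namespace FOPlus

theorem isCanonical_iff (p : FOPlus.{u, v} S) : p.forest.IsCanonical ↔ p.edgeMap.IsCanonical := by
  have e : ∀ γ, p.forest.pathWeights (p.toMarked.path γ).rev = (p.edgeMap.toFun γ).reverse := by
    intro γ
    rw [← p.edgeMap.rev, edgeMap_apply, Marked.seqWeights, Marked.path_rev]
    rfl
  constructor
  · intro h γ
    rw [← e]
    exact h (p.toMarked.path γ)
  · intro h δ
    obtain ⟨γ, rfl⟩ := p.toMarked.path_surjective δ
    have := h γ
    rwa [← e] at this

theorem equivalent_iff {p p' : FOPlus.{u, u} S} :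
    p.Equivalent p' ↔ StateEquiv p.state p'.state :=
  ⟨Equivalent.stateEquiv, fun h => equivalent_of_stateEquiv exists_state_eq h _ _ rfl rfl⟩

theorem equivalent_iff_of_isCanonical {p p' : FOPlus.{u, u} S} (hp : p.forest.IsCanonical)
    (hp' : p'.forest.IsCanonical) : p.Equivalent p' ↔ p.state.toXSet = p'.state.toXSet := by
  rw [equivalent_iff, WState.toXSet_eq_iff]
  exact stateEquiv_iff_of_isCanonical (t := p.state) (t' := p'.state) (p.isCanonical_iff.1 hp)
    (p'.isCanonical_iff.1 hp')

/-- Canonicity concerns only the edge map, so it is achieved by moves on the state; a pair realizing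
the final state is then equivalent to p. -/
theorem exists_isCanonical (p : FOPlus.{u, u} S) :
    ∃ q : FOPlus.{u, u} S, p.Equivalent q ∧ q.forest.IsCanonical := by
  obtain ⟨W, hW, hc⟩ := p.edgeMap.exists_isCanonical
  obtain ⟨w, hw⟩ := exists_stateEquiv_of_edgeMap_equiv p.state W hW
  obtain ⟨q, hq⟩ := exists_state_eq (W, w)
  refine ⟨q, equivalent_iff.2 (by rwa [hq]), q.isCanonical_iff.2 ?_⟩
  have : q.edgeMap = W := congrArg Prod.fst hq
  rwa [this]

theorem exists_isCanonical_of_xSet (χ : XSet S) :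
    ∃ p : FOPlus.{u, u} S, p.forest.IsCanonical ∧ p.state.toXSet = χ := by
  obtain ⟨ω, η⟩ := χ
  obtain ⟨W, rfl⟩ := Quotient.exists_rep ω
  obtain ⟨W', hW, hc⟩ := W.exists_isCanonical
  have hω : (Quotient.mk _ W : Omega S) = Quotient.mk _ W' := Quotient.sound hW
  revert η
  rw [hω]
  intro η
  obtain ⟨w, rfl⟩ := Submodule.mkQ_surjective _ η
  obtain ⟨p, hp⟩ := exists_state_eq (W', w)
  refine ⟨p, p.isCanonical_iff.2 ?_, by rw [hp]; rfl⟩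
  have : p.edgeMap = W' := congrArg Prod.fst hp
  rwa [this]

theorem toXSet_state_of_mem {ω : Omega S} (p : FOPlusAt.{u, v} S ω) :
    p.1.state.toXSet = ⟨ω, (Tbar ω p).2⟩ := by
  obtain ⟨p, rfl⟩ := p
  rfl

end FOPlus

end Blowing

theorem mainTheorem2 (S : Blowing.Skeleton.{u}) :
    ∃! Q : Blowing.FOPlus.{u, u} S → Blowing.XSet S,
      Function.Surjective Q ∧
      (∀ p p' : Blowing.FOPlus.{u, u} S, p.Equivalent p' ↔ Q p = Q p') ∧
      (∀ (ω : Blowing.Omega S) (p : Blowing.FOPlus.FOPlusAt.{u, u} S ω),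
        p.1.forest.IsCanonical → Q p.1 = ⟨ω, (Blowing.FOPlus.Tbar ω p).2⟩) := by
  choose c hc hcan using fun p : Blowing.FOPlus.{u, u} S => p.exists_isCanonical
  have hQ : ∀ p p' : Blowing.FOPlus.{u, u} S,
      p.Equivalent p' ↔ (c p).state.toXSet = (c p').state.toXSet := by
    intro p p'
    rw [← Blowing.FOPlus.equivalent_iff_of_isCanonical (hcan p) (hcan p')]
    exact ⟨fun h => .trans _ _ _ (.symm _ _ (hc p)) (.trans _ _ _ h (hc p')),
      fun h => .trans _ _ _ (hc p) (.trans _ _ _ h (.symm _ _ (hc p')))⟩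
  have hcanon : ∀ p : Blowing.FOPlus.{u, u} S, p.forest.IsCanonical →
      (c p).state.toXSet = p.state.toXSet := fun p hp =>
    (Blowing.FOPlus.equivalent_iff_of_isCanonical (hcan p) hp).1 (.symm _ _ (hc p))
  -- Q(p) is the class of the state of a chosen canonical pair equivalent to p.
  refine ⟨fun p => (c p).state.toXSet, ⟨fun χ => ?_, hQ, fun ω p hp => ?_⟩, ?_⟩
  · obtain ⟨p, hp, rfl⟩ := Blowing.FOPlus.exists_isCanonical_of_xSet χ
    exact ⟨p, hcanon p hp⟩
  · exact (hcanon p.1 hp).trans (Blowing.FOPlus.toXSet_state_of_mem p)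
  · rintro Q ⟨-, h1, h2⟩
    funext p
    -- Uniqueness: Q takes the same value at p and at its canonical representative, where the second
    -- condition prescribes it.
    rw [(h1 p (c p)).1 (hc p)]
    exact (h2 _ ⟨c p, rfl⟩ (hcan p)).trans (Blowing.FOPlus.toXSet_state_of_mem ⟨c p, rfl⟩).symm
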